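/- For $A\in\mathbb{R}^{m\times n}$ and $B\in\mathbb{R}^{l\times n}$ let $$\|A\|_{2\mapsto 2;B}:=\sup_{\|Bv\|_2\le 1}\|Av\|_2\in[0,\infty],\qquad \|M\|_{2\mapsto 2}:=\sup_{\|w\|_2\le 1}\|Mw\|_2 ,$$ and let $B^+$ be the Moore–Penrose pseudoinverse of $B$. **Theorem.** (a) If $B$ is injective, or more generally if $\operatorname{Ker}(B)\subseteq\operatorname{Ker}(A)$, then both suprema below are finite and attained, and $$\max_{\|Bv\|_2\le 1}\|Av\|_2=\|AB^+\|_{2\mapsto 2}.$$ (b) This value can be evaluated in polynomial time with respect to $l,m,n$ and the binary representation size of the data. Precisely, on an integer random access machine with logarithmic (bit) cost: * there are one program and one polynomial $f$ such that, for all $l,m,n$, all rational matrices $A\in\mathbb{Q}^{m\times n}$, $B\in\mathbb{Q}^{l\times n}$ with $\operatorname{Ker}(B)\subseteq\operatorname{Ker}(A)$ and every rational $\varepsilon>0$, the program started on $(A,B,\varepsilon)$ halts with bit cost at most $f(l+m+n+L)$, where $L$ is the total binary length of the entries of $A$ and $B$ and of $\varepsilon$, and outputs a rational number $r$ with $\bigl|r-\|A\|_{2\mapsto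 2;B}\bigr|\le\varepsilon$; * there are one program and polynomials $f,g$ such that, for all such $A,B$ and every rational $t$, the program started on $(A,B,t)$ decides exactly whether $\|A\|_{2\mapsto 2;B}\le t$, in at most $g(l+m+n)$ steps and with bit cost at most $f(l+m+n+L)$, where $L$ is the total binary length of the entries of $A$ and $B$ and of $t$. (c) If $\operatorname{Ker}(B)\not\subseteq\operatorname{Ker}(A)$, then $\sup_{\|Bv\|_2\le 1}\|Av\|_2=\infty$. -/

import Mathlib

open scoped ENNReal

/-! ## Generalized matrix norms -/

section Norms

variable {l m n : ℕ}

/-- The vector `p`-norm on `ℝⁿ`. -/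
noncomputable def vecNorm (p : ℝ≥0∞) (v : Fin n → ℝ) : ℝ := ‖WithLp.toLp p v‖

/-- The generalized matrix `p ↦ q; B`-norm of `A`: the supremum of `‖A v‖_q` over all `v` with
`‖B v‖_p ≤ 1`, as an element of `[0, ∞]`. -/
noncomputable def genMatrixNorm (p q : ℝ≥0∞) (B : Matrix (Fin l) (Fin n) ℝ)
    (A : Matrix (Fin m) (Fin n) ℝ) : ℝ≥0∞ :=
  ⨆ (v : Fin n → ℝ) (_ : vecNorm p (B.mulVec v) ≤ 1), ENNReal.ofReal (vecNorm q (A.mulVec v))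

/-- The classical matrix `p ↦ q`-norm of `M`: the supremum of `‖M v‖_q` over `‖v‖_p ≤ 1`.
For `p = q = 2` this is the spectral norm. -/
noncomputable def matrixNorm (p q : ℝ≥0∞) (M : Matrix (Fin m) (Fin n) ℝ) : ℝ≥0∞ :=
  ⨆ (v : Fin n → ℝ) (_ : vecNorm p v ≤ 1), ENNReal.ofReal (vecNorm q (M.mulVec v))

/-- `Ker B ⊆ Ker A`. -/
def KerLE (B : Matrix (Fin l) (Fin n) ℝ) (A : Matrix (Fin m) (Fin n) ℝ) : Prop :=
  LinearMap.ker B.mulVecLin ≤ LinearMap.ker A.mulVecLin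

end Norms

/-! ## The Moore-Penrose pseudoinverse -/

section PseudoInverse

variable {l n : ℕ}

/-- The four Penrose equations for real matrices. -/
structure IsMoorePenrose (B : Matrix (Fin l) (Fin n) ℝ) (X : Matrix (Fin n) (Fin l) ℝ) : Prop where
  mul_mul_left : B * X * B = B
  mul_mul_right : X * B * X = X
  symm_left : (B * X).transpose = B * X
  symm_right : (X * B).transpose = X * B

theorem IsMoorePenrose.unique {B : Matrix (Fin l) (Fin n) ℝ} {X Y : Matrix (Fin n) (Fin l) ℝ}
    (hX : IsMoorePenrose B X) (hY : IsMoorePenrose B Y) : X = Y := by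
  have h1 : B * X = B * Y := by
    calc B * X = (B * X).transpose := hX.symm_left.symm
      _ = (B * Y * (B * X)).transpose := by rw [← Matrix.mul_assoc, hY.mul_mul_left]
      _ = B * X * (B * Y) := by rw [Matrix.transpose_mul, hX.symm_left, hY.symm_left]
      _ = B * Y := by rw [← Matrix.mul_assoc, hX.mul_mul_left]
  have h2 : X * B = Y * B := by
    calc X * B = (X * B).transpose := hX.symm_right.symm
      _ = (X * B * (Y * B)).transpose := by
          rw [Matrix.mul_assoc, ← Matrix.mul_assoc B, hY.mul_mul_left]
      _ = Y * B * (X * B) := by rw [Matrix.transpose_mul, hX.symm_right, hY.symm_right]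
      _ = Y * B := by rw [Matrix.mul_assoc, ← Matrix.mul_assoc B, hX.mul_mul_left]
  calc X = X * B * X := hX.mul_mul_right.symm
    _ = Y * B * Y := by rw [h2, Matrix.mul_assoc, h1, ← Matrix.mul_assoc]
    _ = Y := hY.mul_mul_right

theorem exists_isMoorePenrose (B : Matrix (Fin l) (Fin n) ℝ) :
    ∃ X : Matrix (Fin n) (Fin l) ℝ, IsMoorePenrose B X := by
  have hS : (B.transpose * B).IsHermitian := by
    rw [Matrix.IsHermitian, Matrix.conjTranspose_eq_transpose_of_trivial, Matrix.transpose_mul,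
      Matrix.transpose_transpose]
  -- a symmetric generalized inverse `T` of `S = Bᵀ B`
  obtain ⟨T, hT, hSTS, hTST, hTS⟩ : ∃ T : Matrix (Fin n) (Fin n) ℝ, T.transpose = T ∧
      B.transpose * B * T * (B.transpose * B) = B.transpose * B ∧
      T * (B.transpose * B) * T = T ∧
      (T * (B.transpose * B)).transpose = T * (B.transpose * B) := by
    obtain ⟨U, d, hU, hd⟩ : ∃ (U : Matrix (Fin n) (Fin n) ℝ) (d : Fin n → ℝ),
        U.transpose * U = 1 ∧ B.transpose * B = U * Matrix.diagonal d * U.transpose := by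
      refine ⟨hS.eigenvectorUnitary, hS.eigenvalues, ?_, ?_⟩
      · have := Unitary.coe_star_mul_self hS.eigenvectorUnitary
        rwa [Matrix.star_eq_conjTranspose, Matrix.conjTranspose_eq_transpose_of_trivial] at this
      · have := hS.spectral_theorem
        rw [Unitary.conjStarAlgAut_apply, Matrix.star_eq_conjTranspose,
          Matrix.conjTranspose_eq_transpose_of_trivial] at this
        exact this
    have key : ∀ a b : Fin n → ℝ, U * Matrix.diagonal a * U.transpose *
        (U * Matrix.diagonal b * U.transpose) =
        U * Matrix.diagonal (fun i => a i * b i) * U.transpose := by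
      intro a b
      calc _ = U * Matrix.diagonal a * (U.transpose * U) * Matrix.diagonal b * U.transpose := by
            simp only [Matrix.mul_assoc]
        _ = _ := by rw [hU, Matrix.mul_one, Matrix.mul_assoc U, Matrix.diagonal_mul_diagonal]
    have tr : ∀ a : Fin n → ℝ, (U * Matrix.diagonal a * U.transpose).transpose =
        U * Matrix.diagonal a * U.transpose := by
      intro a
      simp [Matrix.transpose_mul, Matrix.mul_assoc]
    refine ⟨U * Matrix.diagonal (fun i => (d i)⁻¹) * U.transpose, tr _, ?_, ?_, ?_⟩
    · rw [hd, key, key]; congr; ext i; exact mul_inv_mul_cancel _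
    · rw [hd, key, key]; congr; ext i
      simpa using mul_inv_mul_cancel (d i)⁻¹
    · rw [hd, key, tr]
  have hBTS : B * (T * (B.transpose * B)) = B := by
    have h0 : (B * (T * (B.transpose * B)) - B).transpose *
        (B * (T * (B.transpose * B)) - B) = 0 := by
      have e : B * (T * (B.transpose * B)) - B = B * (T * (B.transpose * B) - 1) := by
        rw [Matrix.mul_sub, Matrix.mul_one]
      rw [e, Matrix.transpose_mul, Matrix.mul_assoc, ← Matrix.mul_assoc B.transpose,
        Matrix.mul_sub (B.transpose * B), ← Matrix.mul_assoc (B.transpose * B) T, hSTS,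
        Matrix.mul_one, sub_self, Matrix.mul_zero]
    rw [← Matrix.conjTranspose_eq_transpose_of_trivial,
      Matrix.conjTranspose_mul_self_eq_zero] at h0
    exact sub_eq_zero.mp h0
  refine ⟨T * B.transpose, ?_, ?_, ?_, ?_⟩
  · simpa only [Matrix.mul_assoc] using hBTS
  · calc T * B.transpose * B * (T * B.transpose) = T * (B.transpose * B) * T * B.transpose := by
          simp only [Matrix.mul_assoc]
      _ = _ := by rw [hTST]
  · rw [Matrix.transpose_mul, Matrix.transpose_mul, Matrix.transpose_transpose, hT,
      Matrix.mul_assoc]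
  · rw [Matrix.mul_assoc, hTS]

/-- The Moore-Penrose pseudoinverse `B⁺`: the unique solution of the Penrose equations. -/
noncomputable def pinv (B : Matrix (Fin l) (Fin n) ℝ) : Matrix (Fin n) (Fin l) ℝ :=
  (exists_isMoorePenrose B).choose

theorem pinv_spec (B : Matrix (Fin l) (Fin n) ℝ) : IsMoorePenrose B (pinv B) :=
  (exists_isMoorePenrose B).choose_spec

end PseudoInverse

/-! ## Integer random access machines with logarithmic cost

A program works with integer registers `reg 0, reg 1, …` and with integer arrays
`mem 0, mem 1, …`, each addressed by a pair of integers.  A program is a finite term, so it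
mentions only finitely many registers and arrays.  Executing an instruction is one *step*; its
*bit cost* is `1` plus the binary lengths of all integers (values and addresses) it handles. -/

/-- The state of the machine. -/
structure RAMState where
  reg : ℕ → ℤ
  mem : ℕ → ℤ → ℤ → ℤ

/-- Integer operations; `div` is division with remainder (with value `0` for the divisor `0`). -/
inductive RAMOp where
  | add | sub | mul | div

/-- Value of an operation. -/
def RAMOp.eval : RAMOp → ℤ → ℤ → ℤ
  | add, x, y => x + y
  | sub, x, y => x - y
  | mul, x, y => x * y
  | div, x, y => x / y

/-- Basic instructions. -/
inductive RAMInstr where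
  /-- `reg r := c` -/
  | const (r : ℕ) (c : ℤ)
  /-- `reg r := reg s ∘ reg t` -/
  | op (o : RAMOp) (r s t : ℕ)
  /-- `reg r := mem b (reg s, reg t)` -/
  | load (r b s t : ℕ)
  /-- `mem b (reg s, reg t) := reg r` -/
  | store (b s t r : ℕ)

/-- The binary length of an integer. -/
def bitLen (z : ℤ) : ℕ := Nat.size z.natAbs

/-- Effect of a basic instruction. -/
def RAMInstr.exec : RAMInstr → RAMState → RAMState
  | const r c, σ => { σ with reg := Function.update σ.reg r c }
  | op o r s t, σ => { σ with reg := Function.update σ.reg r (o.eval (σ.reg s) (σ.reg t)) }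
  | load r b s t, σ => { σ with reg := Function.update σ.reg r (σ.mem b (σ.reg s) (σ.reg t)) }
  | store b s t r, σ =>
    { σ with
      mem := Function.update σ.mem b
        (Function.update (σ.mem b) (σ.reg s)
          (Function.update (σ.mem b (σ.reg s)) (σ.reg t) (σ.reg r))) }

/-- Bit cost of a basic instruction. -/
def RAMInstr.cost : RAMInstr → RAMState → ℕ
  | const _ c, _ => 1 + bitLen c
  | op o _ s t, σ => 1 + bitLen (σ.reg s) + bitLen (σ.reg t)
      + bitLen (o.eval (σ.reg s) (σ.reg t))
  | load _ b s t, σ => 1 + bitLen (σ.reg s) + bitLen (σ.reg t)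
      + bitLen (σ.mem b (σ.reg s) (σ.reg t))
  | store _ s t r, σ => 1 + bitLen (σ.reg s) + bitLen (σ.reg t) + bitLen (σ.reg r)

/-- Programs. -/
inductive RAMProgram where
  | skip
  | instr (i : RAMInstr)
  | seq (P Q : RAMProgram)
  /-- if `reg r > 0` then `P` else `Q` -/
  | ifPos (r : ℕ) (P Q : RAMProgram)
  /-- while `reg r > 0` do `P` -/
  | whilePos (r : ℕ) (P : RAMProgram)

/-- `RAMRun P σ τ a c`: started in the state `σ`, the program `P` halts in the state `τ` after `a`
steps, of total bit cost `c`. -/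
inductive RAMRun : RAMProgram → RAMState → RAMState → ℕ → ℕ → Prop
  | skip (σ : RAMState) : RAMRun .skip σ σ 0 0
  | instr (i : RAMInstr) (σ : RAMState) : RAMRun (.instr i) σ (i.exec σ) 1 (i.cost σ)
  | seq {P Q : RAMProgram} {σ τ υ : RAMState} {a c a' c' : ℕ} :
      RAMRun P σ τ a c → RAMRun Q τ υ a' c' → RAMRun (.seq P Q) σ υ (a + a') (c + c')
  | ifPos_true {r : ℕ} {P Q : RAMProgram} {σ τ : RAMState} {a c : ℕ} :
      0 < σ.reg r → RAMRun P σ τ a c →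
      RAMRun (.ifPos r P Q) σ τ (1 + a) (1 + bitLen (σ.reg r) + c)
  | ifPos_false {r : ℕ} {P Q : RAMProgram} {σ τ : RAMState} {a c : ℕ} :
      ¬ 0 < σ.reg r → RAMRun Q σ τ a c →
      RAMRun (.ifPos r P Q) σ τ (1 + a) (1 + bitLen (σ.reg r) + c)
  | whilePos_true {r : ℕ} {P : RAMProgram} {σ τ υ : RAMState} {a c a' c' : ℕ} :
      0 < σ.reg r → RAMRun P σ τ a c → RAMRun (.whilePos r P) τ υ a' c' →
      RAMRun (.whilePos r P) σ υ (1 + a + a') (1 + bitLen (σ.reg r) + c + c')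
  | whilePos_false {r : ℕ} {P : RAMProgram} {σ : RAMState} :
      ¬ 0 < σ.reg r → RAMRun (.whilePos r P) σ σ 1 (1 + bitLen (σ.reg r))

/-! ## Encoding of the input -/

section Encoding

variable {l m n : ℕ}

/-- An integer matrix as the content of an array, with zero entries outside the matrix. -/
def toArray (M : Fin m → Fin n → ℤ) (i j : ℤ) : ℤ :=
  if h : (0 ≤ i ∧ i < m) ∧ (0 ≤ j ∧ j < n) then
    M ⟨i.toNat, by omega⟩ ⟨j.toNat, by omega⟩
  else 0

/-- The initial state for the rational input `(A, B, t)`: the registers `0, …, 4` hold `l`, `m`,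
`n` and the numerator and denominator of `t`; the arrays `0, 1` hold the numerators and
denominators of the entries of `A`, the arrays `2, 3` those of `B`. All else is zero. -/
def inputState (A : Matrix (Fin m) (Fin n) ℚ) (B : Matrix (Fin l) (Fin n) ℚ) (t : ℚ) :
    RAMState where
  reg
    | 0 => l
    | 1 => m
    | 2 => n
    | 3 => t.num
    | 4 => t.den
    | _ => 0
  mem
    | 0 => toArray fun i j => (A i j).num
    | 1 => toArray fun i j => (A i j).den
    | 2 => toArray fun i j => (B i j).num
    | 3 => toArray fun i j => (B i j).den
    | _ => fun _ _ => 0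

/-- The binary length of a rational number. -/
def ratLen (x : ℚ) : ℕ := bitLen x.num + bitLen x.den

/-- The binary length of the input `(A, B, t)`, including the dimensions (in unary). -/
def inputSize (A : Matrix (Fin m) (Fin n) ℚ) (B : Matrix (Fin l) (Fin n) ℚ) (t : ℚ) : ℕ :=
  l + m + n + (∑ i, ∑ j, ratLen (A i j)) + (∑ i, ∑ j, ratLen (B i j)) + ratLen t

/-- A rational matrix, regarded as a real matrix. -/
def toReal (A : Matrix (Fin m) (Fin n) ℚ) : Matrix (Fin m) (Fin n) ℝ :=
  A.map fun x => (x : ℝ)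

end Encoding

/-!
Let `Ker B ⊆ Ker A`. Then `A = A B⁺ B`, and `B B⁺` is an orthogonal projection. So every value `A v`
with `‖B v‖ ≤ 1` is a value `(A B⁺) w` with `w = B v` in the unit ball, and conversely `(A B⁺) w` is
the value `A v` for `v = B⁺ w`, where `‖B v‖ = ‖B B⁺ w‖ ≤ ‖w‖`. Hence the two suprema agree, and the
second one is attained since the unit ball is compact. If `B v = 0 ≠ A v`, the multiples of `v` show
that the supremum is infinite.

Exact comparison with a rational `t = p / q ≥ 0`: the norm is at most `t` if and only if the
symmetric matrix `q² Aᵀ A - p² Bᵀ B` is negative semidefinite (`genMatrixNorm_toReal_le_iff`). After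
clearing denominators, this is an integer matrix `T` (`testMatrix`), and `T` is negative
semidefinite if and only if its characteristic polynomial has nonnegative coefficients
(`charCoeff_nonneg_iff`): a monic polynomial with nonnegative coefficients has no positive root, and
all roots are real. The coefficients are obtained by Newton's identities (`succ_mul_charCoeff`) from
the traces of the powers of `T`. This takes a number of arithmetic operations polynomial in the
dimensions, and all divisions are exact, so that all numbers are integers of polynomial length
(`natAbs_charCoeff_le`).

Approximation: the product of the nonzero eigenvalues of the integer matrix `(D B)ᵀ (D B)`, with `D`
a common denominator, is a positive integer. As their sum is the trace, none of them is very large,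
hence none is very small, which gives an upper bound `U` for the norm of polynomial length
(`genMatrixNorm_le_normBound`). Bisection of the interval from `0` to `U`, with the exact comparison
at each midpoint, reaches the error `ε` after about `log (U / ε)` steps (`bisectionProgram_spec`).

For the random access machine, integer expressions with bounded sums and products are compiled to
programs (`RAMExpr.compile_spec`). `Runs M P σ τ a` records that `P` takes `σ` to `τ` in at most `a`
steps, handling integers of absolute value at most `M` only; so the bit cost is at most a multiple
of `a` times the length of `M`. Both `a` and the degree `d` in the bounds `M ^ d` of the
intermediate values are computed from the expressions, and are polynomials in a bound `ν` for the
dimensions. As the degrees of successive commands multiply, it matters that the number of commands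
is fixed and that the tables which a command fills entry by entry are bounded by mathematical
arguments and not by their recursion (`tabulate_spec`).
-/

/-! ### Runs with a uniform bound on the integers handled -/

theorem bitLen_le_size {x : ℤ} {M : ℕ} (h : x.natAbs ≤ M) : bitLen x ≤ Nat.size M :=
  Nat.size_le_size h

/-- `Runs M P σ τ a`: from `σ`, the program `P` halts in `τ` after at most `a` steps, at a bit cost
no larger than if each step handled three integers of absolute value `M`. -/
def Runs (M : ℕ) (P : RAMProgram) (σ τ : RAMState) (a : ℕ) : Prop :=
  ∃ a' c, RAMRun P σ τ a' c ∧ a' ≤ a ∧ c ≤ a' * (3 * Nat.size M + 1)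

theorem Runs.mono {M M' : ℕ} {P : RAMProgram} {σ τ : RAMState} {a a' : ℕ} (h : Runs M P σ τ a)
    (hM : M ≤ M') (ha : a ≤ a') : Runs M' P σ τ a' := by
  obtain ⟨b, c, hr, hb, hc⟩ := h
  refine ⟨b, c, hr, hb.trans ha, hc.trans (Nat.mul_le_mul_left _ ?_)⟩
  have := Nat.size_le_size hM
  omega

theorem Runs.seq {M : ℕ} {P Q : RAMProgram} {σ τ υ : RAMState} {a b : ℕ} (h : Runs M P σ τ a)
    (h' : Runs M Q τ υ b) : Runs M (.seq P Q) σ υ (a + b) := by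
  obtain ⟨a', c, hr, ha, hc⟩ := h
  obtain ⟨b', c', hr', hb, hc'⟩ := h'
  exact ⟨_, _, .seq hr hr', by omega, by rw [add_mul]; omega⟩

theorem Runs.const {M r : ℕ} {c : ℤ} {σ : RAMState} (hc : c.natAbs ≤ M) :
    Runs M (.instr (.const r c)) σ { σ with reg := Function.update σ.reg r c } 1 := by
  refine ⟨_, _, .instr _ _, le_rfl, ?_⟩
  have := bitLen_le_size hc
  simp only [RAMInstr.cost]
  omega

theorem Runs.op {M r s t : ℕ} {o : RAMOp} {σ : RAMState} (hs : (σ.reg s).natAbs ≤ M)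
    (ht : (σ.reg t).natAbs ≤ M) (h : (o.eval (σ.reg s) (σ.reg t)).natAbs ≤ M) :
    Runs M (.instr (.op o r s t)) σ
      { σ with reg := Function.update σ.reg r (o.eval (σ.reg s) (σ.reg t)) } 1 := by
  refine ⟨_, _, .instr _ _, le_rfl, ?_⟩
  have := bitLen_le_size hs
  have := bitLen_le_size ht
  have := bitLen_le_size h
  simp only [RAMInstr.cost]
  omega

theorem Runs.load {M r b s t : ℕ} {σ : RAMState} (hs : (σ.reg s).natAbs ≤ M)
    (ht : (σ.reg t).natAbs ≤ M) (h : (σ.mem b (σ.reg s) (σ.reg t)).natAbs ≤ M) :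
    Runs M (.instr (.load r b s t)) σ
      { σ with reg := Function.update σ.reg r (σ.mem b (σ.reg s) (σ.reg t)) } 1 := by
  refine ⟨_, _, .instr _ _, le_rfl, ?_⟩
  have := bitLen_le_size hs
  have := bitLen_le_size ht
  have := bitLen_le_size h
  simp only [RAMInstr.cost]
  omega

theorem Runs.store {M b s t r : ℕ} {σ : RAMState} (hs : (σ.reg s).natAbs ≤ M)
    (ht : (σ.reg t).natAbs ≤ M) (h : (σ.reg r).natAbs ≤ M) :
    Runs M (.instr (.store b s t r)) σ ((RAMInstr.store b s t r).exec σ) 1 := by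
  refine ⟨_, _, .instr _ _, le_rfl, ?_⟩
  have := bitLen_le_size hs
  have := bitLen_le_size ht
  have := bitLen_le_size h
  simp only [RAMInstr.cost]
  omega

/-- The rule for a loop that is known to be executed exactly `n` times. -/
theorem Runs.whilePos {M r a n : ℕ} {P : RAMProgram} (I : ℕ → RAMState → Prop)
    (hM : ∀ i σ, I i σ → (σ.reg r).natAbs ≤ M)
    (hbody : ∀ i < n, ∀ σ, I i σ → 0 < σ.reg r ∧ ∃ τ, Runs M P σ τ a ∧ I (i + 1) τ)
    (hend : ∀ σ, I n σ → ¬ 0 < σ.reg r) {σ : RAMState} (h0 : I 0 σ) :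
    ∃ τ, Runs M (.whilePos r P) σ τ (n * (a + 1) + 1) ∧ I n τ := by
  suffices H : ∀ k ≤ n, ∀ σ, I (n - k) σ →
      ∃ τ, Runs M (.whilePos r P) σ τ (k * (a + 1) + 1) ∧ I n τ from H n le_rfl σ (by simpa)
  intro k
  induction k with
  | zero =>
    intro _ σ hσ
    refine ⟨σ, ⟨_, _, .whilePos_false (hend σ hσ), by simp, ?_⟩, hσ⟩
    have := bitLen_le_size (hM _ _ hσ)
    omega
  | succ k ih =>
    intro hk σ hσ
    obtain ⟨hpos, τ, ⟨a₁, c₁, hr₁, ha₁, hc₁⟩, hτ⟩ := hbody (n - (k + 1)) (by omega) σ hσ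
    obtain ⟨υ, ⟨a₂, c₂, hr₂, ha₂, hc₂⟩, hυ⟩ := ih (by omega) τ (by convert hτ using 1; omega)
    refine ⟨υ, ⟨_, _, .whilePos_true hpos hr₁ hr₂, ?_, ?_⟩, hυ⟩
    · rw [Nat.succ_mul]; omega
    · have := bitLen_le_size (hM _ _ hσ)
      rw [add_mul, add_mul]
      omega

/-- `for r = 0, …, reg q - 1 do P`, with the scratch register `d`. -/
def forLoop (r q d : ℕ) (P : RAMProgram) : RAMProgram :=
  .seq (.instr (.const r 0)) (.seq (.instr (.op .sub d q r))
    (.whilePos d (.seq P (.seq (.instr (.const d 1)) (.seq (.instr (.op .add r r d))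
      (.instr (.op .sub d q r)))))))

/-- The rule for counting loops. The invariant `I` must not refer to the registers `r` and `d`. -/
theorem Runs.forLoop {M r q d a n : ℕ} {P : RAMProgram} (I : ℕ → RAMState → Prop)
    (hqr : q ≠ r) (hqd : q ≠ d) (hrd : r ≠ d) (hM : n + 1 ≤ M)
    (hq : ∀ i σ, I i σ → σ.reg q = n)
    (hI : ∀ i σ τ, I i σ → τ.mem = σ.mem → (∀ x, x ≠ r → x ≠ d → τ.reg x = σ.reg x) → I i τ)
    (hbody : ∀ i < n, ∀ σ, I i σ → σ.reg r = i →
      ∃ τ, Runs M P σ τ a ∧ I (i + 1) τ ∧ τ.reg r = i) {σ : RAMState} (h0 : I 0 σ) :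
    ∃ τ, Runs M (forLoop r q d P) σ τ (n * (a + 4) + 3) ∧ I n τ := by
  let J : ℕ → RAMState → Prop := fun i σ => I i σ ∧ σ.reg r = i ∧ σ.reg d = n - i ∧ i ≤ n
  let σ₁ : RAMState := { σ with reg := Function.update σ.reg r 0 }
  let σ₂ : RAMState := { σ₁ with reg := Function.update σ₁.reg d (σ₁.reg q - σ₁.reg r) }
  have h1q : σ₁.reg q = n := by simp [σ₁, hqr, hq 0 σ h0]
  have h1r : σ₁.reg r = 0 := by simp [σ₁]
  have h1 : Runs M (.instr (.const r 0)) σ σ₁ 1 := .const (by simp)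
  have h2 : Runs M (.instr (.op .sub d q r)) σ₁ σ₂ 1 :=
    .op (by rw [h1q]; simp; omega) (by rw [h1r]; simp)
      (by simp only [RAMOp.eval, h1q, h1r]; simp; omega)
  have hJ0 : J 0 σ₂ := by
    refine ⟨hI 0 σ σ₂ h0 rfl fun x hx hx' => ?_, ?_, ?_, Nat.zero_le _⟩
    · simp [σ₂, σ₁, hx, hx']
    · simp [σ₂, σ₁, hrd]
    · simp [σ₂, h1q, h1r]
  obtain ⟨τ, hτ, hJτ⟩ := Runs.whilePos (M := M) (r := d) (a := a + 3) (n := n)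
    (P := .seq P (.seq (.instr (.const d 1)) (.seq (.instr (.op .add r r d))
      (.instr (.op .sub d q r))))) J
    (fun i σ h => by rw [h.2.2.1]; have := h.2.2.2; omega)
    (fun i hi σ h => by
      refine ⟨by rw [h.2.2.1]; omega, ?_⟩
      obtain ⟨τ, hτ, hIτ, hr⟩ := hbody i hi σ h.1 h.2.1
      have hτq := hq _ _ hIτ
      let τ₁ : RAMState := { τ with reg := Function.update τ.reg d 1 }
      have e1r : τ₁.reg r = i := by simp [τ₁, hrd, hr]
      have e1d : τ₁.reg d = 1 := by simp [τ₁]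
      have e1q : τ₁.reg q = n := by simp [τ₁, hqd, hτq]
      let τ₂ : RAMState := { τ₁ with reg := Function.update τ₁.reg r (τ₁.reg r + τ₁.reg d) }
      have e2r : τ₂.reg r = i + 1 := by simp [τ₂, e1r, e1d]
      have e2q : τ₂.reg q = n := by simp [τ₂, hqr, e1q]
      let τ₃ : RAMState := { τ₂ with reg := Function.update τ₂.reg d (τ₂.reg q - τ₂.reg r) }
      have k1 : Runs M (.instr (.const d 1)) τ τ₁ 1 := .const (by simp; omega)
      have k2 : Runs M (.instr (.op .add r r d)) τ₁ τ₂ 1 :=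
        .op (by rw [e1r]; omega) (by rw [e1d]; omega) (by simp only [RAMOp.eval, e1r, e1d]; omega)
      have k3 : Runs M (.instr (.op .sub d q r)) τ₂ τ₃ 1 :=
        .op (by rw [e2q]; omega) (by rw [e2r]; omega) (by simp only [RAMOp.eval, e2r, e2q]; omega)
      refine ⟨τ₃, hτ.seq (k1.seq (k2.seq k3)), hI _ _ _ hIτ rfl fun x hx hx' => ?_, ?_, ?_, hi⟩
      · simp [τ₃, τ₂, τ₁, hx, hx']
      · simp [τ₃, hrd, e2r]
      · simp [τ₃, e2r, e2q])
    (fun σ h => by rw [h.2.2.1]; simp) hJ0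
  exact ⟨τ, (h1.seq (h2.seq hτ)).mono le_rfl (by ring_nf; omega), hJτ.1⟩

/-! ### Arithmetic expressions and their compilation -/

/-- The value of `(⋯((c ∘ f 0) ∘ f 1) ∘ ⋯) ∘ f (n - 1)`. -/
def foldOp (o : RAMOp) (c : ℤ) (f : ℕ → ℤ) : ℕ → ℤ
  | 0 => c
  | i + 1 => o.eval (foldOp o c f i) (f i)

@[simp] theorem foldOp_add (f : ℕ → ℤ) (n : ℕ) :
    foldOp .add 0 f n = ∑ i ∈ Finset.range n, f i := by
  induction n with
  | zero => rfl
  | succ n ih => rw [foldOp, ih, Finset.sum_range_succ]; rfl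

@[simp] theorem foldOp_mul (f : ℕ → ℤ) (n : ℕ) :
    foldOp .mul 1 f n = ∏ i ∈ Finset.range n, f i := by
  induction n with
  | zero => rfl
  | succ n ih => rw [foldOp, ih, Finset.prod_range_succ]; rfl

theorem foldOp_congr {o : RAMOp} {c : ℤ} {f g : ℕ → ℤ} {n : ℕ} (h : ∀ i < n, f i = g i) :
    foldOp o c f n = foldOp o c g n := by
  induction n with
  | zero => rfl
  | succ n ih => rw [foldOp, foldOp, ih fun i hi => h i (by omega), h n (by omega)]

/-- The state `σ` with the value `x` in register `r`. -/
def RAMState.set (σ : RAMState) (r : ℕ) (x : ℤ) : RAMState :=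
  { σ with reg := Function.update σ.reg r x }

@[simp] theorem RAMState.set_mem (σ : RAMState) (r : ℕ) (x : ℤ) : (σ.set r x).mem = σ.mem := rfl

@[simp] theorem RAMState.set_reg_self (σ : RAMState) (r : ℕ) (x : ℤ) : (σ.set r x).reg r = x := by
  simp [RAMState.set]

theorem RAMState.set_reg_of_ne (σ : RAMState) {r s : ℕ} (h : s ≠ r) (x : ℤ) :
    (σ.set r x).reg s = σ.reg s := by
  simp [RAMState.set, h]

theorem RAMState.set_reg (σ : RAMState) (r s : ℕ) (x : ℤ) :
    (σ.set r x).reg s = if s = r then x else σ.reg s := by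
  simp [RAMState.set, Function.update_apply]

/-- Integer expressions in the registers and arrays. `fold o c r N e` combines, by the operation
`o` and starting with `c`, the values of `e` for `reg r = 0, …, N - 1`; so it provides finite
sums and products. -/
inductive RAMExpr where
  | var (r : ℕ)
  | const (c : ℤ)
  | op (o : RAMOp) (e f : RAMExpr)
  | load (b : ℕ) (e f : RAMExpr)
  | fold (o : RAMOp) (c : ℤ) (r : ℕ) (N e : RAMExpr)

namespace RAMExpr

/-- The value of an expression. -/
def eval : RAMExpr → RAMState → ℤ
  | var r, σ => σ.reg r
  | const c, _ => c
  | op o e f, σ => o.eval (e.eval σ) (f.eval σ)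
  | load b e f, σ => σ.mem b (e.eval σ) (f.eval σ)
  | fold o c r N e, σ => foldOp o c (fun i => e.eval (σ.set r i)) (N.eval σ).toNat

/-- The expression has its free registers below `k`, binds the registers `k, k + 1, …` below `30`
in the order of nesting, and has constants of absolute value at most `2`. -/
def Scoped : RAMExpr → ℕ → Prop
  | var r, k => r < k
  | const c, _ => c.natAbs ≤ 2
  | op _ e f, k => e.Scoped k ∧ f.Scoped k
  | load _ e f, k => e.Scoped k ∧ f.Scoped k
  | fold _ c r N e, k => r = k ∧ k < 30 ∧ c.natAbs ≤ 2 ∧ N.Scoped k ∧ e.Scoped (k + 1)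

/-- The bounds of all folds evaluated lie between `0` and `ν`. -/
def Counts (ν : ℕ) : RAMExpr → RAMState → Prop
  | var _, _ => True
  | const _, _ => True
  | op _ e f, σ => e.Counts ν σ ∧ f.Counts ν σ
  | load _ e f, σ => e.Counts ν σ ∧ f.Counts ν σ
  | fold _ _ r N e, σ => N.Counts ν σ ∧ 0 ≤ N.eval σ ∧ N.eval σ ≤ ν ∧
      ∀ i : ℕ, i < N.eval σ → e.Counts ν (σ.set r i)

/-- The code that computes the value of the expression in register `d`, with `d, d + 1, …` as
scratch registers. -/
def compile : RAMExpr → ℕ → RAMProgram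
  | var r, d => .seq (.instr (.const d 0)) (.instr (.op .add d d r))
  | const c, d => .instr (.const d c)
  | op o e f, d => .seq (e.compile d) (.seq (f.compile (d + 1)) (.instr (.op o d d (d + 1))))
  | load b e f, d => .seq (e.compile d) (.seq (f.compile (d + 1)) (.instr (.load d b d (d + 1))))
  | fold o c r N e, d => .seq (.instr (.const d c)) (.seq (N.compile (d + 1))
      (forLoop r (d + 1) (d + 2)
        (.seq (e.compile (d + 2)) (.instr (.op o d d (d + 2))))))

/-- A bound for the number of steps in terms of the bound `ν` for the folds. -/
def steps (ν : ℕ) : RAMExpr → ℕ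
  | var _ => 2
  | const _ => 1
  | op _ e f => e.steps ν + f.steps ν + 1
  | load _ e f => e.steps ν + f.steps ν + 1
  | fold _ _ _ N e => N.steps ν + ν * (e.steps ν + 5) + 4

/-- The degree of an expression: if all data are bounded by `M ≥ 2`, then all intermediate values
are bounded by `M ^ e.deg ν`. -/
def deg (ν : ℕ) : RAMExpr → ℕ
  | var _ => 1
  | const _ => 1
  | op _ e f => e.deg ν + f.deg ν + 1
  | load _ e f => e.deg ν + f.deg ν + 1
  | fold _ _ _ N e => N.deg ν + ν * (e.deg ν + 1) + 2

theorem exists_steps_eq (e : RAMExpr) : ∃ p : Polynomial ℕ, ∀ ν, e.steps ν = p.eval ν := by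
  induction e with
  | var r => exact ⟨2, fun ν => by simp [steps]⟩
  | const c => exact ⟨1, fun ν => by simp [steps]⟩
  | op o e f ihe ihf | load o e f ihe ihf =>
    obtain ⟨p, hp⟩ := ihe
    obtain ⟨q, hq⟩ := ihf
    exact ⟨p + q + 1, fun ν => by simp [steps, hp, hq]⟩
  | fold o c r N e ihN ihe =>
    obtain ⟨p, hp⟩ := ihN
    obtain ⟨q, hq⟩ := ihe
    exact ⟨p + .X * (q + 5) + 4, fun ν => by simp [steps, hp, hq]⟩

theorem exists_deg_eq (e : RAMExpr) : ∃ p : Polynomial ℕ, ∀ ν, e.deg ν = p.eval ν := by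
  induction e with
  | var r | const r => exact ⟨1, fun ν => by simp [deg]⟩
  | op o e f ihe ihf | load o e f ihe ihf =>
    obtain ⟨p, hp⟩ := ihe
    obtain ⟨q, hq⟩ := ihf
    exact ⟨p + q + 1, fun ν => by simp [deg, hp, hq]⟩
  | fold o c r N e ihN ihe =>
    obtain ⟨p, hp⟩ := ihN
    obtain ⟨q, hq⟩ := ihe
    exact ⟨p + .X * (q + 1) + 2, fun ν => by simp [deg, hp, hq]⟩

theorem one_le_deg (ν : ℕ) (e : RAMExpr) : 1 ≤ e.deg ν := by
  cases e <;> simp [deg]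

theorem eval_congr {e : RAMExpr} {k : ℕ} {σ τ : RAMState} (he : e.Scoped k)
    (hr : ∀ r < k, σ.reg r = τ.reg r) (hm : σ.mem = τ.mem) : e.eval σ = e.eval τ := by
  induction e generalizing k σ τ with
  | var r => exact hr r he
  | const c => rfl
  | op o e f ihe ihf => simp only [eval, ihe he.1 hr hm, ihf he.2 hr hm]
  | load b e f ihe ihf => simp only [eval, ihe he.1 hr hm, ihf he.2 hr hm, hm]
  | fold o c r N e ihN ihe =>
    obtain ⟨rfl, -, -, hN, he⟩ := he
    simp only [eval, ihN hN hr hm]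
    refine foldOp_congr fun i _ => ihe he (fun s hs => ?_) (by simpa)
    rw [RAMState.set_reg, RAMState.set_reg]
    split_ifs with h
    · rfl
    · exact hr s (by omega)

theorem counts_congr {ν : ℕ} {e : RAMExpr} {k : ℕ} {σ τ : RAMState} (he : e.Scoped k)
    (hr : ∀ r < k, σ.reg r = τ.reg r) (hm : σ.mem = τ.mem) (h : e.Counts ν σ) :
    e.Counts ν τ := by
  induction e generalizing k σ τ with
  | var r | const r => trivial
  | op o e f ihe ihf => exact ⟨ihe he.1 hr hm h.1, ihf he.2 hr hm h.2⟩
  | load b e f ihe ihf => exact ⟨ihe he.1 hr hm h.1, ihf he.2 hr hm h.2⟩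
  | fold o c r N e ihN ihe =>
    obtain ⟨rfl, -, -, hN, he⟩ := he
    obtain ⟨h1, h2, h3, h4⟩ := h
    rw [eval_congr hN hr hm] at h2 h3 h4
    refine ⟨ihN hN hr hm h1, h2, h3, fun i hi => ihe he (fun s hs => ?_) (by simpa) (h4 i hi)⟩
    rw [RAMState.set_reg, RAMState.set_reg]
    split_ifs with h
    · rfl
    · exact hr s (by omega)

end RAMExpr

theorem natAbs_opEval_le {M a b : ℕ} (hM : 2 ≤ M) (ha : 1 ≤ a) (hb : 1 ≤ b) {x y : ℤ}
    (hx : x.natAbs ≤ M ^ a) (hy : y.natAbs ≤ M ^ b) (o : RAMOp) :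
    (o.eval x y).natAbs ≤ M ^ (a + b) := by
  have h1 : 2 ≤ M ^ a := hM.trans (Nat.le_self_pow (by omega) M)
  have h2 : 2 ≤ M ^ b := hM.trans (Nat.le_self_pow (by omega) M)
  have h3 : M ^ a + M ^ b ≤ M ^ (a + b) := by rw [pow_add]; nlinarith
  cases o with
  | add => exact (Int.natAbs_add_le x y).trans (by omega)
  | sub => exact (Int.natAbs_sub_le x y).trans (by omega)
  | mul => rw [RAMOp.eval, Int.natAbs_mul, pow_add]; exact Nat.mul_le_mul hx hy
  | div =>
    have : (x / y).natAbs ≤ x.natAbs := Int.natAbs_ediv_le_natAbs x y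
    exact this.trans (by omega)

theorem natAbs_foldOp_le {M d : ℕ} (hM : 2 ≤ M) (hd : 1 ≤ d) (o : RAMOp) {c : ℤ}
    (hc : c.natAbs ≤ M) {f : ℕ → ℤ} {n : ℕ} (hf : ∀ i < n, (f i).natAbs ≤ M ^ d) :
    (foldOp o c f n).natAbs ≤ M ^ (n * d + 1) := by
  induction n with
  | zero => simpa [foldOp] using hc
  | succ n ih =>
    have := natAbs_opEval_le hM (by omega) hd (ih fun i hi => hf i (by omega)) (hf n (by omega)) o
    rw [foldOp]
    convert this using 2
    ring

namespace RAMExpr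

theorem natAbs_eval_le {M ν : ℕ} (hM : 2 ≤ M) (hν : ν + 1 ≤ M) {e : RAMExpr} {k : ℕ}
    {σ : RAMState} (he : e.Scoped k) (hc : e.Counts ν σ) (hr : ∀ r < k, (σ.reg r).natAbs ≤ M)
    (hm : ∀ b i j, (σ.mem b i j).natAbs ≤ M) : (e.eval σ).natAbs ≤ M ^ e.deg ν := by
  induction e generalizing k σ with
  | var r => simpa [deg, eval] using hr r he
  | const c => exact (le_trans he hM).trans (by simp [deg])
  | op o e f ihe ihf =>
    refine (natAbs_opEval_le hM (one_le_deg ν e) (one_le_deg ν f) (ihe he.1 hc.1 hr hm)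
      (ihf he.2 hc.2 hr hm) o).trans (Nat.pow_le_pow_right (by omega) ?_)
    simp [deg]
  | load b e f ihe ihf =>
    exact (hm _ _ _).trans (Nat.le_self_pow (by simp [deg]) M)
  | fold o c r N e ihN ihe =>
    obtain ⟨rfl, -, hc2, hN, he⟩ := he
    obtain ⟨h1, h2, h3, h4⟩ := hc
    refine (natAbs_foldOp_le hM (one_le_deg ν e) o (hc2.trans hM) fun i hi =>
      ihe he (h4 i (by omega)) (fun s hs => ?_) hm).trans (Nat.pow_le_pow_right (by omega) ?_)
    · rw [RAMState.set_reg]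
      split_ifs with h
      · omega
      · exact hr s (by omega)
    · simp only [deg]
      have : (eval N σ).toNat * e.deg ν ≤ ν * (e.deg ν + 1) :=
        Nat.mul_le_mul (by omega) (by omega)
      have := one_le_deg ν N
      omega

/-- Correctness and cost of the compiled code. It leaves the arrays, the registers below `k` and
the registers `30, …, d - 1` unchanged. -/
theorem compile_spec {M ν : ℕ} (hM : 2 ≤ M) (hν : ν + 1 ≤ M) {e : RAMExpr} {k d : ℕ}
    {σ : RAMState} (hk : k ≤ 30) (hd : 30 ≤ d) (he : e.Scoped k) (hc : e.Counts ν σ)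
    (hr : ∀ r < k, (σ.reg r).natAbs ≤ M) (hm : ∀ b i j, (σ.mem b i j).natAbs ≤ M) :
    ∃ τ, Runs (M ^ e.deg ν) (e.compile d) σ τ (e.steps ν) ∧ τ.reg d = e.eval σ ∧
      τ.mem = σ.mem ∧ ∀ r, r < k ∨ 30 ≤ r ∧ r < d → τ.reg r = σ.reg r := by
  have hpow : ∀ {a b : ℕ}, a ≤ b → M ^ a ≤ M ^ b := Nat.pow_le_pow_right (by omega)
  induction e generalizing k d σ with
  | var r =>
    have hrk : r < k := he
    have hrd : r ≠ d := by omega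
    let σ₁ : RAMState := { σ with reg := Function.update σ.reg d 0 }
    have e1 : σ₁.reg d = 0 := by simp [σ₁]
    have e2 : σ₁.reg r = σ.reg r := by simp [σ₁, hrd]
    have k1 : Runs (M ^ (var r).deg ν) _ σ σ₁ 1 := .const (by simp)
    have hb : (σ.reg r).natAbs ≤ M ^ (var r).deg ν := by simpa [deg] using hr r hrk
    refine ⟨_, k1.seq (.op (by simp [e1]) (by simpa [e2]) (by simpa [RAMOp.eval, e1, e2])),
      ?_, rfl, fun x hx => ?_⟩
    · simp [RAMOp.eval, e1, e2, eval]
    · have : x ≠ d := by omega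
      simp [σ₁, this]
  | const c =>
    refine ⟨_, .const ((le_trans he hM).trans (by simp [deg])), by simp [eval], rfl, fun x hx => ?_⟩
    have : x ≠ d := by omega
    simp [this]
  | op o e f ihe ihf =>
    have b1 := natAbs_eval_le hM hν he.1 hc.1 hr hm
    have b2 := natAbs_eval_le hM hν he.2 hc.2 hr hm
    have b3 := natAbs_eval_le (e := op o e f) hM hν he hc hr hm
    obtain ⟨τ, h1, v1, m1, r1⟩ := ihe (d := d) hk hd he.1 hc.1 hr hm
    have hag : ∀ r < k, σ.reg r = τ.reg r := fun r hr => (r1 r (.inl hr)).symm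
    obtain ⟨υ, h2, v2, m2, r2⟩ := ihf (d := d + 1) (σ := τ) hk (by omega) he.2
      (counts_congr he.2 hag m1.symm hc.2) (fun r h => by rw [← hag r h]; exact hr r h)
      (by simpa only [m1])
    rw [← eval_congr he.2 hag m1.symm] at v2
    have v1' : υ.reg d = e.eval σ := by rw [r2 d (by omega), v1]
    refine ⟨_, (h1.mono (hpow (by simp [deg]; omega)) le_rfl).seq
      ((h2.mono (hpow (by simp [deg]; omega)) le_rfl).seq (.op ?_ ?_ ?_)) |>.mono le_rfl
        (by simp [steps]; omega), ?_, ?_, fun x hx => ?_⟩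
    · rw [v1']; exact b1.trans (hpow (by simp [deg]; omega))
    · rw [v2]; exact b2.trans (hpow (by simp [deg]; omega))
    · rw [v1', v2]; exact b3
    · simp [eval, v1', v2]
    · simp [m1, m2]
    · have : x ≠ d := by omega
      simp only [Function.update_of_ne this]
      rw [r2 x (by omega), r1 x hx]
  | load b e f ihe ihf =>
    have b1 := natAbs_eval_le hM hν he.1 hc.1 hr hm
    have b2 := natAbs_eval_le hM hν he.2 hc.2 hr hm
    have b3 := natAbs_eval_le (e := load b e f) hM hν he hc hr hm
    obtain ⟨τ, h1, v1, m1, r1⟩ := ihe (d := d) hk hd he.1 hc.1 hr hm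
    have hag : ∀ r < k, σ.reg r = τ.reg r := fun r hr => (r1 r (.inl hr)).symm
    obtain ⟨υ, h2, v2, m2, r2⟩ := ihf (d := d + 1) (σ := τ) hk (by omega) he.2
      (counts_congr he.2 hag m1.symm hc.2) (fun r h => by rw [← hag r h]; exact hr r h)
      (by simpa only [m1])
    rw [← eval_congr he.2 hag m1.symm] at v2
    have v1' : υ.reg d = e.eval σ := by rw [r2 d (by omega), v1]
    refine ⟨_, (h1.mono (hpow (by simp [deg]; omega)) le_rfl).seq
      ((h2.mono (hpow (by simp [deg]; omega)) le_rfl).seq (.load ?_ ?_ ?_)) |>.mono le_rfl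
        (by simp [steps]; omega), ?_, ?_, fun x hx => ?_⟩
    · rw [v1']; exact b1.trans (hpow (by simp [deg]; omega))
    · rw [v2]; exact b2.trans (hpow (by simp [deg]; omega))
    · rw [v1', v2, m2, m1]; exact b3
    · simp [eval, v1', v2, m1, m2]
    · simp [m1, m2]
    · have : x ≠ d := by omega
      simp only [Function.update_of_ne this]
      rw [r2 x (by omega), r1 x hx]
  | fold o c r N e ihN ihe =>
    obtain ⟨rfl, hr30, hc2, hN, he⟩ := he
    obtain ⟨hcN, hN0, hNν, hce⟩ := hc
    have hν' : ((N.eval σ).toNat : ℤ) = N.eval σ := Int.toNat_of_nonneg hN0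
    have hn : (N.eval σ).toNat ≤ ν := by omega
    set n := (N.eval σ).toNat
    have hMle : M ≤ M ^ (fold o c r N e).deg ν := Nat.le_self_pow (by simp [deg]) M
    have hdege : e.deg ν ≤ (fold o c r N e).deg ν ∨ n = 0 := by
      rcases Nat.eq_zero_or_pos n with h | h
      · exact .inr h
      · left
        have : 1 * (e.deg ν + 1) ≤ ν * (e.deg ν + 1) := Nat.mul_le_mul_right _ (by omega)
        simp only [deg]
        omega
    let σ₁ : RAMState := { σ with reg := Function.update σ.reg d c }
    have k1 : Runs (M ^ (fold o c r N e).deg ν) (.instr (.const d c)) σ σ₁ 1 :=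
      .const ((hc2.trans hM).trans hMle)
    have s1 : ∀ x, x ≠ d → σ₁.reg x = σ.reg x := fun x hx => by simp [σ₁, hx]
    have hag : ∀ x < r, σ.reg x = σ₁.reg x := fun x hx => (s1 x (by omega)).symm
    obtain ⟨σ₂, k2, v2, m2, r2⟩ := ihN (d := d + 1) (σ := σ₁) hk (by omega) hN
      (counts_congr hN hag rfl hcN) (fun x h => by rw [← hag x h]; exact hr x h) hm
    rw [← eval_congr hN hag rfl] at v2
    -- the values seen by the body in the `i`-th round
    have hset : ∀ i < n, ∀ x < r + 1, ((σ.set r i).reg x).natAbs ≤ M := fun i hi x hx => by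
      rw [RAMState.set_reg]
      split_ifs with h
      · omega
      · exact hr x (by omega)
    have hb : ∀ i < n, (e.eval (σ.set r i)).natAbs ≤ M ^ e.deg ν := fun i hi =>
      natAbs_eval_le hM hν he (hce i (by omega)) (hset i hi) hm
    have hacc : ∀ i ≤ n, (foldOp o c (fun i => e.eval (σ.set r i)) i).natAbs ≤
        M ^ (fold o c r N e).deg ν := fun i hi => by
      refine (natAbs_foldOp_le hM (one_le_deg ν e) o (hc2.trans hM) fun j hj =>
        hb j (by omega)).trans (hpow ?_)
      have : i * e.deg ν ≤ ν * (e.deg ν + 1) := Nat.mul_le_mul (by omega) (by omega)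
      simp only [deg]
      omega
    obtain ⟨τ, k3, hτ⟩ := Runs.forLoop (M := M ^ (fold o c r N e).deg ν) (r := r) (q := d + 1)
      (d := d + 2) (a := e.steps ν + 1) (n := n)
      (P := .seq (e.compile (d + 2)) (.instr (.op o d d (d + 2))))
      (fun i τ => τ.reg d = foldOp o c (fun i => e.eval (σ.set r i)) i ∧ τ.reg (d + 1) = n ∧
        τ.mem = σ.mem ∧ ∀ x, x < r ∨ 30 ≤ x ∧ x < d → τ.reg x = σ.reg x)
      (by omega) (by omega) (by omega) (by omega) (fun i τ h => h.2.1)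
      (fun i τ υ h hm' hr' => by
        refine ⟨by rw [hr' d (by omega) (by omega), h.1], by
          rw [hr' _ (by omega) (by omega), h.2.1], by rw [hm', h.2.2.1], fun x hx => ?_⟩
        rw [hr' x (by omega) (by omega), h.2.2.2 x hx])
      (fun i hi τ h hri => by
        obtain ⟨hd1, hd2, hmem, hreg⟩ := h
        have hdeg := hpow (hdege.resolve_right (by omega))
        have hag' : ∀ x < r + 1, (σ.set r i).reg x = τ.reg x := fun x hx => by
          rw [RAMState.set_reg]
          split_ifs with hxr
          · rw [hxr, hri]
          · exact (hreg x (by omega)).symm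
        obtain ⟨υ, h1, v1, m1, r1⟩ := ihe (d := d + 2) (σ := τ) (by omega) (by omega) he
          (counts_congr he hag' hmem.symm (hce i (by omega)))
          (fun x hx => by rw [← hag' x hx]; exact hset i hi x hx) (by simpa only [hmem])
        rw [← eval_congr he hag' hmem.symm] at v1
        have vd : υ.reg d = foldOp o c (fun i => e.eval (σ.set r i)) i := by
          rw [r1 d (by omega), hd1]
        refine ⟨_, (h1.mono hdeg le_rfl).seq (.op ?_ ?_ ?_), ⟨?_, ?_, ?_, fun x hx => ?_⟩, ?_⟩
        · rw [vd]; exact hacc i hi.le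
        · rw [v1]; exact (hb i hi).trans hdeg
        · rw [vd, v1]; exact hacc (i + 1) hi
        · simp [vd, v1, foldOp]
        · simp [r1 (d + 1) (by omega), hd2]
        · simp [m1, hmem]
        · have : x ≠ d := by omega
          simp only [Function.update_of_ne this]
          rw [r1 x (by omega), hreg x hx]
        · have : r ≠ d := by omega
          simp only [Function.update_of_ne this]
          rw [r1 r (by omega), hri])
      (σ := σ₂) (by
        refine ⟨by rw [r2 d (by omega)]; simp [σ₁, foldOp], by rw [v2, hν'], m2, fun x hx => ?_⟩
        rw [r2 x (by omega), s1 x (by omega)])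
    refine ⟨τ, (k1.seq ((k2.mono (hpow (by simp [deg]; omega)) le_rfl).seq k3)).mono le_rfl ?_,
      by rw [hτ.1]; rfl, hτ.2.2.1, hτ.2.2.2⟩
    have : n * (e.steps ν + 1 + 4) ≤ ν * (e.steps ν + 5) := Nat.mul_le_mul hn (by omega)
    simp only [steps]
    omega

end RAMExpr

/-! ### Assignments and tables -/

/-- `reg r := e` -/
def assign (r : ℕ) (e : RAMExpr) : RAMProgram :=
  .seq (e.compile 30) (.seq (.instr (.const r 0)) (.instr (.op .add r r 30)))

/-- `mem b (reg o + i, j) := e` for `i = 0, …, reg p - 1` and `j = 0, …, reg q - 1`, in the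
lexicographic order, where `e` may use `i = reg 20`, `j = reg 21` and the entries stored so far. -/
def tabulate (b o p q : ℕ) (e : RAMExpr) : RAMProgram :=
  forLoop 20 p 30 (forLoop 21 q 30 (.seq ((RAMExpr.op .add (.var o) (.var 20)).compile 30)
    (.seq ((RAMExpr.var 21).compile 31) (.seq (e.compile 32) (.instr (.store b 30 31 32))))))

/-- The integers in the registers `0, …, 19` and in the arrays have absolute value at most `M`. -/
structure BoundedBy (M : ℕ) (σ : RAMState) : Prop where
  reg : ∀ r < 20, (σ.reg r).natAbs ≤ M
  mem : ∀ b i j, (σ.mem b i j).natAbs ≤ M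

theorem BoundedBy.mono {M M' : ℕ} {σ : RAMState} (h : BoundedBy M σ) (hM : M ≤ M') :
    BoundedBy M' σ :=
  ⟨fun r hr => (h.reg r hr).trans hM, fun b i j => (h.mem b i j).trans hM⟩

/-- Correctness and cost of `assign`. -/
theorem assign_spec {M ν r : ℕ} {e : RAMExpr} {σ : RAMState} (hM : 2 ≤ M) (hν : ν + 1 ≤ M)
    (hr : r < 20) (he : e.Scoped 20) (hc : e.Counts ν σ) (hσ : BoundedBy M σ) :
    ∃ τ, Runs (M ^ e.deg ν) (assign r e) σ τ (e.steps ν + 2) ∧ τ.reg r = e.eval σ ∧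
      τ.mem = σ.mem ∧ (∀ x < 20, x ≠ r → τ.reg x = σ.reg x) ∧ BoundedBy (M ^ e.deg ν) τ := by
  obtain ⟨τ, h1, v1, m1, r1⟩ :=
    RAMExpr.compile_spec hM hν (by omega) le_rfl he hc hσ.reg hσ.mem
  have hb := RAMExpr.natAbs_eval_le hM hν he hc hσ.reg hσ.mem
  let τ₁ : RAMState := { τ with reg := Function.update τ.reg r 0 }
  have hMle : M ≤ M ^ e.deg ν := Nat.le_self_pow (by have := e.one_le_deg ν; omega) M
  have hr30 : (30 : ℕ) ≠ r := by omega
  have e1 : τ₁.reg r = 0 := by simp [τ₁]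
  have e2 : τ₁.reg 30 = e.eval σ := by simp [τ₁, hr30, v1]
  have k1 : Runs (M ^ e.deg ν) (.instr (.const r 0)) τ τ₁ 1 := .const (by simp)
  refine ⟨_, h1.seq (k1.seq (.op (by simp [e1]) (by simpa [e2]) (by simpa [RAMOp.eval, e1, e2]))),
    ?_, m1, fun x hx hxr => ?_, fun x hx => ?_, fun b i j => ?_⟩
  · simp [RAMOp.eval, e1, e2]
  · simp [τ₁, hxr, r1 x (by omega)]
  · by_cases hxr : x = r
    · simpa [hxr, RAMOp.eval, e1, e2] using hb
    · simpa [τ₁, hxr, r1 x (by omega)] using (hσ.reg x hx).trans hMle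
  · simpa only [τ₁, m1] using (hσ.mem b i j).trans hMle

/-- A bound for the number of steps of `tabulate`. -/
def tabulateSteps (ν : ℕ) (e : RAMExpr) : ℕ := ν * (ν * (e.steps ν + 12) + 7) + 3

/-- Correctness and cost of `tabulate`, which fills the rows `o', …, o' + m - 1` of a table `T`. The
bound for `T` is a hypothesis: as an entry may be computed from previous ones, a bound derived from
the expression would be raised to a power at each entry. -/
theorem tabulate_spec {M ν b o p q o' m n : ℕ} {e : RAMExpr} {σ : RAMState} (hM : 2 ≤ M)
    (hν : ν + 1 ≤ M) (ho : o < 20) (hp : p < 20) (hq : q < 20) (hσo : σ.reg o = o')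
    (hσp : σ.reg p = m) (hσq : σ.reg q = n) (hm : m ≤ ν) (hn : n ≤ ν) (he : e.Scoped 22)
    (hσ : BoundedBy M σ) (T : ℕ → ℕ → ℤ) (hT : ∀ i < m, ∀ j < n, (T (o' + i) j).natAbs ≤ M)
    (hbase : ∀ x < o', ∀ y < n, σ.mem b x y = T x y)
    (hstep : ∀ i < m, ∀ j < n, ∀ s : RAMState, (∀ x < 20, s.reg x = σ.reg x) → s.reg 20 = i →
      s.reg 21 = j → (∀ c ≠ b, s.mem c = σ.mem c) →
      (∀ x < o' + i, ∀ y < n, s.mem b x y = T x y) →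
      e.Counts ν s ∧ e.eval s = T (o' + i) j) :
    ∃ τ, Runs (M ^ (e.deg ν + 3)) (tabulate b o p q e) σ τ (tabulateSteps ν e) ∧
      (∀ x < 20, τ.reg x = σ.reg x) ∧ (∀ c ≠ b, τ.mem c = σ.mem c) ∧
      (∀ x < o' + m, ∀ y < n, τ.mem b x y = T x y) ∧ BoundedBy M τ := by
  have hpow : ∀ {a b : ℕ}, a ≤ b → M ^ a ≤ M ^ b := Nat.pow_le_pow_right (by omega)
  have hMle : M ≤ M ^ (e.deg ν + 3) := Nat.le_self_pow (by omega) M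
  have ho' : o' ≤ M := by have := hσ.reg o ho; omega
  -- rows below `o' + i` and, in row `o' + i`, columns below `j` are filled
  let J : ℕ → ℕ → RAMState → Prop := fun i j s =>
    (∀ x < 20, s.reg x = σ.reg x) ∧ (∀ c ≠ b, s.mem c = σ.mem c) ∧
    (∀ x < o' + i, ∀ y < n, s.mem b x y = T x y) ∧
    (∀ y < j, s.mem b (o' + i : ℕ) y = T (o' + i) y) ∧
    ∀ x y, (s.mem b x y).natAbs ≤ M
  have hSmall : ∀ {i j s}, J i j s → BoundedBy M s := fun {i j s} h => by
    refine ⟨fun r hr => by rw [h.1 r hr]; exact hσ.reg r hr, fun c x y => ?_⟩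
    by_cases hcb : c = b
    · rw [hcb]; exact h.2.2.2.2 x y
    · rw [h.2.1 c hcb]; exact hσ.mem c x y
  have hJ : ∀ i j s s', J i j s → s'.mem = s.mem → (∀ x < 20, s'.reg x = s.reg x) → J i j s' :=
    fun i j s s' h hm hr => ⟨fun x hx => by rw [hr x hx, h.1 x hx], by simpa only [hm] using h.2⟩
  obtain ⟨τ, hτ, hJτ⟩ := Runs.forLoop (M := M ^ (e.deg ν + 3)) (r := 20) (q := p) (d := 30)
    (a := ν * (e.steps ν + 12) + 3) (n := m)
    (P := forLoop 21 q 30 (.seq ((RAMExpr.op .add (.var o) (.var 20)).compile 30)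
      (.seq ((RAMExpr.var 21).compile 31) (.seq (e.compile 32) (.instr (.store b 30 31 32))))))
    (fun i s => J i 0 s) (by omega) (by omega) (by omega) (by omega)
    (fun i s h => by rw [h.1 p hp, hσp])
    (fun i s s' h hm hr => hJ i 0 s s' h hm fun x hx => hr x (by omega) (by omega))
    (fun i hi s h hs20 => by
      obtain ⟨τ, hτ, hJτ, h20⟩ := Runs.forLoop (M := M ^ (e.deg ν + 3)) (r := 21) (q := q) (d := 30)
        (a := e.steps ν + 8) (n := n)
        (P := .seq ((RAMExpr.op .add (.var o) (.var 20)).compile 30)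
          (.seq ((RAMExpr.var 21).compile 31) (.seq (e.compile 32) (.instr (.store b 30 31 32)))))
        (fun j s => J i j s ∧ s.reg 20 = i) (by omega) (by omega) (by omega) (by omega)
        (fun i s h => by rw [h.1.1 q hq, hσq])
        (fun j s s' h hm hr => ⟨hJ i j s s' h.1 hm fun x hx => hr x (by omega) (by omega),
          by rw [hr 20 (by omega) (by omega), h.2]⟩)
        (fun j hj s h hs21 => by
          obtain ⟨h, hs20⟩ := h
          have hsm := hSmall h
          obtain ⟨hreg, hmem, hrows, hrow, hbd⟩ := h
          have hs : ∀ r < 22, (s.reg r).natAbs ≤ M := fun r hr => by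
            rcases Nat.lt_or_ge r 20 with h | h
            · exact hsm.reg r h
            · obtain rfl | rfl : r = 20 ∨ r = 21 := by omega
              · rw [hs20]; omega
              · rw [hs21]; omega
          obtain ⟨hcnt, hev⟩ := hstep i hi j hj s hreg hs20 hs21 hmem hrows
          have hsc1 : (RAMExpr.op .add (.var o) (.var 20)).Scoped 22 := by
            simp [RAMExpr.Scoped]; omega
          obtain ⟨s1, k1, v1, m1, r1⟩ := RAMExpr.compile_spec (d := 30) (k := 22) hM hν (by omega)
            le_rfl hsc1 (by simp [RAMExpr.Counts]) hs hsm.mem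
          have hs1 : ∀ x < 22, s.reg x = s1.reg x := fun x hx => (r1 x (.inl hx)).symm
          obtain ⟨s2, k2, v2, m2, r2⟩ := RAMExpr.compile_spec (d := 31) (k := 22) (σ := s1)
            (e := .var 21) hM hν (by omega) (by omega) (by simp [RAMExpr.Scoped]) trivial
            (fun x hx => by rw [← hs1 x hx]; exact hs x hx) (by rw [m1]; exact hsm.mem)
          have hs2 : ∀ x < 22, s.reg x = s2.reg x := fun x hx =>
            (hs1 x hx).trans (r2 x (.inl hx)).symm
          have hm2 : s.mem = s2.mem := (m2.trans m1).symm
          obtain ⟨s3, k3, v3, m3, r3⟩ := RAMExpr.compile_spec (d := 32) (k := 22) (σ := s2)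
            (e := e) hM hν (by omega) (by omega) he
            (RAMExpr.counts_congr he hs2 hm2 hcnt)
            (fun x hx => by rw [← hs2 x hx]; exact hs x hx) (by rw [← hm2]; exact hsm.mem)
          rw [← RAMExpr.eval_congr he hs2 hm2, hev] at v3
          have v30 : s3.reg 30 = (o' + i : ℕ) := by
            rw [r3 30 (by omega), r2 30 (by omega), v1]
            simp [RAMExpr.eval, RAMOp.eval, hreg o ho, hσo, hs20]
          have v31 : s3.reg 31 = j := by
            rw [r3 31 (by omega), v2, RAMExpr.eval, ← hs1 21 (by omega), hs21]
          have hm3 : s3.mem = s.mem := m3.trans hm2.symm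
          have hs3 : ∀ x < 22, s3.reg x = s.reg x := fun x hx => by
            rw [r3 x (.inl hx), hs2 x hx]
          have hoi : o' + i ≤ M ^ (e.deg ν + 3) := by
            have : M ^ 2 ≤ M ^ (e.deg ν + 3) := hpow (by omega)
            nlinarith
          refine ⟨_, (k1.mono (hpow (by simp [RAMExpr.deg])) le_rfl).seq
            ((k2.mono (hpow (by simp [RAMExpr.deg])) le_rfl).seq
              ((k3.mono (hpow (by omega)) le_rfl).seq
              (.store (by rw [v30, Int.natAbs_natCast]; exact hoi) (by rw [v31]; simp; omega)
                (by rw [v3]; exact (hT i hi j hj).trans hMle)))) |>.mono le_rfl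
                  (by simp [RAMExpr.steps]; omega), ⟨⟨?_, ?_, ?_, ?_, ?_⟩, ?_⟩, ?_⟩
          · intro x hx
            simp only [RAMInstr.exec]
            rw [hs3 x (by omega), hreg x hx]
          · intro c hc
            simp only [RAMInstr.exec, Function.update_of_ne hc]
            rw [hm3, hmem c hc]
          · intro x hx y hy
            have : (x : ℤ) ≠ (o' + i : ℕ) := by omega
            simp only [RAMInstr.exec, v30, Function.update_self, Function.update_of_ne this]
            rw [hm3, hrows x hx y hy]
          · intro y hy
            simp only [RAMInstr.exec, v30, v31, v3, Function.update_self]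
            rcases Nat.lt_succ_iff_lt_or_eq.mp hy with hy | rfl
            · have : (y : ℤ) ≠ j := by omega
              rw [Function.update_of_ne this, hm3, hrow y hy]
            · simp
          · intro x y
            simp only [RAMInstr.exec, v30, v31, v3, Function.update_self]
            by_cases hx : x = (o' + i : ℕ)
            · rw [hx, Function.update_self, Function.update_apply]
              split_ifs
              · exact hT i hi j hj
              · rw [hm3]; exact hbd _ y
            · rw [Function.update_of_ne hx, hm3]
              exact hbd _ _
          · simp only [RAMInstr.exec]
            rw [hs3 20 (by omega), hs20]
          · simp only [RAMInstr.exec]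
            rw [hs3 21 (by omega), hs21])
        (σ := s) ⟨h, hs20⟩
      refine ⟨τ, hτ.mono le_rfl ?_, ⟨hJτ.1, hJτ.2.1, fun x hx y hy => ?_, fun y hy => by omega,
        hJτ.2.2.2.2⟩, h20⟩
      · exact Nat.add_le_add_right (Nat.mul_le_mul_right (e.steps ν + 12) hn) 3
      · rcases Nat.lt_succ_iff_lt_or_eq.mp (show x < o' + i + 1 by omega) with hx | rfl
        · exact hJτ.2.2.1 x hx y hy
        · exact hJτ.2.2.2.1 y hy)
    (σ := σ) ⟨fun _ _ => rfl, fun _ _ => rfl, by simpa using hbase, fun y hy => by omega, hσ.mem b⟩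
  refine ⟨τ, hτ.mono le_rfl ?_, hJτ.1, hJτ.2.1, hJτ.2.2.1, hSmall hJτ⟩
  exact Nat.add_le_add_right (Nat.mul_le_mul_right (ν * (e.steps ν + 12) + 7) hm) 3

/-! ### The generalized norm and the pseudoinverse -/

section

variable {l m n : ℕ}

theorem vecNorm_sq (v : Fin n → ℝ) : vecNorm 2 v ^ 2 = v ⬝ᵥ v := by
  rw [vecNorm, EuclideanSpace.norm_sq_eq]
  simp [dotProduct, sq]

theorem vecNorm_nonneg (v : Fin n → ℝ) : 0 ≤ vecNorm 2 v := norm_nonneg _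

theorem vecNorm_smul (c : ℝ) (v : Fin n → ℝ) : vecNorm 2 (c • v) = |c| * vecNorm 2 v := by
  rw [vecNorm, WithLp.toLp_smul, norm_smul, Real.norm_eq_abs, vecNorm]

theorem vecNorm_eq_zero {v : Fin n → ℝ} : vecNorm 2 v = 0 ↔ v = 0 := by
  simp [vecNorm]

theorem continuous_vecNorm_mulVec (A : Matrix (Fin m) (Fin n) ℝ) :
    Continuous fun v => vecNorm 2 (A.mulVec v) := by
  refine continuous_norm.comp ((PiLp.continuous_toLp 2 _).comp ?_)
  exact Continuous.matrix_mulVec continuous_const continuous_id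

theorem isCompact_vecNorm_le_one : IsCompact {v : Fin n → ℝ | vecNorm 2 v ≤ 1} := by
  have h : {v : Fin n → ℝ | vecNorm 2 v ≤ 1} =
      WithLp.ofLp '' Metric.closedBall (0 : EuclideanSpace ℝ (Fin n)) 1 := by
    ext v
    constructor
    · intro hv
      exact ⟨WithLp.toLp 2 v, by simpa [vecNorm] using hv, rfl⟩
    · rintro ⟨w, hw, rfl⟩
      simpa [vecNorm] using hw
  rw [h]
  exact (isCompact_closedBall _ _).image (PiLp.continuous_ofLp 2 _)

/-- The supremum defining the spectral norm is attained, since the unit ball is compact. -/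
theorem exists_eq_matrixNorm (M : Matrix (Fin m) (Fin n) ℝ) : ∃ w : Fin n → ℝ, vecNorm 2 w ≤ 1 ∧
    ENNReal.ofReal (vecNorm 2 (M.mulVec w)) = matrixNorm 2 2 M := by
  obtain ⟨w, hw, hmax⟩ := (isCompact_vecNorm_le_one (n := n)).exists_isMaxOn
    ⟨0, by simp [vecNorm]⟩ (continuous_vecNorm_mulVec M).continuousOn
  refine ⟨w, hw, le_antisymm ?_ ?_⟩
  · exact le_iSup₂_of_le (f := fun (v : Fin n → ℝ) (_ : vecNorm 2 v ≤ 1) =>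
      ENNReal.ofReal (vecNorm 2 (M.mulVec v))) w hw le_rfl
  · exact iSup₂_le fun v hv => ENNReal.ofReal_le_ofReal (hmax hv)

theorem KerLE.mulVec_eq_zero {B : Matrix (Fin l) (Fin n) ℝ} {A : Matrix (Fin m) (Fin n) ℝ}
    (h : KerLE B A) {v : Fin n → ℝ} (hv : B.mulVec v = 0) : A.mulVec v = 0 := by
  have : v ∈ LinearMap.ker A.mulVecLin := h (by simpa using hv)
  simpa using this

theorem KerLE.mulVec_pinv {B : Matrix (Fin l) (Fin n) ℝ} {A : Matrix (Fin m) (Fin n) ℝ}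
    (h : KerLE B A) (v : Fin n → ℝ) : (A * pinv B).mulVec (B.mulVec v) = A.mulVec v := by
  have h0 : B.mulVec ((pinv B).mulVec (B.mulVec v) - v) = 0 := by
    rw [Matrix.mulVec_sub, Matrix.mulVec_mulVec, Matrix.mulVec_mulVec,
      (pinv_spec B).mul_mul_left, sub_self]
  have h1 := h.mulVec_eq_zero h0
  rw [Matrix.mulVec_sub, sub_eq_zero] at h1
  rw [← Matrix.mulVec_mulVec, h1]

/-- `B B⁺` is an orthogonal projection, hence does not increase the norm. -/
theorem vecNorm_mulVec_pinv_le (B : Matrix (Fin l) (Fin n) ℝ) (w : Fin l → ℝ) :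
    vecNorm 2 (B.mulVec ((pinv B).mulVec w)) ≤ vecNorm 2 w := by
  set P := B * pinv B
  have hP : P * P = P := by
    rw [← Matrix.mul_assoc, (pinv_spec B).mul_mul_left]
  have hPt : P.transpose = P := (pinv_spec B).symm_left
  have horth : P.mulVec w ⬝ᵥ (w - P.mulVec w) = 0 := by
    have h := Matrix.vecMul_transpose P w
    rw [hPt] at h
    rw [← h, ← Matrix.dotProduct_mulVec, Matrix.mulVec_sub, h, Matrix.mulVec_mulVec, hP,
      sub_self, dotProduct_zero]
  have hsq : vecNorm 2 (P.mulVec w) ^ 2 ≤ vecNorm 2 w ^ 2 := by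
    rw [vecNorm_sq, vecNorm_sq]
    have hd : 0 ≤ (w - P.mulVec w) ⬝ᵥ (w - P.mulVec w) := by rw [← vecNorm_sq]; positivity
    have h2 := horth
    rw [dotProduct_sub] at h2
    rw [sub_dotProduct, horth, dotProduct_sub, dotProduct_comm w (P.mulVec w)] at hd
    linarith
  rw [Matrix.mulVec_mulVec]
  exact (sq_le_sq₀ (vecNorm_nonneg _) (vecNorm_nonneg _)).mp hsq

theorem le_genMatrixNorm {B : Matrix (Fin l) (Fin n) ℝ} (A : Matrix (Fin m) (Fin n) ℝ)
    {v : Fin n → ℝ} (hv : vecNorm 2 (B.mulVec v) ≤ 1) :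
    ENNReal.ofReal (vecNorm 2 (A.mulVec v)) ≤ genMatrixNorm 2 2 B A :=
  le_iSup₂_of_le (f := fun (v : Fin n → ℝ) (_ : vecNorm 2 (B.mulVec v) ≤ 1) =>
      ENNReal.ofReal (vecNorm 2 (A.mulVec v))) v hv le_rfl

theorem genMatrixNorm_eq_matrixNorm {B : Matrix (Fin l) (Fin n) ℝ}
    {A : Matrix (Fin m) (Fin n) ℝ} (h : KerLE B A) :
    genMatrixNorm 2 2 B A = matrixNorm 2 2 (A * pinv B) := by
  refine le_antisymm (iSup₂_le fun v hv => ?_) (iSup₂_le fun w hw => ?_)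
  · rw [← h.mulVec_pinv v]
    exact le_iSup₂_of_le (f := fun (v : Fin l → ℝ) (_ : vecNorm 2 v ≤ 1) =>
      ENNReal.ofReal (vecNorm 2 ((A * pinv B).mulVec v))) _ hv le_rfl
  · rw [← Matrix.mulVec_mulVec]
    exact le_genMatrixNorm A ((vecNorm_mulVec_pinv_le B w).trans hw)

theorem exists_eq_genMatrixNorm {B : Matrix (Fin l) (Fin n) ℝ} {A : Matrix (Fin m) (Fin n) ℝ}
    (h : KerLE B A) : ∃ v : Fin n → ℝ, vecNorm 2 (B.mulVec v) ≤ 1 ∧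
      ENNReal.ofReal (vecNorm 2 (A.mulVec v)) = genMatrixNorm 2 2 B A := by
  obtain ⟨w, hw, he⟩ := exists_eq_matrixNorm (A * pinv B)
  refine ⟨(pinv B).mulVec w, (vecNorm_mulVec_pinv_le B w).trans hw, ?_⟩
  rw [Matrix.mulVec_mulVec, he, genMatrixNorm_eq_matrixNorm h]

theorem genMatrixNorm_ne_top {B : Matrix (Fin l) (Fin n) ℝ} {A : Matrix (Fin m) (Fin n) ℝ}
    (h : KerLE B A) : genMatrixNorm 2 2 B A ≠ ⊤ := by
  obtain ⟨v, -, he⟩ := exists_eq_genMatrixNorm h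
  rw [← he]
  exact ENNReal.ofReal_ne_top

theorem genMatrixNorm_eq_top {B : Matrix (Fin l) (Fin n) ℝ} {A : Matrix (Fin m) (Fin n) ℝ}
    (h : ¬ KerLE B A) : genMatrixNorm 2 2 B A = ⊤ := by
  obtain ⟨v, hB, hA⟩ := SetLike.not_le_iff_exists.mp h
  simp only [LinearMap.mem_ker, Matrix.mulVecLin_apply] at hB hA
  have hpos : 0 < vecNorm 2 (A.mulVec v) :=
    lt_of_le_of_ne (vecNorm_nonneg _) fun h => hA (vecNorm_eq_zero.mp h.symm)
  refine ENNReal.eq_top_of_forall_nnreal_le fun r => ?_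
  -- the multiple of `v` whose image under `A` has norm `r`
  have := le_genMatrixNorm (B := B) A (v := ((r : ℝ) / vecNorm 2 (A.mulVec v)) • v)
    (by simp [Matrix.mulVec_smul, hB, vecNorm])
  rwa [Matrix.mulVec_smul, vecNorm_smul, abs_of_nonneg (by positivity),
    div_mul_cancel₀ _ hpos.ne', ENNReal.ofReal_coe_nnreal] at this

/-- The norm is the best constant in the homogeneous inequality `‖A v‖ ≤ t ‖B v‖`. -/
theorem genMatrixNorm_toReal_le_iff {B : Matrix (Fin l) (Fin n) ℝ} {A : Matrix (Fin m) (Fin n) ℝ}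
    (h : KerLE B A) {t : ℝ} (ht : 0 ≤ t) : (genMatrixNorm 2 2 B A).toReal ≤ t ↔
      ∀ v, A.mulVec v ⬝ᵥ A.mulVec v ≤ t ^ 2 * (B.mulVec v ⬝ᵥ B.mulVec v) := by
  have key : (genMatrixNorm 2 2 B A).toReal ≤ t ↔
      ∀ v, vecNorm 2 (B.mulVec v) ≤ 1 → vecNorm 2 (A.mulVec v) ≤ t := by
    rw [← ENNReal.le_ofReal_iff_toReal_le (genMatrixNorm_ne_top h) ht]
    refine iSup₂_le_iff.trans (forall₂_congr fun v _ => ENNReal.ofReal_le_ofReal_iff ht)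
  rw [key]
  constructor
  · intro H v
    rcases eq_or_ne (B.mulVec v) 0 with h0 | h0
    · simp [h0, h.mulVec_eq_zero h0]
    · have hpos : 0 < vecNorm 2 (B.mulVec v) :=
        lt_of_le_of_ne (vecNorm_nonneg _) fun h => h0 (vecNorm_eq_zero.mp h.symm)
      have := H ((vecNorm 2 (B.mulVec v))⁻¹ • v) (by
        rw [Matrix.mulVec_smul, vecNorm_smul, abs_of_pos (by positivity),
          inv_mul_cancel₀ hpos.ne'])
      rw [Matrix.mulVec_smul, vecNorm_smul, abs_of_pos (by positivity),
        inv_mul_le_iff₀ hpos] at this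
      rw [← vecNorm_sq, ← vecNorm_sq, ← mul_pow, mul_comm t]
      exact pow_le_pow_left₀ (vecNorm_nonneg _) this 2
  · intro H v hv
    have := H v
    rw [← vecNorm_sq, ← vecNorm_sq, ← mul_pow] at this
    have := (sq_le_sq₀ (vecNorm_nonneg _) (mul_nonneg ht (vecNorm_nonneg _))).mp this
    exact this.trans (mul_le_of_le_one_right ht hv)

end

/-! ### Negative semidefiniteness and the characteristic polynomial -/

section

variable {n : ℕ}

/-- The spectral theorem in terms of transposes. -/
theorem Matrix.IsHermitian.exists_orthogonal {S : Matrix (Fin n) (Fin n) ℝ} (hS : S.IsHermitian) :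
    ∃ U : Matrix (Fin n) (Fin n) ℝ, U.transpose * U = 1 ∧ U * U.transpose = 1 ∧
      S = U * Matrix.diagonal hS.eigenvalues * U.transpose := by
  have h1 := Unitary.coe_star_mul_self hS.eigenvectorUnitary
  rw [Matrix.star_eq_conjTranspose, Matrix.conjTranspose_eq_transpose_of_trivial] at h1
  refine ⟨hS.eigenvectorUnitary, h1, mul_eq_one_comm.mp h1, ?_⟩
  have := hS.spectral_theorem
  rw [Unitary.conjStarAlgAut_apply, Matrix.star_eq_conjTranspose,
    Matrix.conjTranspose_eq_transpose_of_trivial] at this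
  exact this

theorem dotProduct_diagonal_conj (U : Matrix (Fin n) (Fin n) ℝ) (d v : Fin n → ℝ) :
    v ⬝ᵥ (U * Matrix.diagonal d * U.transpose).mulVec v =
      ∑ i, d i * (U.transpose.mulVec v i) ^ 2 := by
  rw [← Matrix.mulVec_mulVec, ← Matrix.mulVec_mulVec, Matrix.dotProduct_mulVec,
    ← Matrix.mulVec_transpose, dotProduct]
  refine Finset.sum_congr rfl fun i _ => ?_
  rw [Matrix.mulVec_diagonal]
  ring

theorem trace_pow_eq_sum_eigenvalues {S : Matrix (Fin n) (Fin n) ℝ} (hS : S.IsHermitian)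
    (k : ℕ) :
    (S ^ k).trace = ∑ i, hS.eigenvalues i ^ k := by
  obtain ⟨U, hU, hU', hd⟩ := hS.exists_orthogonal
  have : S ^ k = U * Matrix.diagonal (hS.eigenvalues ^ k) * U.transpose := by
    induction k with
    | zero => simp [hU']
    | succ k ih =>
      rw [pow_succ, ih]
      nth_rw 2 [hd]
      rw [pow_succ, show Matrix.diagonal (hS.eigenvalues ^ k * hS.eigenvalues) =
        Matrix.diagonal (hS.eigenvalues ^ k) * Matrix.diagonal hS.eigenvalues from
        (Matrix.diagonal_mul_diagonal _ _).symm]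
      simp only [Matrix.mul_assoc]
      rw [← Matrix.mul_assoc U.transpose U, hU, Matrix.one_mul]
  rw [this, Matrix.mul_assoc, Matrix.trace_mul_comm, Matrix.mul_assoc, hU, Matrix.mul_one,
    Matrix.trace_diagonal]
  rfl

theorem charpoly_coeff_eq_esymm {S : Matrix (Fin n) (Fin n) ℝ} (hS : S.IsHermitian) {k : ℕ}
    (hk : k ≤ n) : S.charpoly.coeff (n - k) =
      (-1) ^ k * MvPolynomial.aeval hS.eigenvalues (MvPolynomial.esymm (Fin n) ℝ k) := by
  have hcard : (Finset.univ.val.map hS.eigenvalues).card = n := by simp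
  have h := Multiset.prod_X_sub_C_coeff (Finset.univ.val.map hS.eigenvalues)
    (k := n - k) (by rw [hcard]; omega)
  rw [hcard, show n - (n - k) = k by omega, Multiset.map_map] at h
  rw [hS.charpoly_eq, MvPolynomial.aeval_esymm_eq_multiset_esymm, ← h]
  rfl

/-- The coefficient of `X ^ (n - k)` of the characteristic polynomial, i.e. `(-1) ^ k` times the
`k`-th elementary symmetric function of the eigenvalues. -/
noncomputable def charCoeff {R : Type*} [CommRing R] (T : Matrix (Fin n) (Fin n) R) (k : ℕ) : R :=
  T.charpoly.coeff (n - k)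

theorem charCoeff_zero {R : Type*} [CommRing R] (T : Matrix (Fin n) (Fin n) R) :
    charCoeff T 0 = 1 := by
  have h := T.charpoly_monic.coeff_natDegree
  nontriviality R
  rwa [Matrix.charpoly_natDegree_eq_dim, Fintype.card_fin] at h

theorem charCoeff_map (T : Matrix (Fin n) (Fin n) ℤ) (k : ℕ) :
    charCoeff (T.map ((↑) : ℤ → ℝ)) k = (charCoeff T k : ℤ) := by
  have : (T.map ((↑) : ℤ → ℝ)).charpoly = T.charpoly.map (Int.castRingHom ℝ) :=
    T.charpoly_map (Int.castRingHom ℝ)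
  rw [charCoeff, this, Polynomial.coeff_map]
  rfl

theorem isHermitian_map {T : Matrix (Fin n) (Fin n) ℤ} (hT : T.transpose = T) :
    (T.map ((↑) : ℤ → ℝ)).IsHermitian := by
  rw [Matrix.IsHermitian, Matrix.conjTranspose_eq_transpose_of_trivial, ← Matrix.transpose_map, hT]

/-- Newton's identities for the coefficients of the characteristic polynomial and the traces of
powers. -/
theorem succ_mul_charCoeff {T : Matrix (Fin n) (Fin n) ℤ} (hT : T.transpose = T) {k : ℕ}
    (hk : k < n) : (k + 1 : ℤ) * charCoeff T (k + 1) =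
      -∑ i ∈ Finset.range (k + 1), charCoeff T (k - i) * (T ^ (i + 1)).trace := by
  have hS := isHermitian_map hT
  set S := T.map ((↑) : ℤ → ℝ)
  have htr : ∀ i, (((T ^ i).trace : ℤ) : ℝ) = ∑ j, hS.eigenvalues j ^ i := fun i => by
    rw [← trace_pow_eq_sum_eigenvalues hS]
    have h1 : S ^ i = (T ^ i).map ((↑) : ℤ → ℝ) := ((Int.castRingHom ℝ).mapMatrix.map_pow T i).symm
    rw [h1]
    simp [Matrix.trace]
  have hc : ∀ i ≤ n, ((charCoeff T i : ℤ) : ℝ) =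
      (-1) ^ i * MvPolynomial.aeval hS.eigenvalues (MvPolynomial.esymm (Fin n) ℝ i) :=
      fun i hi => by
        rw [← charCoeff_map, charCoeff, charpoly_coeff_eq_esymm hS hi]
  have hN := congrArg (MvPolynomial.aeval hS.eigenvalues)
    (MvPolynomial.mul_esymm_eq_sum (Fin n) ℝ (k + 1))
  simp only [map_mul, map_sum, map_pow, map_neg, map_one, map_natCast] at hN
  have hfilter : (Finset.HasAntidiagonal.antidiagonal (k + 1)).filter (fun a => a.1 < k + 1) =
      (Finset.range (k + 1)).image fun i => (k - i, i + 1) := by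
    ext ⟨a, b⟩
    simp only [Finset.mem_filter, Finset.HasAntidiagonal.mem_antidiagonal, Finset.mem_image,
      Finset.mem_range, Prod.mk.injEq]
    constructor
    · rintro ⟨h1, h2⟩
      exact ⟨b - 1, by omega, by omega, by omega⟩
    · rintro ⟨i, h1, h2, h3⟩
      omega
  rw [hfilter, Finset.sum_image (fun i hi j hj h => by simpa using congrArg Prod.snd h)] at hN
  have hR : (k + 1 : ℝ) * (charCoeff T (k + 1) : ℤ) =
      -∑ i ∈ Finset.range (k + 1), ((charCoeff T (k - i) : ℤ) : ℝ) * ((T ^ (i + 1)).trace : ℤ) := by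
    rw [hc (k + 1) hk, mul_left_comm]
    push_cast at hN ⊢
    rw [hN, ← mul_assoc, ← pow_add, show k + 1 + (k + 1 + 1) = 2 * (k + 1) + 1 by ring, pow_succ,
      pow_mul]
    simp only [even_two, Even.neg_pow, one_pow, one_mul, neg_mul]
    congr 1
    refine Finset.sum_congr rfl fun i hi => ?_
    rw [hc (k - i) (by omega), htr]
    simp [MvPolynomial.psum]
  exact_mod_cast hR

/-- A symmetric integer matrix is negative semidefinite if and only if the coefficients of its
characteristic polynomial are nonnegative: a monic polynomial with nonnegative coefficients has no
positive root, and a product of factors `X + c` with `c ≥ 0` has nonnegative coefficients. -/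
theorem charCoeff_nonneg_iff {T : Matrix (Fin n) (Fin n) ℤ} (hT : T.transpose = T) :
    (∀ k ≤ n, 0 ≤ charCoeff T k) ↔
      ∀ v : Fin n → ℝ, v ⬝ᵥ (T.map ((↑) : ℤ → ℝ)).mulVec v ≤ 0 := by
  have hS := isHermitian_map hT
  have hcoe : (∀ k ≤ n, 0 ≤ charCoeff T k) ↔
      ∀ k ≤ n, 0 ≤ (T.map ((↑) : ℤ → ℝ)).charpoly.coeff k := by
    constructor
    · intro h k hk
      have := h (n - k) (by omega)
      rw [← Int.cast_nonneg_iff (R := ℝ), ← charCoeff_map, charCoeff] at this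
      rwa [show n - (n - k) = k by omega] at this
    · intro h k hk
      rw [← Int.cast_nonneg_iff (R := ℝ), ← charCoeff_map]
      exact h _ (by omega)
  rw [hcoe]
  set S := T.map ((↑) : ℤ → ℝ)
  have hdeg : S.charpoly.natDegree = n := by rw [Matrix.charpoly_natDegree_eq_dim, Fintype.card_fin]
  obtain ⟨U, hU, hU', hd⟩ := hS.exists_orthogonal
  have hform : ∀ v, v ⬝ᵥ S.mulVec v = ∑ i, hS.eigenvalues i * (U.transpose.mulVec v i) ^ 2 :=
    fun v => by
      rw [← dotProduct_diagonal_conj]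
      exact congrArg (fun M => v ⬝ᵥ Matrix.mulVec M v) hd
  have heig : (∀ v, v ⬝ᵥ S.mulVec v ≤ 0) ↔ ∀ i, hS.eigenvalues i ≤ 0 := by
    constructor
    · intro h i
      rw [hS.eigenvalues_eq i]
      exact h _
    · intro h v
      rw [hform]
      exact Finset.sum_nonpos fun i _ => mul_nonpos_of_nonpos_of_nonneg (h i) (sq_nonneg _)
  rw [heig]
  constructor
  · intro h i
    by_contra! hpos
    have hroot : S.charpoly.eval (hS.eigenvalues i) = 0 := by
      rw [hS.charpoly_eq, Polynomial.eval_prod]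
      exact Finset.prod_eq_zero (Finset.mem_univ i) (by simp)
    rw [Polynomial.eval_eq_sum_range, hdeg, Finset.sum_range_succ] at hroot
    have h1 : S.charpoly.coeff n = 1 := by
      have := S.charpoly_monic.coeff_natDegree
      rwa [hdeg] at this
    have h2 : 0 ≤ ∑ k ∈ Finset.range n, S.charpoly.coeff k * hS.eigenvalues i ^ k :=
      Finset.sum_nonneg fun k hk =>
        mul_nonneg (h k (Finset.mem_range.mp hk).le) (pow_nonneg hpos.le k)
    have h3 : 0 < hS.eigenvalues i ^ n := pow_pos hpos n
    rw [h1] at hroot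
    linarith
  · intro h k _
    have : ∀ s : Finset (Fin n), ∀ k,
        0 ≤ (∏ i ∈ s, (Polynomial.X - Polynomial.C (hS.eigenvalues i))).coeff k := by
      intro s
      induction s using Finset.induction_on with
      | empty => intro k; simp [Polynomial.coeff_one]; split_ifs <;> simp
      | insert i s hi ih =>
        intro k
        rw [Finset.prod_insert hi, sub_mul, Polynomial.coeff_sub, Polynomial.coeff_C_mul]
        have h1 := mul_nonpos_of_nonpos_of_nonneg (h i) (ih k)
        cases k with
        | zero => simpa [Polynomial.mul_coeff_zero] using h1
        | succ k => rw [Polynomial.coeff_X_mul]; linarith [ih k]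
    rw [hS.charpoly_eq]
    exact this _ k

end

/-! ### An a priori bound for the norm -/

section

variable {l m n : ℕ}

theorem dotProduct_mulVec_self (B : Matrix (Fin l) (Fin n) ℝ) (v : Fin n → ℝ) :
    B.mulVec v ⬝ᵥ B.mulVec v = v ⬝ᵥ (B.transpose * B).mulVec v := by
  rw [← Matrix.mulVec_mulVec, Matrix.dotProduct_mulVec v, Matrix.vecMul_transpose]

theorem dotProduct_mulVec_self_le (A : Matrix (Fin m) (Fin n) ℝ) (v : Fin n → ℝ) :
    A.mulVec v ⬝ᵥ A.mulVec v ≤ (A.transpose * A).trace * (v ⬝ᵥ v) := by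
  have h : (A.transpose * A).trace = ∑ i, ∑ j, A i j ^ 2 := by
    rw [Finset.sum_comm]
    simp [Matrix.trace, Matrix.mul_apply, sq]
  rw [h, Finset.sum_mul, dotProduct]
  refine Finset.sum_le_sum fun i _ => ?_
  have := Finset.sum_mul_sq_le_sq_mul_sq Finset.univ (A i) v
  simpa only [Matrix.mulVec, dotProduct, sq] using this

/-- The product of the nonzero eigenvalues of an integer matrix is an integer, up to sign the last
nonzero coefficient of the characteristic polynomial. -/
theorem one_le_abs_prod_eigenvalues {T : Matrix (Fin n) (Fin n) ℤ}
    (hS : (T.map ((↑) : ℤ → ℝ)).IsHermitian) :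
    1 ≤ |∏ i with hS.eigenvalues i ≠ 0, hS.eigenvalues i| := by
  set Z : Finset (Fin n) := Finset.univ.filter fun i => hS.eigenvalues i ≠ 0
  have hchar : (T.map ((↑) : ℤ → ℝ)).charpoly = T.charpoly.map (Int.castRingHom ℝ) :=
    T.charpoly_map (Int.castRingHom ℝ)
  have hprod : (T.map ((↑) : ℤ → ℝ)).charpoly =
      (∏ i ∈ Z, (Polynomial.X - Polynomial.C (hS.eigenvalues i))) *
        Polynomial.X ^ (Finset.univ.filter fun i => ¬ hS.eigenvalues i ≠ 0).card := by
    rw [hS.charpoly_eq, ← Finset.prod_filter_mul_prod_filter_not Finset.univ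
      (fun i => hS.eigenvalues i ≠ 0)]
    congr 1
    refine Finset.prod_eq_pow_card fun i hi => ?_
    have : hS.eigenvalues i = 0 := by simpa using hi
    simp [this]
  have hcoeff := congrArg (fun p => p.coeff (Finset.univ.filter
    fun i => ¬ hS.eigenvalues i ≠ 0).card) (hchar.symm.trans hprod)
  simp only [Polynomial.coeff_map, Polynomial.coeff_mul_X_pow', le_refl, if_true, tsub_self,
    Polynomial.coeff_zero_prod, Polynomial.coeff_sub, Polynomial.coeff_X_zero,
    Polynomial.coeff_C_zero, zero_sub] at hcoeff
  set z := T.charpoly.coeff (Finset.univ.filter fun i => ¬ hS.eigenvalues i ≠ 0).card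
  have habs : |∏ i ∈ Z, hS.eigenvalues i| = ((|z| : ℤ) : ℝ) := by
    have : (z : ℝ) = ∏ i ∈ Z, -hS.eigenvalues i := hcoeff
    rw [Int.cast_abs, this, Finset.abs_prod, Finset.abs_prod]
    simp
  have hne : (∏ i ∈ Z, hS.eigenvalues i) ≠ 0 :=
    Finset.prod_ne_zero_iff.mpr fun i hi => (Finset.mem_filter.mp hi).2
  rw [habs]
  have : 0 < |z| := by
    have := abs_pos.mpr hne
    rw [habs] at this
    exact_mod_cast this
  exact_mod_cast this

theorem map_transpose_mul_self (B : Matrix (Fin l) (Fin n) ℤ) :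
    (B.transpose * B).map ((↑) : ℤ → ℝ) =
      (B.map ((↑) : ℤ → ℝ)).transpose * B.map ((↑) : ℤ → ℝ) := by
  rw [← Matrix.transpose_map]
  exact Matrix.map_mul (f := Int.castRingHom ℝ)

theorem trace_transpose_mul_self_nonneg (B : Matrix (Fin l) (Fin n) ℤ) :
    0 ≤ (B.transpose * B).trace := by
  refine Finset.sum_nonneg fun i _ => ?_
  rw [Matrix.diag_apply, Matrix.mul_apply]
  exact Finset.sum_nonneg fun j _ => mul_self_nonneg _

/-- An integral upper bound for the norm and its square. -/
def normBound (A : Matrix (Fin m) (Fin n) ℤ) (B : Matrix (Fin l) (Fin n) ℤ) : ℤ :=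
  (1 + (A.transpose * A).trace) * (1 + (B.transpose * B).trace) ^ n

theorem one_le_normBound (A : Matrix (Fin m) (Fin n) ℤ) (B : Matrix (Fin l) (Fin n) ℤ) :
    1 ≤ normBound A B := by
  have h1 := trace_transpose_mul_self_nonneg A
  have h2 : 1 ≤ (1 + (B.transpose * B).trace) ^ n :=
    one_le_pow₀ (by linarith [trace_transpose_mul_self_nonneg B])
  rw [normBound]
  nlinarith

/-- If the nonzero eigenvalues of `Bᵀ B` have a product of at least `1` and a sum of `τ`, then each
of them is at least `(1 + τ) ^ (-n)`. Hence `‖v‖² ≤ (1 + τ) ^ n ‖B v‖²` for `v` orthogonal to the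
kernel of `B`. -/
theorem dotProduct_mulVec_le_normBound {A : Matrix (Fin m) (Fin n) ℤ}
    {B : Matrix (Fin l) (Fin n) ℤ} (h : KerLE (B.map ((↑) : ℤ → ℝ)) (A.map ((↑) : ℤ → ℝ)))
    (v : Fin n → ℝ) :
    (A.map ((↑) : ℤ → ℝ)).mulVec v ⬝ᵥ (A.map ((↑) : ℤ → ℝ)).mulVec v ≤
      normBound A B * ((B.map ((↑) : ℤ → ℝ)).mulVec v ⬝ᵥ (B.map ((↑) : ℤ → ℝ)).mulVec v) := by
  have hS : ((B.transpose * B).map ((↑) : ℤ → ℝ)).IsHermitian :=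
    isHermitian_map (by rw [Matrix.transpose_mul, Matrix.transpose_transpose])
  obtain ⟨U, hU, hU', hd⟩ := hS.exists_orthogonal
  have hprod := one_le_abs_prod_eigenvalues hS
  have htr := trace_pow_eq_sum_eigenvalues hS 1
  set ev := hS.eigenvalues
  rw [map_transpose_mul_self] at hd
  set A' := A.map ((↑) : ℤ → ℝ)
  set B' := B.map ((↑) : ℤ → ℝ)
  have hform : ∀ v, B'.mulVec v ⬝ᵥ B'.mulVec v = ∑ i, ev i * (U.transpose.mulVec v i) ^ 2 :=
    fun v => by rw [dotProduct_mulVec_self, hd, dotProduct_diagonal_conj]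
  have hev : ∀ i, 0 ≤ ev i := fun i => by
    have h1 := hform (U.mulVec (Pi.single i 1))
    rw [Matrix.mulVec_mulVec _ U.transpose U, hU, Matrix.one_mulVec] at h1
    have h2 : ∑ j, ev j * (Pi.single i 1 : Fin n → ℝ) j ^ 2 = ev i := by
      rw [Finset.sum_eq_single i (fun j _ hj => by simp [hj]) (by simp)]
      simp
    rw [← h2, ← h1, ← vecNorm_sq]
    positivity
  have htr' : ((B.transpose * B).trace : ℝ) = ∑ i, ev i := by
    simpa [Matrix.trace] using htr
  set τ : ℝ := ((B.transpose * B).trace : ℝ)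
  have hτ : ∀ i, ev i ≤ 1 + τ := fun i => by
    rw [htr']
    linarith [Finset.single_le_sum (fun j _ => hev j) (Finset.mem_univ i)]
  have hτ0 : 0 ≤ τ := by rw [htr']; exact Finset.sum_nonneg fun i _ => hev i
  have hmin : ∀ i, ev i ≠ 0 → 1 ≤ (1 + τ) ^ n * ev i := fun i hi => by
    rw [abs_of_nonneg (Finset.prod_nonneg fun j _ => hev j), ← Finset.mul_prod_erase _ _
      (show i ∈ Finset.univ.filter fun i => ev i ≠ 0 by simpa using hi)] at hprod
    have h1 : ∏ j ∈ (Finset.univ.filter fun i => ev i ≠ 0).erase i, ev j ≤ (1 + τ) ^ n := by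
      refine (Finset.prod_le_prod (fun j _ => hev j) fun j _ => hτ j).trans ?_
      rw [Finset.prod_const]
      refine pow_le_pow_right₀ (by linarith) ((Finset.card_le_univ _).trans ?_)
      simp
    rw [mul_comm]
    exact hprod.trans (mul_le_mul_of_nonneg_left h1 (hev i))
  -- the component of `v` orthogonal to the kernel of `B`
  set w := U.transpose.mulVec v
  let w' : Fin n → ℝ := fun i => if ev i = 0 then 0 else w i
  let v' := U.mulVec w'
  have hUv' : U.transpose.mulVec v' = w' := by
    rw [Matrix.mulVec_mulVec, hU, Matrix.one_mulVec]
  have hker : B'.mulVec (v - v') = 0 := by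
    rw [← dotProduct_self_eq_zero, hform, Matrix.mulVec_sub, hUv']
    refine Finset.sum_eq_zero fun i _ => ?_
    by_cases hi : ev i = 0 <;> simp [w', hi, w]
  have hA : A'.mulVec v = A'.mulVec v' := by
    have := h.mulVec_eq_zero hker
    rwa [Matrix.mulVec_sub, sub_eq_zero] at this
  have hv' : v' ⬝ᵥ v' = ∑ i, w' i ^ 2 := by
    have : v' ⬝ᵥ v' = w' ⬝ᵥ w' := by
      rw [dotProduct_mulVec_self, hU, Matrix.one_mulVec]
    rw [this]
    simp [dotProduct, sq]
  have hle : v' ⬝ᵥ v' ≤ (1 + τ) ^ n * (B'.mulVec v ⬝ᵥ B'.mulVec v) := by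
    rw [hv', hform, Finset.mul_sum]
    refine Finset.sum_le_sum fun i _ => ?_
    by_cases hi : ev i = 0
    · simp [w', hi]
    · simp only [w', hi, if_false]
      have := mul_le_mul_of_nonneg_right (hmin i hi) (sq_nonneg (w i))
      linarith
  have hBB : 0 ≤ B'.mulVec v ⬝ᵥ B'.mulVec v := by rw [← vecNorm_sq]; positivity
  have hAtr : (A'.transpose * A').trace = ((A.transpose * A).trace : ℝ) := by
    rw [← map_transpose_mul_self]
    simp [Matrix.trace]
  have hA0 : (0 : ℝ) ≤ (A.transpose * A).trace := by
    exact_mod_cast trace_transpose_mul_self_nonneg A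
  have hvv : 0 ≤ v' ⬝ᵥ v' := by rw [← vecNorm_sq]; positivity
  calc A'.mulVec v ⬝ᵥ A'.mulVec v ≤ (A.transpose * A).trace * (v' ⬝ᵥ v') := by
        rw [hA, ← hAtr]; exact dotProduct_mulVec_self_le A' v'
    _ ≤ (1 + (A.transpose * A).trace) * ((1 + τ) ^ n * (B'.mulVec v ⬝ᵥ B'.mulVec v)) :=
        mul_le_mul (by linarith) hle hvv (by linarith)
    _ = _ := by rw [normBound]; push_cast; ring

/-! ### Clearing denominators -/

/-- The product of all denominators of the entries of two rational matrices. -/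
def commonDen (A : Matrix (Fin m) (Fin n) ℚ) (B : Matrix (Fin l) (Fin n) ℚ) : ℤ :=
  (∏ i, ∏ j, ((A i j).den : ℤ)) * ∏ i, ∏ j, ((B i j).den : ℤ)

/-- The matrix `D A`, which is integral if `D` is a common denominator of the entries of `A`. -/
def scaled (D : ℤ) (A : Matrix (Fin m) (Fin n) ℚ) : Matrix (Fin m) (Fin n) ℤ :=
  Matrix.of fun i j => (A i j).num * (D / (A i j).den)

theorem commonDen_pos (A : Matrix (Fin m) (Fin n) ℚ) (B : Matrix (Fin l) (Fin n) ℚ) :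
    0 < commonDen A B := by
  refine mul_pos ?_ ?_ <;> exact Finset.prod_pos fun i _ => Finset.prod_pos fun j _ => by
    exact_mod_cast Rat.den_pos _

theorem den_dvd_commonDen_left (A : Matrix (Fin m) (Fin n) ℚ) (B : Matrix (Fin l) (Fin n) ℚ)
    (i : Fin m) (j : Fin n) : ((A i j).den : ℤ) ∣ commonDen A B :=
  ((Finset.dvd_prod_of_mem (fun j => ((A i j).den : ℤ)) (Finset.mem_univ j)).trans
    (Finset.dvd_prod_of_mem (fun i => ∏ j, ((A i j).den : ℤ)) (Finset.mem_univ i))).mul_right _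

theorem den_dvd_commonDen_right (A : Matrix (Fin m) (Fin n) ℚ) (B : Matrix (Fin l) (Fin n) ℚ)
    (i : Fin l) (j : Fin n) : ((B i j).den : ℤ) ∣ commonDen A B :=
  ((Finset.dvd_prod_of_mem (fun j => ((B i j).den : ℤ)) (Finset.mem_univ j)).trans
    (Finset.dvd_prod_of_mem (fun i => ∏ j, ((B i j).den : ℤ)) (Finset.mem_univ i))).mul_left _

theorem scaled_map {D : ℤ} {A : Matrix (Fin m) (Fin n) ℚ}
    (h : ∀ i j, ((A i j).den : ℤ) ∣ D) : (scaled D A).map ((↑) : ℤ → ℝ) = (D : ℝ) • toReal A := by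
  ext i j
  obtain ⟨k, hk⟩ := h i j
  have hden : ((A i j).den : ℝ) ≠ 0 := by exact_mod_cast (A i j).den_nz
  have h1 : D / (A i j).den = k := by
    rw [hk, Int.mul_ediv_cancel_left _ (by exact_mod_cast (A i j).den_nz)]
  simp only [scaled, Matrix.map_apply, Matrix.of_apply, h1, Matrix.smul_apply, toReal, smul_eq_mul]
  rw [hk, Rat.cast_def (A i j)]
  push_cast
  field_simp

end

/-! ### Comparison by integer arithmetic -/

section

variable {l m n : ℕ}

/-- The matrix `(t_d D A)ᵀ (t_d D A) - (t_n D B)ᵀ (t_n D B)`, with `D` a common denominator; it is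
negative semidefinite if and only if `‖A v‖ ≤ (t_n / t_d) ‖B v‖` for all `v`. -/
def testMatrix (A : Matrix (Fin m) (Fin n) ℚ) (B : Matrix (Fin l) (Fin n) ℚ) (tn td : ℤ) :
    Matrix (Fin n) (Fin n) ℤ :=
  Matrix.of fun i j =>
    td ^ 2 * ((scaled (commonDen A B) A).transpose * scaled (commonDen A B) A) i j -
      tn ^ 2 * ((scaled (commonDen A B) B).transpose * scaled (commonDen A B) B) i j

theorem testMatrix_transpose (A : Matrix (Fin m) (Fin n) ℚ) (B : Matrix (Fin l) (Fin n) ℚ)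
    (tn td : ℤ) : (testMatrix A B tn td).transpose = testMatrix A B tn td := by
  ext i j
  simp [testMatrix, Matrix.mul_apply, mul_comm]

/-- Comparison of the norm with a nonnegative rational number by integer arithmetic. -/
theorem genMatrixNorm_le_div_iff {A : Matrix (Fin m) (Fin n) ℚ} {B : Matrix (Fin l) (Fin n) ℚ}
    (h : KerLE (toReal B) (toReal A)) {tn td : ℤ} (htn : 0 ≤ tn) (htd : 0 < td) :
    (genMatrixNorm 2 2 (toReal B) (toReal A)).toReal ≤ (tn : ℝ) / td ↔
      ∀ k ≤ n, 0 ≤ charCoeff (testMatrix A B tn td) k := by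
  have htn' : (0 : ℝ) ≤ tn := by exact_mod_cast htn
  have htd' : (0 : ℝ) < td := by exact_mod_cast htd
  rw [charCoeff_nonneg_iff (testMatrix_transpose A B tn td),
    genMatrixNorm_toReal_le_iff h (by positivity)]
  refine forall_congr' fun v => ?_
  have hD : (0 : ℝ) < commonDen A B := by exact_mod_cast commonDen_pos A B
  set D := commonDen A B
  have hmap : (testMatrix A B tn td).map ((↑) : ℤ → ℝ) =
      (td : ℝ) ^ 2 • ((scaled D A).transpose * scaled D A).map ((↑) : ℤ → ℝ) -
        (tn : ℝ) ^ 2 • ((scaled D B).transpose * scaled D B).map ((↑) : ℤ → ℝ) := by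
    ext i j
    simp [testMatrix, D]
  rw [hmap, map_transpose_mul_self, map_transpose_mul_self,
    scaled_map (den_dvd_commonDen_left A B), scaled_map (den_dvd_commonDen_right A B),
    Matrix.sub_mulVec, Matrix.smul_mulVec, Matrix.smul_mulVec, dotProduct_sub,
    dotProduct_smul, dotProduct_smul, ← dotProduct_mulVec_self, ← dotProduct_mulVec_self,
    Matrix.smul_mulVec, Matrix.smul_mulVec]
  simp only [smul_dotProduct, dotProduct_smul, smul_eq_mul]
  rw [div_pow, div_mul_eq_mul_div, le_div_iff₀ (by positivity)]
  set a := (toReal A).mulVec v ⬝ᵥ (toReal A).mulVec v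
  set b := (toReal B).mulVec v ⬝ᵥ (toReal B).mulVec v
  have e : (td : ℝ) ^ 2 * ((D : ℝ) * (D * a)) - tn ^ 2 * (D * (D * b)) =
      (D : ℝ) ^ 2 * (a * td ^ 2 - tn ^ 2 * b) := by ring
  have hD2 : 0 < (D : ℝ) ^ 2 := by positivity
  rw [e, ← sub_nonpos]
  exact ⟨mul_nonpos_of_nonneg_of_nonpos hD2.le, fun h => nonpos_of_mul_nonpos_right h hD2⟩

theorem genMatrixNorm_le_normBound {A : Matrix (Fin m) (Fin n) ℚ} {B : Matrix (Fin l) (Fin n) ℚ}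
    (h : KerLE (toReal B) (toReal A)) :
    (genMatrixNorm 2 2 (toReal B) (toReal A)).toReal ≤
      normBound (scaled (commonDen A B) A) (scaled (commonDen A B) B) := by
  have hD : (0 : ℝ) < commonDen A B := by exact_mod_cast commonDen_pos A B
  have hU := one_le_normBound (scaled (commonDen A B) A) (scaled (commonDen A B) B)
  have hA := scaled_map (den_dvd_commonDen_left A B)
  have hB := scaled_map (den_dvd_commonDen_right A B)
  have hker : KerLE ((scaled (commonDen A B) B).map ((↑) : ℤ → ℝ))
      ((scaled (commonDen A B) A).map ((↑) : ℤ → ℝ)) := by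
    rw [hA, hB]
    intro v hv
    simp only [LinearMap.mem_ker, Matrix.mulVecLin_apply, Matrix.smul_mulVec, smul_eq_zero,
      hD.ne', false_or] at hv ⊢
    exact h.mulVec_eq_zero hv
  have hle := dotProduct_mulVec_le_normBound hker
  rw [hA, hB] at hle
  set U := normBound (scaled (commonDen A B) A) (scaled (commonDen A B) B)
  have hU' : (1 : ℝ) ≤ U := by exact_mod_cast hU
  rw [genMatrixNorm_toReal_le_iff h (by linarith)]
  intro v
  have hv := hle v
  simp only [Matrix.smul_mulVec, smul_dotProduct, dotProduct_smul, smul_eq_mul] at hv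
  have hb : 0 ≤ (toReal B).mulVec v ⬝ᵥ (toReal B).mulVec v := by rw [← vecNorm_sq]; positivity
  set a := (toReal A).mulVec v ⬝ᵥ (toReal A).mulVec v
  set b := (toReal B).mulVec v ⬝ᵥ (toReal B).mulVec v
  set D := (commonDen A B : ℝ)
  have h1 : D ^ 2 * a ≤ D ^ 2 * (U * b) := by linarith
  have h2 : a ≤ U * b := le_of_mul_le_mul_left h1 (by positivity)
  have h3 : (U : ℝ) * b ≤ U ^ 2 * b :=
    mul_le_mul_of_nonneg_right (le_self_pow₀ hU' two_ne_zero) hb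
  linarith

end

/-! ### The size of the intermediate results -/

section

variable {n : ℕ}

theorem natAbs_pow_apply_le {T : Matrix (Fin n) (Fin n) ℤ} {Q : ℕ} (hn : n ≤ Q)
    (hT : ∀ i j, (T i j).natAbs ≤ Q) (k : ℕ) (i j : Fin n) :
    ((T ^ k) i j).natAbs ≤ Q ^ (2 * k) := by
  induction k generalizing i j with
  | zero => rw [pow_zero, Matrix.one_apply]; split_ifs <;> simp
  | succ k ih =>
    rw [pow_succ, Matrix.mul_apply]
    calc _ ≤ ∑ a, ((T ^ k) i a * T a j).natAbs := Int.natAbs_sum_le _ _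
      _ ≤ ∑ _a : Fin n, Q ^ (2 * k) * Q := Finset.sum_le_sum fun a _ => by
          rw [Int.natAbs_mul]; exact Nat.mul_le_mul (ih i a) (hT a j)
      _ = n * (Q ^ (2 * k) * Q) := by simp
      _ ≤ Q * (Q ^ (2 * k) * Q) := Nat.mul_le_mul_right _ hn
      _ = Q ^ (2 * (k + 1)) := by ring

theorem natAbs_trace_pow_le {T : Matrix (Fin n) (Fin n) ℤ} {Q : ℕ} (hn : n ≤ Q)
    (hT : ∀ i j, (T i j).natAbs ≤ Q) (k : ℕ) :
    ((T ^ k).trace).natAbs ≤ Q ^ (2 * k + 1) := by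
  calc _ ≤ ∑ i, ((T ^ k) i i).natAbs := Int.natAbs_sum_le _ _
    _ ≤ ∑ _i : Fin n, Q ^ (2 * k) := Finset.sum_le_sum fun i _ => natAbs_pow_apply_le hn hT k i i
    _ = n * Q ^ (2 * k) := by simp
    _ ≤ Q * Q ^ (2 * k) := Nat.mul_le_mul_right _ hn
    _ = Q ^ (2 * k + 1) := by ring

theorem natAbs_charCoeff_le {T : Matrix (Fin n) (Fin n) ℤ} {Q : ℕ} (hsymm : T.transpose = T)
    (hn : n ≤ Q) (hQ : 1 ≤ Q) (hT : ∀ i j, (T i j).natAbs ≤ Q) (k : ℕ) (hk : k ≤ n) :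
    (charCoeff T k).natAbs ≤ Q ^ (4 * k) := by
  induction k using Nat.strong_induction_on with
  | _ k ih =>
    cases k with
    | zero => simp [charCoeff_zero]
    | succ k =>
      have hN := congrArg Int.natAbs (succ_mul_charCoeff hsymm (show k < n by omega))
      rw [Int.natAbs_mul, Int.natAbs_neg] at hN
      calc _ ≤ (k + 1 : ℤ).natAbs * (charCoeff T (k + 1)).natAbs :=
            Nat.le_mul_of_pos_left _ (by omega)
        _ ≤ ∑ i ∈ Finset.range (k + 1), (charCoeff T (k - i) * (T ^ (i + 1)).trace).natAbs := by
            rw [hN]; exact Int.natAbs_sum_le _ _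
        _ ≤ ∑ i ∈ Finset.range (k + 1), Q ^ (4 * k + 3) := Finset.sum_le_sum fun i hi => by
            have hi := Finset.mem_range.mp hi
            rw [Int.natAbs_mul]
            calc _ ≤ Q ^ (4 * (k - i)) * Q ^ (2 * (i + 1) + 1) :=
                  Nat.mul_le_mul (ih (k - i) (by omega) (by omega)) (natAbs_trace_pow_le hn hT _)
              _ = Q ^ (4 * (k - i) + (2 * (i + 1) + 1)) := (pow_add _ _ _).symm
              _ ≤ _ := Nat.pow_le_pow_right hQ (by omega)
        _ = (k + 1) * Q ^ (4 * k + 3) := by simp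
        _ ≤ Q * Q ^ (4 * k + 3) := Nat.mul_le_mul_right _ (by omega)
        _ = Q ^ (4 * (k + 1)) := by ring

end

/-- If the expression does not refer to the table itself, the bound for the entries follows from
the expression. -/
theorem tabulate_spec_of_independent {M ν b o p q o' m n : ℕ} {e : RAMExpr} {σ : RAMState}
    (hM : 2 ≤ M) (hν : ν + 1 ≤ M) (ho : o < 20) (hp : p < 20) (hq : q < 20) (hσo : σ.reg o = o')
    (hσp : σ.reg p = m) (hσq : σ.reg q = n) (hm : m ≤ ν) (hn : n ≤ ν) (he : e.Scoped 22)
    (hσ : BoundedBy M σ) (T : ℕ → ℕ → ℤ) (hbase : ∀ x < o', ∀ y < n, σ.mem b x y = T x y)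
    (hstep : ∀ i < m, ∀ j < n, ∀ s : RAMState, (∀ x < 20, s.reg x = σ.reg x) → s.reg 20 = i →
      s.reg 21 = j → (∀ c ≠ b, s.mem c = σ.mem c) →
      e.Counts ν s ∧ e.eval s = T (o' + i) j) :
    ∃ τ, Runs ((M ^ e.deg ν) ^ (e.deg ν + 3)) (tabulate b o p q e) σ τ (tabulateSteps ν e) ∧
      (∀ x < 20, τ.reg x = σ.reg x) ∧ (∀ c ≠ b, τ.mem c = σ.mem c) ∧
      (∀ x < o' + m, ∀ y < n, τ.mem b x y = T x y) ∧ BoundedBy (M ^ e.deg ν) τ := by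
  have hMle : M ≤ M ^ e.deg ν := Nat.le_self_pow (by have := e.one_le_deg ν; omega) M
  refine tabulate_spec (hM.trans hMle) (hν.trans hMle) ho hp hq hσo hσp hσq hm hn he
    (hσ.mono hMle) T (fun i hi j hj => ?_) hbase
    fun i hi j hj s h1 h2 h3 h4 _ => hstep i hi j hj s h1 h2 h3 h4
  have hreg : ∀ x < 20, ((σ.set 20 i).set 21 j).reg x = σ.reg x := fun x hx => by
    rw [RAMState.set_reg_of_ne _ (by omega), RAMState.set_reg_of_ne _ (by omega)]
  have h20 : ((σ.set 20 i).set 21 j).reg 20 = i := by simp [RAMState.set_reg]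
  have h21 : ((σ.set 20 i).set 21 j).reg 21 = j := by simp
  obtain ⟨hc, hT⟩ := hstep i hi j hj ((σ.set 20 i).set 21 j) hreg h20 h21 fun _ _ => rfl
  rw [← hT]
  refine RAMExpr.natAbs_eval_le hM hν he hc (fun r hr => ?_) hσ.mem
  rcases Nat.lt_or_ge r 20 with h | h
  · rw [hreg r h]; exact hσ.reg r h
  · obtain rfl | rfl : r = 20 ∨ r = 21 := by omega
    · rw [h20]; omega
    · rw [h21]; omega

/-! ### The programs -/

namespace RAMExpr

instance : Add RAMExpr := ⟨op .add⟩
instance : Sub RAMExpr := ⟨op .sub⟩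
instance : Mul RAMExpr := ⟨op .mul⟩
instance : Div RAMExpr := ⟨op .div⟩

/-- `∑ e` over `reg r = 0, …, N - 1` -/
def sum (r : ℕ) (N e : RAMExpr) : RAMExpr := fold .add 0 r N e

/-- `∏ e` over `reg r = 0, …, N - 1` -/
def prod (r : ℕ) (N e : RAMExpr) : RAMExpr := fold .mul 1 r N e

section

variable (e f N : RAMExpr) (σ : RAMState) (r k ν b : ℕ) (c : ℤ)

@[simp] theorem eval_var : (var r).eval σ = σ.reg r := rfl
@[simp] theorem eval_const : (const c).eval σ = c := rfl
@[simp] theorem eval_add : (e + f).eval σ = e.eval σ + f.eval σ := rfl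
@[simp] theorem eval_sub : (e - f).eval σ = e.eval σ - f.eval σ := rfl
@[simp] theorem eval_mul : (e * f).eval σ = e.eval σ * f.eval σ := rfl
@[simp] theorem eval_div : (e / f).eval σ = e.eval σ / f.eval σ := rfl
@[simp] theorem eval_load : (load b e f).eval σ = σ.mem b (e.eval σ) (f.eval σ) := rfl
@[simp] theorem eval_sum : (sum r N e).eval σ =
    ∑ i ∈ Finset.range (N.eval σ).toNat, e.eval (σ.set r i) := foldOp_add _ _
@[simp] theorem eval_prod : (prod r N e).eval σ =
    ∏ i ∈ Finset.range (N.eval σ).toNat, e.eval (σ.set r i) := foldOp_mul _ _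

@[simp] theorem scoped_var : (var r).Scoped k ↔ r < k := .rfl
@[simp] theorem scoped_const : (const c).Scoped k ↔ c.natAbs ≤ 2 := .rfl
@[simp] theorem scoped_add : (e + f).Scoped k ↔ e.Scoped k ∧ f.Scoped k := .rfl
@[simp] theorem scoped_sub : (e - f).Scoped k ↔ e.Scoped k ∧ f.Scoped k := .rfl
@[simp] theorem scoped_mul : (e * f).Scoped k ↔ e.Scoped k ∧ f.Scoped k := .rfl
@[simp] theorem scoped_div : (e / f).Scoped k ↔ e.Scoped k ∧ f.Scoped k := .rfl
@[simp] theorem scoped_load : (load b e f).Scoped k ↔ e.Scoped k ∧ f.Scoped k := .rfl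
@[simp] theorem scoped_sum :
    (sum r N e).Scoped k ↔ r = k ∧ k < 30 ∧ N.Scoped k ∧ e.Scoped (k + 1) := by
  simp [sum, Scoped]
@[simp] theorem scoped_prod :
    (prod r N e).Scoped k ↔ r = k ∧ k < 30 ∧ N.Scoped k ∧ e.Scoped (k + 1) := by
  simp [prod, Scoped]

@[simp] theorem counts_var : (var r).Counts ν σ := trivial
@[simp] theorem counts_const : (const c).Counts ν σ := trivial
@[simp] theorem counts_add : (e + f).Counts ν σ ↔ e.Counts ν σ ∧ f.Counts ν σ := .rfl
@[simp] theorem counts_sub : (e - f).Counts ν σ ↔ e.Counts ν σ ∧ f.Counts ν σ := .rfl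
@[simp] theorem counts_mul : (e * f).Counts ν σ ↔ e.Counts ν σ ∧ f.Counts ν σ := .rfl
@[simp] theorem counts_div : (e / f).Counts ν σ ↔ e.Counts ν σ ∧ f.Counts ν σ := .rfl
@[simp] theorem counts_load : (load b e f).Counts ν σ ↔ e.Counts ν σ ∧ f.Counts ν σ := .rfl
@[simp] theorem counts_sum : (sum r N e).Counts ν σ ↔ N.Counts ν σ ∧ 0 ≤ N.eval σ ∧
    N.eval σ ≤ ν ∧ ∀ i : ℕ, i < N.eval σ → e.Counts ν (σ.set r i) := .rfl
@[simp] theorem counts_prod : (prod r N e).Counts ν σ ↔ N.Counts ν σ ∧ 0 ≤ N.eval σ ∧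
    N.eval σ ≤ ν ∧ ∀ i : ℕ, i < N.eval σ → e.Counts ν (σ.set r i) := .rfl

end

/-- The product of the entries of the array `b` with `reg r` rows and `reg 2` columns. -/
def entryProd (b r : ℕ) : RAMExpr :=
  prod 20 (var r) (prod 21 (var 2) (load b (var 20) (var 21)))

/-- An entry of the numerator array `b`, divided by the corresponding entry of the denominator
array `b + 1` and multiplied by `reg 7`. -/
def scaledEntry (b : ℕ) (i j : RAMExpr) : RAMExpr :=
  load b i j * (var 7 / load (b + 1) i j)

/-- The entry `(reg 20, reg 21)` of the Gram matrix of the columns of the rational matrix in the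
arrays `b` and `b + 1`, with `reg r` rows. -/
def gramEntry (b r : ℕ) : RAMExpr :=
  sum 22 (var r) (scaledEntry b (var 22) (var 20) * scaledEntry b (var 22) (var 21))

/-- The entry `(reg 20, reg 21)` of `testMatrix`. -/
def testEntry : RAMExpr :=
  var 6 * var 6 * load 4 (var 20) (var 21) - var 5 * var 5 * load 5 (var 20) (var 21)

/-- In the array `6`, the powers `T, T², …` are stacked. This is the row with number
`reg 2 + reg 20`. -/
def powEntry : RAMExpr :=
  sum 22 (var 2) (load 6 (var 20) (var 22) * load 6 (var 22) (var 21))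

/-- Newton's formula for the coefficient with number `reg 20 + 1`, from the previous ones, in the
array `7`, and the traces of the powers in the array `6`. -/
def newtonEntry : RAMExpr :=
  (const 0 - sum 22 (var 20 + const 1) (load 7 (var 20 - var 22) (const 0) *
    sum 23 (var 2) (load 6 (var 22 * var 2 + var 23) (var 23)))) / (var 20 + const 1)

/-- The value is `-1` if that of `e` is negative, and `0` otherwise. -/
def negIndicator (e : RAMExpr) : RAMExpr := e / (e * e + const 1)

/-- Minus the number of negative coefficients in the array `7`. -/
def negCount : RAMExpr := sum 20 (var 2 + const 1) (negIndicator (load 7 (var 20) (const 0)))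

/-- The value of `normBound`. -/
def boundExpr : RAMExpr :=
  (const 1 + sum 20 (var 2) (load 4 (var 20) (var 20))) *
    prod 20 (var 2) (const 1 + sum 21 (var 2) (load 5 (var 21) (var 21)))

end RAMExpr

open RAMExpr in
/-- Clears the denominators and stores the Gram matrices of the columns of `A` and `B` in the arrays
`4` and `5`. -/
def initProgram : RAMProgram :=
  .seq (assign 10 (const 1)) (.seq (assign 8 (var 2 * var 2))
    (.seq (assign 7 (entryProd 1 1 * entryProd 3 0))
      (.seq (tabulate 4 9 2 2 (gramEntry 0 1)) (tabulate 5 9 2 2 (gramEntry 2 0)))))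

open RAMExpr in
/-- Stores the matrix of `testEntry` and its powers in the array `6` and the coefficients of its
characteristic polynomial in the array `7`, and sets `reg 15` to `1` or `0` according to whether the
norm is at most `reg 5 / reg 6` or not. -/
def testProgram : RAMProgram :=
  .seq (tabulate 6 9 2 2 testEntry) (.seq (tabulate 6 2 8 2 powEntry)
    (.seq (tabulate 7 9 10 10 (const 1)) (.seq (tabulate 7 10 2 10 newtonEntry)
      (.seq (assign 16 negCount) (assign 15 (const 1 + negIndicator (var 16)))))))

open RAMExpr in
/-- Compares the norm with `reg 3 / reg 4`. As the test depends on the square of this number only,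
the result is set to `0` if it is negative. -/
def decisionProgram : RAMProgram :=
  .seq initProgram (.seq (assign 5 (var 3)) (.seq (assign 6 (var 4)) (.seq testProgram
    (assign 0 (var 15 * (const 1 + negIndicator (var 5)))))))

open RAMExpr in
/-- Halves the interval from `reg 12 / reg 13` to `(reg 12 + reg 11) / reg 13`. Then `reg 14`, the
guard of the bisection, is positive if and only if the length of the interval exceeds
`reg 3 / reg 4`. -/
def bisectionStep : RAMProgram :=
  .seq (assign 13 (const 2 * var 13)) (.seq (assign 5 (const 2 * var 12 + var 11))
    (.seq (assign 6 (var 13)) (.seq testProgram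
      (.seq (assign 12 (const 2 * var 12 + (const 1 - var 15) * var 11))
        (assign 14 (var 11 * var 4 - var 13 * var 3))))))

open RAMExpr in
/-- Approximates the norm with the error `reg 3 / reg 4` by bisection. -/
def bisectionProgram : RAMProgram :=
  .seq initProgram (.seq (assign 11 boundExpr) (.seq (assign 13 (const 1))
    (.seq (assign 14 (var 11 * var 4 - var 13 * var 3)) (.seq (.whilePos 14 bisectionStep)
      (.seq (assign 0 (var 12)) (assign 1 (var 13)))))))

/-- The value of `negIndicator`. -/
theorem ediv_sq_add_one (x : ℤ) : x / (x * x + 1) = if x < 0 then -1 else 0 := by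
  split_ifs with h
  · rw [Int.ediv_eq_iff_of_pos (by nlinarith)]
    constructor <;> nlinarith
  · exact Int.ediv_eq_zero_of_lt (by omega) (by nlinarith)

/-! ### Loading the data -/

section

variable {l m n : ℕ}

@[simp] theorem toArray_fin (M : Fin m → Fin n → ℤ) (i : Fin m) (j : Fin n) :
    toArray M i j = M i j := by
  simp [toArray]

/-- The entries of a matrix, indexed by natural numbers, with value `0` outside the matrix. -/
def natEntry (M : Matrix (Fin m) (Fin n) ℤ) (i j : ℕ) : ℤ :=
  if h : i < m ∧ j < n then M ⟨i, h.1⟩ ⟨j, h.2⟩ else 0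

@[simp] theorem natEntry_fin (M : Matrix (Fin m) (Fin n) ℤ) (i : Fin m) (j : Fin n) :
    natEntry M i j = M i j := by
  simp [natEntry]

/-- The bounds in terms of `M ^ D ^ i` grow by one in `i` with each command of degree `d ≤ D`. -/
theorem pow_pow_pow_le {M D d : ℕ} (i : ℕ) (hM : 2 ≤ M) (hd : d ≤ D) :
    (M ^ D ^ i) ^ d ≤ M ^ D ^ (i + 1) := by
  rw [← pow_mul, pow_succ]
  exact Nat.pow_le_pow_right (by omega) (Nat.mul_le_mul_left _ hd)

/-- The Gram matrices of the columns of `D A` and `D B`, with `D` the common denominator, are stored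
in the arrays `4` and `5`, and the registers hold the dimensions. -/
structure Loaded (A : Matrix (Fin m) (Fin n) ℚ) (B : Matrix (Fin l) (Fin n) ℚ) (σ : RAMState) :
    Prop where
  reg_two : σ.reg 2 = n
  reg_eight : σ.reg 8 = n * n
  reg_nine : σ.reg 9 = 0
  reg_ten : σ.reg 10 = 1
  mem_four : ∀ i j : Fin n, σ.mem 4 i j =
    ((scaled (commonDen A B) A).transpose * scaled (commonDen A B) A) i j
  mem_five : ∀ i j : Fin n, σ.mem 5 i j =
    ((scaled (commonDen A B) B).transpose * scaled (commonDen A B) B) i j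

theorem Loaded.of_eq {A : Matrix (Fin m) (Fin n) ℚ} {B : Matrix (Fin l) (Fin n) ℚ}
    {σ τ : RAMState} (h : Loaded A B σ) (h2 : τ.reg 2 = σ.reg 2) (h8 : τ.reg 8 = σ.reg 8)
    (h9 : τ.reg 9 = σ.reg 9) (h10 : τ.reg 10 = σ.reg 10) (h4 : τ.mem 4 = σ.mem 4)
    (h5 : τ.mem 5 = σ.mem 5) : Loaded A B τ :=
  ⟨h2.trans h.1, h8.trans h.2, h9.trans h.3, h10.trans h.4, by simpa only [h4] using h.5,
    by simpa only [h5] using h.6⟩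

/-- The value of `gramEntry`. -/
theorem gramEntry_spec {ν b r k : ℕ} {C : Matrix (Fin k) (Fin n) ℚ} {D : ℤ}
    {s : RAMState} (hk : k ≤ ν) (hs : s.reg r = k) (h7 : s.reg 7 = D)
    (hnum : s.mem b = toArray fun i j => (C i j).num)
    (hden : s.mem (b + 1) = toArray fun i j => (C i j).den) (i j : Fin n) (h20 : s.reg 20 = i)
    (h21 : s.reg 21 = j) : (RAMExpr.gramEntry b r).Counts ν s ∧
      (RAMExpr.gramEntry b r).eval s = ((scaled D C).transpose * scaled D C) i j := by
  constructor
  · simp [RAMExpr.gramEntry, RAMExpr.scaledEntry, hs, hk]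
  · have h : ∀ x, (s.set 22 x).reg 20 = i ∧ (s.set 22 x).reg 21 = j ∧ (s.set 22 x).reg 7 = D :=
      fun x => by simp [RAMState.set_reg, h20, h21, h7]
    simp only [RAMExpr.gramEntry, RAMExpr.scaledEntry, RAMExpr.eval_sum, RAMExpr.eval_var, hs,
      RAMExpr.eval_mul, RAMExpr.eval_load, RAMExpr.eval_div, RAMState.set_mem, hnum, hden,
      Int.toNat_natCast, Finset.sum_range, RAMState.set_reg_self, h, toArray_fin,
      Matrix.mul_apply, Matrix.transpose_apply, scaled, Matrix.of_apply]

/-- A bound for the factor by which each command of `initProgram` increases the length of the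
data, also during its execution. -/
def initDeg (ν : ℕ) : ℕ :=
  (RAMExpr.entryProd 1 1 * RAMExpr.entryProd 3 0).deg ν + (RAMExpr.gramEntry 0 1).deg ν + 6

/-- A bound for the number of steps of `initProgram`. -/
def initSteps (ν : ℕ) : ℕ :=
  (RAMExpr.entryProd 1 1 * RAMExpr.entryProd 3 0).steps ν +
    2 * tabulateSteps ν (RAMExpr.gramEntry 0 1) + 12

/-- Correctness and cost of `initProgram`. Each of its five commands raises the bound for the data
at most to the power `initDeg ν`. -/
theorem initProgram_spec (A : Matrix (Fin m) (Fin n) ℚ) (B : Matrix (Fin l) (Fin n) ℚ) (t : ℚ)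
    {M ν : ℕ} (hM : 2 ≤ M) (hν : ν + 1 ≤ M) (hl : l ≤ ν) (hm : m ≤ ν) (hn : n ≤ ν)
    (hin : BoundedBy M (inputState A B t)) :
    ∃ τ, Runs (M ^ initDeg ν ^ 6) initProgram (inputState A B t) τ (initSteps ν) ∧
      BoundedBy (M ^ initDeg ν ^ 5) τ ∧ Loaded A B τ ∧
      ∀ x < 20, x ≠ 7 → x ≠ 8 → x ≠ 10 → τ.reg x = (inputState A B t).reg x := by
  set D := initDeg ν with hD
  have hD6 : 6 ≤ D := by simp [hD, initDeg]
  have hD7 : (RAMExpr.entryProd 1 1 * RAMExpr.entryProd 3 0).deg ν ≤ D := by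
    simp [hD, initDeg]; omega
  have hDG : (RAMExpr.gramEntry 0 1).deg ν + 3 ≤ D := by simp [hD, initDeg]; omega
  have hDG' : (RAMExpr.gramEntry 2 0).deg ν + 3 ≤ D := hDG
  have hpow : ∀ {a b : ℕ}, a ≤ b → M ^ D ^ a ≤ M ^ D ^ b := fun h =>
    Nat.pow_le_pow_right (by omega) (Nat.pow_le_pow_right (by omega) h)
  have hM' : ∀ i, 2 ≤ M ^ D ^ i := fun i => hM.trans (Nat.le_self_pow (by positivity) M)
  have hν' : ∀ i, ν + 1 ≤ M ^ D ^ i := fun i => hν.trans (Nat.le_self_pow (by positivity) M)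
  have hstep : ∀ {i d}, d ≤ D → (M ^ D ^ i) ^ d ≤ M ^ D ^ (i + 1) := fun {i d} h =>
    pow_pow_pow_le i hM h
  replace hin : BoundedBy (M ^ D ^ 0) (inputState A B t) := hin.mono (by simp)
  set σ := inputState A B t with hσ
  have r0 : σ.reg 0 = l := rfl
  have r1 : σ.reg 1 = m := rfl
  have r2 : σ.reg 2 = n := rfl
  obtain ⟨σ₁, k1, v1, m1, f1, b1⟩ := assign_spec (r := 10) (e := .const 1) (hM' 0) (hν' 0)
    (by omega) (by simp) (by simp) hin
  replace b1 := b1.mono (hstep (by simp [RAMExpr.deg]; omega))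
  obtain ⟨σ₂, k2, v2, m2, f2, b2⟩ := assign_spec (r := 8) (e := .var 2 * .var 2) (hM' 1) (hν' 1)
    (by omega) (by simp) (by simp) b1
  have d2 : (RAMExpr.var 2 * RAMExpr.var 2).deg ν = 3 := rfl
  replace b2 := b2.mono (hstep (by omega))
  have g2 : ∀ x < 20, x ≠ 10 → x ≠ 8 → σ₂.reg x = σ.reg x := fun x hx h h' => by
    rw [f2 x hx h', f1 x hx h]
  have mem2 : σ₂.mem = σ.mem := m2.trans m1
  obtain ⟨σ₃, k3, v3, m3, f3, b3⟩ := assign_spec (r := 7)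
    (e := .entryProd 1 1 * .entryProd 3 0) (hM' 2) (hν' 2)
    (by omega) (by simp [RAMExpr.entryProd]) (by
      have h1 := g2 1 (by omega) (by omega) (by omega)
      have h0 := g2 0 (by omega) (by omega) (by omega)
      have h2 := g2 2 (by omega) (by omega) (by omega)
      simp [RAMExpr.entryProd, RAMState.set_reg, h1, h0, h2, r0, r1, r2, hl, hm, hn]) b2
  replace b3 := b3.mono (hstep hD7)
  have g3 : ∀ x < 20, x ≠ 10 → x ≠ 8 → x ≠ 7 → σ₃.reg x = σ.reg x := fun x hx h h' h'' => by
    rw [f3 x hx h'', g2 x hx h h']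
  have mem3 : σ₃.mem = σ.mem := m3.trans mem2
  have h7 : σ₃.reg 7 = commonDen A B := by
    have h1 := g2 1 (by omega) (by omega) (by omega)
    have h0 := g2 0 (by omega) (by omega) (by omega)
    have h2 := g2 2 (by omega) (by omega) (by omega)
    have e1 : σ.mem 1 = toArray fun i j => (A i j).den := rfl
    have e3 : σ.mem 3 = toArray fun i j => (B i j).den := rfl
    rw [v3]
    simp [RAMExpr.entryProd, RAMState.set_reg, h1, h0, h2, r0, r1, r2, mem2, e1, e3,
      Finset.prod_range, commonDen]
  obtain ⟨σ₄, k4, f4, m4, t4, b4⟩ := tabulate_spec_of_independent (b := 4) (o := 9) (p := 2)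
    (q := 2) (o' := 0) (m := n) (n := n) (e := .gramEntry 0 1) (hM' 3) (hν' 3) (by omega)
    (by omega) (by omega) (g3 9 (by omega) (by omega) (by omega) (by omega))
    (g3 2 (by omega) (by omega) (by omega) (by omega))
    (g3 2 (by omega) (by omega) (by omega) (by omega)) hn hn
    (by simp [RAMExpr.gramEntry, RAMExpr.scaledEntry]) b3
    (natEntry ((scaled (commonDen A B) A).transpose * scaled (commonDen A B) A))
    (fun x hx => by omega) (fun i hi j hj s hs h20 h21 hmem => by
      have := gramEntry_spec (b := 0) (r := 1) (C := A) (s := s) hm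
        ((hs 1 (by omega)).trans (g3 1 (by omega) (by omega) (by omega) (by omega)))
        ((hs 7 (by omega)).trans h7)
        (by rw [hmem 0 (by omega), mem3]; rfl) (by rw [hmem 1 (by omega), mem3]; rfl)
        ⟨i, hi⟩ ⟨j, hj⟩ h20 h21
      refine ⟨this.1, ?_⟩
      rw [zero_add, this.2]
      exact (natEntry_fin _ ⟨i, hi⟩ ⟨j, hj⟩).symm)
  have b4' := b4.mono (hstep (by omega))
  obtain ⟨σ₅, k5, f5, m5, t5, b5⟩ := tabulate_spec_of_independent (b := 5) (o := 9) (p := 2)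
    (q := 2) (o' := 0) (m := n) (n := n) (e := .gramEntry 2 0) (hM' 4) (hν' 4) (by omega)
    (by omega) (by omega)
    ((f4 9 (by omega)).trans (g3 9 (by omega) (by omega) (by omega) (by omega)))
    ((f4 2 (by omega)).trans (g3 2 (by omega) (by omega) (by omega) (by omega)))
    ((f4 2 (by omega)).trans (g3 2 (by omega) (by omega) (by omega) (by omega))) hn hn
    (by simp [RAMExpr.gramEntry, RAMExpr.scaledEntry]) b4'
    (natEntry ((scaled (commonDen A B) B).transpose * scaled (commonDen A B) B))
    (fun x hx => by omega) (fun i hi j hj s hs h20 h21 hmem => by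
      have := gramEntry_spec (b := 2) (r := 0) (C := B) (s := s) hl
        ((hs 0 (by omega)).trans ((f4 0 (by omega)).trans
          (g3 0 (by omega) (by omega) (by omega) (by omega))))
        ((hs 7 (by omega)).trans ((f4 7 (by omega)).trans h7))
        (by rw [hmem 2 (by omega), m4 2 (by omega), mem3]; rfl)
        (by rw [hmem 3 (by omega), m4 3 (by omega), mem3]; rfl)
        ⟨i, hi⟩ ⟨j, hj⟩ h20 h21
      refine ⟨this.1, ?_⟩
      rw [zero_add, this.2]
      exact (natEntry_fin _ ⟨i, hi⟩ ⟨j, hj⟩).symm)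
  have b5' := b5.mono (hstep (by omega))
  have g5 : ∀ x < 20, σ₅.reg x = σ₃.reg x := fun x hx => by rw [f5 x hx, f4 x hx]
  have hrun : ∀ {i d}, d + 3 ≤ D → i ≤ 4 → ((M ^ D ^ i) ^ d) ^ (d + 3) ≤ M ^ D ^ 6 :=
    fun {i d} h hi => (Nat.pow_le_pow_left (hstep (by omega)) _).trans
      ((hstep h).trans (hpow (by omega)))
  have c1 : (RAMExpr.const 1).deg ν = 1 := rfl
  refine ⟨σ₅, ((k1.mono ((hstep (by omega)).trans (hpow (by omega))) le_rfl).seq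
    ((k2.mono ((hstep (by omega)).trans (hpow (by omega))) le_rfl).seq
    ((k3.mono ((hstep hD7).trans (hpow (by omega))) le_rfl).seq
    ((k4.mono (hrun hDG (by omega)) le_rfl).seq (k5.mono (hrun hDG' le_rfl) le_rfl))))).mono le_rfl
      ?_, b5', ⟨?_, ?_, ?_, ?_, ?_, ?_⟩, fun x hx h h' h'' => ?_⟩
  · have e1 : (RAMExpr.var 2 * RAMExpr.var 2).steps ν = 5 := rfl
    have e2 : (RAMExpr.const 1).steps ν = 1 := rfl
    have e3 : tabulateSteps ν (.gramEntry 2 0) = tabulateSteps ν (.gramEntry 0 1) := rfl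
    simp only [initSteps]
    omega
  · rw [g5 2 (by omega), g3 2 (by omega) (by omega) (by omega) (by omega), r2]
  · rw [g5 8 (by omega), f3 8 (by omega) (by omega), v2]
    simp [f1 2 (by omega) (by omega), r2]
  · rw [g5 9 (by omega), g3 9 (by omega) (by omega) (by omega) (by omega)]
    rfl
  · rw [g5 10 (by omega), f3 10 (by omega) (by omega), f2 10 (by omega) (by omega), v1]
    rfl
  · intro i j
    have := t4 i (by omega) j (by omega)
    rwa [← m5 4 (by omega), natEntry_fin] at this
  · intro i j
    have := t5 i (by omega) j (by omega)
    rwa [natEntry_fin] at this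
  · rw [g5 x hx, g3 x hx h'' h' h]

end

/-! ### Testing the signs of the coefficients -/

section

variable {l m n : ℕ}

theorem natAbs_natEntry_le {T : Matrix (Fin m) (Fin n) ℤ} {K : ℕ}
    (h : ∀ i j, (T i j).natAbs ≤ K) (i j : ℕ) : (natEntry T i j).natAbs ≤ K := by
  rw [natEntry]
  split_ifs
  · exact h _ _
  · simp

theorem sum_natEntry_mul (S T : Matrix (Fin n) (Fin n) ℤ) {i j : ℕ} (hi : i < n) (hj : j < n) :
    ∑ a ∈ Finset.range n, natEntry S i a * natEntry T a j = natEntry (S * T) i j := by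
  rw [Finset.sum_range]
  have h1 : ∀ a : Fin n, natEntry S i a = S ⟨i, hi⟩ a := fun a => natEntry_fin S ⟨i, hi⟩ a
  have h2 : ∀ a : Fin n, natEntry T a j = T a ⟨j, hj⟩ := fun a => natEntry_fin T a ⟨j, hj⟩
  have h3 : natEntry (S * T) i j = (S * T) ⟨i, hi⟩ ⟨j, hj⟩ := natEntry_fin _ ⟨i, hi⟩ ⟨j, hj⟩
  simp only [h1, h2, h3, Matrix.mul_apply]

theorem BoundedBy.of_assign {M r : ℕ} {σ τ : RAMState} (h : BoundedBy M σ) (hm : τ.mem = σ.mem)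
    (hr : ∀ x < 20, x ≠ r → τ.reg x = σ.reg x) (hv : (τ.reg r).natAbs ≤ M) : BoundedBy M τ := by
  refine ⟨fun x hx => ?_, by rw [hm]; exact h.mem⟩
  by_cases hxr : x = r
  · rwa [hxr]
  · rw [hr x hx hxr]; exact h.reg x hx

/-- The entries of the powers `T, T², …`, stacked: the row `x` is the row `x % n` of
`T ^ (x / n + 1)`. -/
def stackedPow (T : Matrix (Fin n) (Fin n) ℤ) (x y : ℕ) : ℤ :=
  natEntry (T ^ (x / n + 1)) (x % n) y

theorem stackedPow_of_lt (T : Matrix (Fin n) (Fin n) ℤ) {x : ℕ} (hx : x < n) (y : ℕ) :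
    stackedPow T x y = natEntry T x y := by
  simp [stackedPow, Nat.div_eq_of_lt hx, Nat.mod_eq_of_lt hx]

theorem sum_stackedPow_mul (T : Matrix (Fin n) (Fin n) ℤ) (x : ℕ) {y : ℕ} (hy : y < n) :
    ∑ a ∈ Finset.range n, stackedPow T x a * stackedPow T a y = stackedPow T (n + x) y := by
  have hn : 0 < n := by omega
  have h : ∀ a ∈ Finset.range n, stackedPow T x a * stackedPow T a y =
      natEntry (T ^ (x / n + 1)) (x % n) a * natEntry T a y := fun a ha => by
    rw [stackedPow_of_lt T (Finset.mem_range.mp ha), stackedPow]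
  rw [Finset.sum_congr rfl h, sum_natEntry_mul _ _ (Nat.mod_lt _ hn) hy, stackedPow,
    Nat.add_mod_left, Nat.add_div_left _ hn, ← pow_succ]

theorem sum_stackedPow_diag (T : Matrix (Fin n) (Fin n) ℤ) (i : ℕ) :
    ∑ a ∈ Finset.range n, stackedPow T (i * n + a) a = (T ^ (i + 1)).trace := by
  rw [Finset.sum_range, Matrix.trace]
  refine Finset.sum_congr rfl fun a _ => ?_
  have hn : 0 < n := a.pos
  rw [stackedPow, show i * n + (a : ℕ) = a + n * i by ring, Nat.add_mul_div_left _ _ hn,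
    Nat.add_mul_mod_self_left, Nat.div_eq_of_lt a.2, Nat.mod_eq_of_lt a.2, natEntry_fin, zero_add,
    Matrix.diag_apply]

theorem natAbs_stackedPow_le {T : Matrix (Fin n) (Fin n) ℤ} {Q : ℕ} (hn : n ≤ Q) (hQ : 1 ≤ Q)
    (hT : ∀ i j, (T i j).natAbs ≤ Q) {x : ℕ} (hx : x < n + n * n) (y : ℕ) :
    (stackedPow T x y).natAbs ≤ Q ^ (2 * (n + 1)) := by
  refine (natAbs_natEntry_le (natAbs_pow_apply_le hn hT _) _ _).trans (Nat.pow_le_pow_right hQ ?_)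
  have : x / n < n + 1 := Nat.div_lt_of_lt_mul (by linarith)
  omega

/-- A bound for the factor by which the lengths of the numbers handled by `testProgram` exceed that
of the data. -/
def testDeg (ν : ℕ) : ℕ :=
  RAMExpr.testEntry.deg ν + RAMExpr.powEntry.deg ν + RAMExpr.newtonEntry.deg ν +
    RAMExpr.negCount.deg ν + 10

/-- A bound for the number of steps of `testProgram`. -/
def testSteps (ν : ℕ) : ℕ :=
  tabulateSteps ν .testEntry + tabulateSteps ν .powEntry + tabulateSteps ν (.const 1) +
    tabulateSteps ν .newtonEntry + RAMExpr.negCount.steps ν + 20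

/-- Correctness and cost of `testProgram`. With data bounded by `R`, all tables are bounded by a
power of `R` with an exponent linear in `n`; so the bound `M` is preserved, however often the
program is executed. -/
theorem testProgram_spec {A : Matrix (Fin m) (Fin n) ℚ} {B : Matrix (Fin l) (Fin n) ℚ}
    {σ : RAMState} {R M ν : ℕ} (hR : 2 ≤ R) (hM : R ^ (16 * (n + 1)) ≤ M) (hν : ν + 1 ≤ R)
    (hn : n + 1 ≤ ν) (hnn : n * n ≤ ν) (hload : Loaded A B σ) (h5 : (σ.reg 5).natAbs ≤ R)
    (h6 : (σ.reg 6).natAbs ≤ R) (hm4 : ∀ i j, (σ.mem 4 i j).natAbs ≤ R)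
    (hm5 : ∀ i j, (σ.mem 5 i j).natAbs ≤ R) (hσ : BoundedBy M σ) :
    ∃ τ, Runs (M ^ testDeg ν) testProgram σ τ (testSteps ν) ∧ BoundedBy M τ ∧
      (∀ x < 20, x ≠ 15 → x ≠ 16 → τ.reg x = σ.reg x) ∧ τ.mem 4 = σ.mem 4 ∧ τ.mem 5 = σ.mem 5 ∧
      ((∀ k ≤ n, 0 ≤ charCoeff (testMatrix A B (σ.reg 5) (σ.reg 6)) k) ∧ τ.reg 15 = 1 ∨
        (¬ ∀ k ≤ n, 0 ≤ charCoeff (testMatrix A B (σ.reg 5) (σ.reg 6)) k) ∧ τ.reg 15 = 0) := by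
  have hRM : R ≤ M := (Nat.le_self_pow (by omega) R).trans hM
  have hM2 : 2 ≤ M := hR.trans hRM
  have hνM : ν + 1 ≤ M := hν.trans hRM
  have hpow : ∀ {a}, a ≤ testDeg ν → M ^ a ≤ M ^ testDeg ν := fun h =>
    Nat.pow_le_pow_right (by omega) h
  set T := testMatrix A B (σ.reg 5) (σ.reg 6) with hT
  have hsymm : T.transpose = T := testMatrix_transpose _ _ _ _
  -- the entries of `T`
  have hTe : ∀ i j : Fin n, T i j =
      σ.reg 6 * σ.reg 6 * σ.mem 4 i j - σ.reg 5 * σ.reg 5 * σ.mem 5 i j := fun i j => by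
    rw [hload.mem_four, hload.mem_five, hT, testMatrix, Matrix.of_apply]
    ring
  have hTQ : ∀ i j, (T i j).natAbs ≤ R ^ 4 := fun i j => by
    rw [hTe]
    refine (Int.natAbs_sub_le _ _).trans ?_
    rw [Int.natAbs_mul, Int.natAbs_mul, Int.natAbs_mul, Int.natAbs_mul]
    calc _ ≤ R * R * R + R * R * R := Nat.add_le_add
          (Nat.mul_le_mul (Nat.mul_le_mul h6 h6) (hm4 _ _))
          (Nat.mul_le_mul (Nat.mul_le_mul h5 h5) (hm5 _ _))
      _ = 2 * R ^ 3 := by ring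
      _ ≤ R * R ^ 3 := Nat.mul_le_mul_right _ hR
      _ = R ^ 4 := by ring
  have hR4 : R ≤ R ^ 4 := Nat.le_self_pow (by omega) R
  have hQM : ∀ k ≤ 4 * (n + 1), (R ^ 4) ^ k ≤ M := fun k hk => by
    rw [← pow_mul]
    exact (Nat.pow_le_pow_right (by omega) (by omega)).trans hM
  have hcM : ∀ k ≤ n, (charCoeff T k).natAbs ≤ M := fun k hk =>
    (natAbs_charCoeff_le hsymm (by omega) (by omega) hTQ k hk).trans (hQM _ (by omega))
  have r2 := hload.reg_two
  have r8 := hload.reg_eight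
  have r9 := hload.reg_nine
  have r10 := hload.reg_ten
  -- the matrix `T`
  obtain ⟨σ₁, k1, f1, m1, t1, b1⟩ := tabulate_spec (b := 6) (o := 9) (p := 2) (q := 2) (o' := 0)
    (m := n) (n := n) (e := .testEntry) hM2 hνM (by omega) (by omega) (by omega) r9 r2 r2
    (by omega) (by omega) (by simp [RAMExpr.testEntry]) hσ (natEntry T)
    (fun i _ j _ => (natAbs_natEntry_le hTQ _ _).trans (by simpa using hQM 1 (by omega)))
    (fun x hx => by omega) (fun i hi j hj s hs h20 h21 hmem _ => by
      refine ⟨by simp [RAMExpr.testEntry], ?_⟩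
      have := hTe ⟨i, hi⟩ ⟨j, hj⟩
      rw [zero_add, show natEntry T i j = _ from natEntry_fin T ⟨i, hi⟩ ⟨j, hj⟩, this]
      simp [RAMExpr.testEntry, hs 6, hs 5, h20, h21, hmem 4, hmem 5])
  -- its powers
  obtain ⟨σ₂, k2, f2, m2, t2, b2⟩ := tabulate_spec (b := 6) (o := 2) (p := 8) (q := 2) (o' := n)
    (m := n * n) (n := n) (e := .powEntry) hM2 hνM (by omega) (by omega) (by omega)
    (by rw [f1 2 (by omega), r2]) (by rw [f1 8 (by omega), r8]; simp) (by rw [f1 2 (by omega), r2])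
    (by omega) (by omega) (by simp [RAMExpr.powEntry]) b1 (stackedPow T)
    (fun i hi j _ => (natAbs_stackedPow_le (by omega) (by omega) hTQ (by omega) _).trans
      (hQM _ (by omega)))
    (fun x hx y hy => by rw [t1 x (by omega) y hy, stackedPow_of_lt T hx])
    (fun i hi j hj s hs h20 h21 hmem hrows => by
      have s2 : s.reg 2 = n := by rw [hs 2 (by omega), f1 2 (by omega), r2]
      refine ⟨by simp [RAMExpr.powEntry, s2]; omega, ?_⟩
      rw [← sum_stackedPow_mul T i hj]
      simp only [RAMExpr.powEntry, RAMExpr.eval_sum, RAMExpr.eval_var, s2, Int.toNat_natCast]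
      refine Finset.sum_congr rfl fun a ha => ?_
      have ha := Finset.mem_range.mp ha
      simp [RAMState.set_reg, h20, h21, hrows i (by omega) a ha, hrows a (by omega) j hj])
  -- the coefficient with number `0`
  obtain ⟨σ₃, k3, f3, m3, t3, b3⟩ := tabulate_spec (b := 7) (o := 9) (p := 10) (q := 10) (o' := 0)
    (m := 1) (n := 1) (e := .const 1) hM2 hνM (by omega) (by omega) (by omega)
    (by rw [f2 9 (by omega), f1 9 (by omega), r9]; rfl)
    (by rw [f2 10 (by omega), f1 10 (by omega), r10]; rfl)
    (by rw [f2 10 (by omega), f1 10 (by omega), r10]; rfl) (by omega) (by omega)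
    (by simp) b2 (fun x _ => charCoeff T x)
    (fun i hi j _ => hcM _ (by omega)) (fun x hx => by omega)
    (fun i hi j hj s _ _ _ _ _ => by
      obtain rfl : i = 0 := by omega
      simp [charCoeff_zero])
  -- the other coefficients
  obtain ⟨σ₄, k4, f4, m4, t4, b4⟩ := tabulate_spec (b := 7) (o := 10) (p := 2) (q := 10) (o' := 1)
    (m := n) (n := 1) (e := .newtonEntry) hM2 hνM (by omega) (by omega) (by omega)
    (by rw [f3 10 (by omega), f2 10 (by omega), f1 10 (by omega), r10]; rfl)
    (by rw [f3 2 (by omega), f2 2 (by omega), f1 2 (by omega), r2])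
    (by rw [f3 10 (by omega), f2 10 (by omega), f1 10 (by omega), r10]; rfl) (by omega) (by omega)
    (by simp [RAMExpr.newtonEntry]) b3 (fun x _ => charCoeff T x)
    (fun i hi j _ => hcM _ (by omega)) (fun x hx y hy => t3 x (by omega) y hy)
    (fun k hk j hj s hs h20 h21 hmem hrows => by
      have s2 : s.reg 2 = n := by
        rw [hs 2 (by omega), f3 2 (by omega), f2 2 (by omega), f1 2 (by omega), r2]
      refine ⟨?_, ?_⟩
      · simp [RAMExpr.newtonEntry, RAMState.set_reg, s2, h20]
        exact ⟨by omega, by omega, fun _ _ => by omega⟩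
      · have hsum : (RAMExpr.sum 22 (.var 20 + .const 1) (.load 7 (.var 20 - .var 22) (.const 0) *
            .sum 23 (.var 2) (.load 6 (.var 22 * .var 2 + .var 23) (.var 23)))).eval s =
            ∑ i ∈ Finset.range (k + 1), charCoeff T (k - i) * (T ^ (i + 1)).trace := by
          have : ((k : ℤ) + 1).toNat = k + 1 := by omega
          simp only [RAMExpr.eval_sum, RAMExpr.eval_add, RAMExpr.eval_var, RAMExpr.eval_const, h20,
            this]
          refine Finset.sum_congr rfl fun i hi => ?_
          have hi := Finset.mem_range.mp hi
          rw [← sum_stackedPow_diag]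
          have e1 := hrows (k - i) (by omega) 0 (by omega)
          rw [Nat.cast_sub (by omega)] at e1
          have e2 : ∀ a ∈ Finset.range n, s.mem 6 (i * n + a) a = stackedPow T (i * n + a) a :=
            fun a ha => by
              have ha := Finset.mem_range.mp ha
              rw [hmem 6 (by omega), m3 6 (by omega)]
              have h1 : i * n ≤ (n - 1) * n := Nat.mul_le_mul_right _ (by omega)
              have h2 : (n - 1) * n + n = n * n := by
                obtain ⟨p, rfl⟩ : ∃ p, n = p + 1 := ⟨n - 1, by omega⟩
                simp; ring
              have := t2 (i * n + a) (by omega) a ha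
              push_cast at this
              exact this
          simp only [Nat.cast_zero] at e1
          simp [RAMState.set_reg, h20, s2, e1, Finset.sum_congr rfl e2]
        have hN := succ_mul_charCoeff hsymm hk
        rw [RAMExpr.newtonEntry, RAMExpr.eval_div, RAMExpr.eval_sub, hsum]
        simp only [RAMExpr.eval_const, RAMExpr.eval_add, RAMExpr.eval_var, h20, zero_sub]
        rw [← hN, Int.mul_ediv_cancel_left _ (by omega), add_comm])
  have g4 : ∀ x < 20, σ₄.reg x = σ.reg x := fun x hx => by
    rw [f4 x hx, f3 x hx, f2 x hx, f1 x hx]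
  -- the test for negative coefficients
  have hc4 : ∀ k ≤ n, σ₄.mem 7 k 0 = charCoeff T k := fun k hk => t4 k (by omega) 0 (by omega)
  have s2 : σ₄.reg 2 = n := by rw [g4 2 (by omega), r2]
  obtain ⟨σ₅, k5, v5, m5, f5, -⟩ := assign_spec (r := 16) (e := .negCount) hM2 hνM (by omega)
    (by simp [RAMExpr.negCount, RAMExpr.negIndicator])
    (by simp [RAMExpr.negCount, RAMExpr.negIndicator, s2]; omega) b4
  have hv5 : σ₅.reg 16 = ∑ k ∈ Finset.range (n + 1), if charCoeff T k < 0 then (-1 : ℤ) else 0 := by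
    have : ((n : ℤ) + 1).toNat = n + 1 := by omega
    rw [v5]
    simp only [RAMExpr.negCount, RAMExpr.eval_sum, RAMExpr.eval_add, RAMExpr.eval_var,
      RAMExpr.eval_const, s2, this]
    refine Finset.sum_congr rfl fun k hk => ?_
    have hk := Finset.mem_range.mp hk
    simp only [RAMExpr.negIndicator, RAMExpr.eval_div, RAMExpr.eval_add, RAMExpr.eval_mul,
      RAMExpr.eval_load, RAMExpr.eval_var, RAMExpr.eval_const, RAMState.set_mem,
      RAMState.set_reg_self, hc4 k (by omega), ediv_sq_add_one]
  have hb5 : (σ₅.reg 16).natAbs ≤ M := by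
    rw [hv5]
    refine (Int.natAbs_sum_le _ _).trans ((Finset.sum_le_card_nsmul _ _ 1 fun k _ => ?_).trans ?_)
    · split_ifs <;> simp
    · simp; omega
  have hneg : σ₅.reg 16 < 0 ↔ ¬ ∀ k ≤ n, 0 ≤ charCoeff T k := by
    rw [hv5]
    constructor
    · intro h hk
      rw [Finset.sum_eq_zero fun k hk' => if_neg (by
        have := hk k (by have := Finset.mem_range.mp hk'; omega); omega)] at h
      omega
    · intro h
      push Not at h
      obtain ⟨k, hk, hlt⟩ := h
      refine Finset.sum_neg' (fun i _ => by split_ifs <;> simp) ⟨k, by simp; omega, ?_⟩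
      simp [hlt]
  have b5 := b4.of_assign m5 f5 hb5
  obtain ⟨σ₆, k6, v6, m6, f6, -⟩ := assign_spec (r := 15)
    (e := .const 1 + .negIndicator (.var 16)) hM2 hνM (by omega)
    (by simp [RAMExpr.negIndicator]) (by simp [RAMExpr.negIndicator]) b5
  have hv6 : (∀ k ≤ n, 0 ≤ charCoeff T k) ∧ σ₆.reg 15 = 1 ∨
      (¬ ∀ k ≤ n, 0 ≤ charCoeff T k) ∧ σ₆.reg 15 = 0 := by
    rw [← hneg, v6]
    simp only [RAMExpr.negIndicator, RAMExpr.eval_div, RAMExpr.eval_add, RAMExpr.eval_mul,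
      RAMExpr.eval_var, RAMExpr.eval_const, ediv_sq_add_one]
    by_cases h : σ₅.reg 16 < 0
    · exact .inr ⟨h, by simp [h]⟩
    · exact .inl ⟨by_contra fun h' => h (hneg.mpr h'), by simp [h]⟩
  have d3 : (RAMExpr.const 1).deg ν = 1 := rfl
  have d6 : (RAMExpr.const 1 + RAMExpr.negIndicator (.var 16)).deg ν = 9 := rfl
  have e6 : (RAMExpr.const 1 + RAMExpr.negIndicator (.var 16)).steps ν = 12 := rfl
  refine ⟨σ₆, (Runs.seq (k1.mono (hpow (by simp only [testDeg]; omega)) le_rfl)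
    (Runs.seq (k2.mono (hpow (by simp only [testDeg]; omega)) le_rfl)
    (Runs.seq (k3.mono (hpow (by simp only [testDeg]; omega)) le_rfl)
    (Runs.seq (k4.mono (hpow (by simp only [testDeg]; omega)) le_rfl)
    (Runs.seq (k5.mono (hpow (by simp only [testDeg]; omega)) le_rfl)
    (k6.mono (hpow (by simp only [testDeg]; omega)) le_rfl)))))).mono le_rfl
      (by simp only [testSteps]; omega),
    b5.of_assign m6 f6 (by omega), fun x hx h15 h16 => ?_, ?_, ?_, hv6⟩
  · rw [f6 x hx h15, f5 x hx h16, g4 x hx]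
  · rw [m6, m5, m4 4 (by omega), m3 4 (by omega), m2 4 (by omega), m1 4 (by omega)]
  · rw [m6, m5, m4 5 (by omega), m3 5 (by omega), m2 5 (by omega), m1 5 (by omega)]

end

/-! ### Correctness of the decision and of the bisection -/

section

variable {l m n : ℕ}

/-- A bound for the number of steps of `decisionProgram`. -/
def decisionSteps (ν : ℕ) : ℕ := initSteps ν + testSteps ν + 26

/-- A bound for the factor by which the lengths of the numbers handled by `decisionProgram` exceed
that of the input. -/
def decisionDeg (ν : ℕ) : ℕ := initDeg ν ^ 6 * (16 * ν) * (testDeg ν + 20)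

theorem decisionProgram_spec {A : Matrix (Fin m) (Fin n) ℚ} {B : Matrix (Fin l) (Fin n) ℚ} {t : ℚ}
    (hker : KerLE (toReal B) (toReal A)) {M ν : ℕ} (hM : 2 ≤ M) (hν : ν + 1 ≤ M) (hl : l ≤ ν)
    (hm : m ≤ ν) (hn : n + 1 ≤ ν) (hnn : n * n ≤ ν) (hin : BoundedBy M (inputState A B t)) :
    ∃ τ, Runs (M ^ decisionDeg ν) decisionProgram (inputState A B t) τ (decisionSteps ν) ∧
      (τ.reg 0 = 0 ∨ τ.reg 0 = 1) ∧
      (τ.reg 0 = 1 ↔ (genMatrixNorm 2 2 (toReal B) (toReal A)).toReal ≤ (t : ℝ)) := by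
  obtain ⟨σ₁, k1, b1, h1, f1⟩ := initProgram_spec A B t hM hν hl hm (by omega) hin
  have hD : 1 ≤ initDeg ν := by simp [initDeg]
  set R := M ^ initDeg ν ^ 5 with hR
  have hMR : M ≤ R := Nat.le_self_pow (by positivity) M
  have hR2 : 2 ≤ R := hM.trans hMR
  obtain ⟨σ₂, k2, v2, m2, f2, b2⟩ := assign_spec (r := 5) (e := .var 3) hR2 (hν.trans hMR)
    (by omega) (by simp) (by simp) b1
  have d1 : ∀ r, (RAMExpr.var r).deg ν = 1 := fun _ => rfl
  rw [d1, pow_one] at b2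
  obtain ⟨σ₃, k3, v3, m3, f3, b3⟩ := assign_spec (r := 6) (e := .var 4) hR2 (hν.trans hMR)
    (by omega) (by simp) (by simp) b2
  rw [d1, pow_one] at b3
  have r5 : σ₃.reg 5 = t.num := by
    rw [f3 5 (by omega) (by omega), v2, RAMExpr.eval_var,
      f1 3 (by omega) (by omega) (by omega) (by omega)]
    rfl
  have r6 : σ₃.reg 6 = t.den := by
    rw [v3, RAMExpr.eval_var, f2 4 (by omega) (by omega),
      f1 4 (by omega) (by omega) (by omega) (by omega)]
    rfl
  have g3 : ∀ x < 20, x ≠ 5 → x ≠ 6 → σ₃.reg x = σ₁.reg x := fun x hx h h' => by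
    rw [f3 x hx h', f2 x hx h]
  have h3 : Loaded A B σ₃ := h1.of_eq (g3 2 (by omega) (by omega) (by omega))
    (g3 8 (by omega) (by omega) (by omega)) (g3 9 (by omega) (by omega) (by omega))
    (g3 10 (by omega) (by omega) (by omega)) (by rw [m3, m2]) (by rw [m3, m2])
  set K := R ^ (16 * ν) with hK
  have hRK : R ≤ K := Nat.le_self_pow (by omega) R
  obtain ⟨σ₄, k4, b4, f4, -, -, v4⟩ := testProgram_spec (R := R) (M := K) (ν := ν) hR2
    (Nat.pow_le_pow_right (by omega) (by omega)) (hν.trans hMR) hn hnn h3 (b3.reg 5 (by omega))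
    (b3.reg 6 (by omega)) (b3.mem 4) (b3.mem 5) (b3.mono hRK)
  obtain ⟨σ₅, k5, v5, -, -, -⟩ := assign_spec (r := 0)
    (e := .var 15 * (.const 1 + .negIndicator (.var 5))) (hR2.trans hRK)
    ((hν.trans hMR).trans hRK) (by omega) (by simp [RAMExpr.negIndicator])
    (by simp [RAMExpr.negIndicator]) b4
  have d5 : (RAMExpr.var 15 * (.const 1 + .negIndicator (.var 5))).deg ν = 11 := rfl
  have e5 : (RAMExpr.var 15 * (.const 1 + .negIndicator (.var 5))).steps ν = 15 := rfl
  have e1 : ∀ r, (RAMExpr.var r).steps ν = 2 := fun _ => rfl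
  have hKd : ∀ {a}, a ≤ testDeg ν + 20 → K ^ a ≤ M ^ decisionDeg ν := fun {a} ha => by
    have h : ∀ x a b c : ℕ, ((x ^ a) ^ b) ^ c = x ^ (a * b * c) := fun x a b c => by
      rw [pow_mul, pow_mul]
    rw [hK, hR, h]
    refine Nat.pow_le_pow_right (by omega) ?_
    rw [decisionDeg]
    exact Nat.mul_le_mul (Nat.mul_le_mul_right _ (Nat.pow_le_pow_right hD (by omega))) ha
  have hRd : R ≤ M ^ decisionDeg ν := hRK.trans ((pow_one K).symm.le.trans (hKd (by omega)))
  have hi : M ^ initDeg ν ^ 6 ≤ M ^ decisionDeg ν := by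
    refine Nat.pow_le_pow_right (by omega) ?_
    rw [decisionDeg, mul_assoc]
    exact Nat.le_mul_of_pos_right _ (by simp; omega)
  rw [r5, r6] at v4
  have v0 : σ₅.reg 0 = σ₄.reg 15 * (1 + if t.num < 0 then -1 else 0) := by
    rw [v5]
    simp only [RAMExpr.negIndicator, RAMExpr.eval_div, RAMExpr.eval_add, RAMExpr.eval_mul,
      RAMExpr.eval_var, RAMExpr.eval_const, ediv_sq_add_one, f4 5 (by omega) (by omega) (by omega),
      r5]
  generalize M ^ decisionDeg ν = N at hi hKd hRd
  replace k1 := k1.mono hi le_rfl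
  replace k2 := k2.mono (M' := N) (by rwa [d1, pow_one]) le_rfl
  replace k3 := k3.mono (M' := N) (by rwa [d1, pow_one]) le_rfl
  replace k4 := k4.mono (hKd (by omega)) le_rfl
  replace k5 := k5.mono (M' := N) (hKd (by omega)) le_rfl
  rw [e1] at k2 k3
  rw [e5] at k5
  refine ⟨σ₅, (k1.seq (k2.seq (k3.seq (k4.seq k5)))).mono le_rfl
    (by simp only [decisionSteps]; omega), ?_, ?_⟩
  · rw [v0]
    rcases v4 with ⟨-, h⟩ | ⟨-, h⟩ <;> rw [h] <;> split_ifs <;> simp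
  · rw [v0]
    by_cases ht : 0 ≤ t.num
    · have := genMatrixNorm_le_div_iff hker ht (show (0 : ℤ) < t.den by exact_mod_cast t.den_pos)
      rw [Rat.cast_def t]
      rw [Int.cast_natCast] at this
      rw [this, if_neg (not_lt.mpr ht)]
      rcases v4 with ⟨h, h'⟩ | ⟨h, h'⟩
      · simpa [h'] using h
      · simpa [h'] using h
    -- a negative number is not an upper bound for the norm
    · have h0 : (t : ℝ) < 0 := by exact_mod_cast Rat.num_neg.mp (not_le.mp ht)
      rw [if_pos (not_le.mp ht)]
      simpa using h0.trans_le ENNReal.toReal_nonneg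

/-- The invariant of the bisection: after `i` halvings, the norm lies between `x / 2 ^ i` and
`(x + U) / 2 ^ i`, with `x` in the register `12`. The bound `G` for the data does not change; `M`
bounds all registers and arrays. -/
structure Bisecting (A : Matrix (Fin m) (Fin n) ℚ) (B : Matrix (Fin l) (Fin n) ℚ) (ε : ℚ)
    (G M : ℕ) (U : ℤ) (i : ℕ) (σ : RAMState) : Prop where
  loaded : Loaded A B σ
  bounded : BoundedBy M σ
  mem_four : ∀ x y, (σ.mem 4 x y).natAbs ≤ G
  mem_five : ∀ x y, (σ.mem 5 x y).natAbs ≤ G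
  reg_three : σ.reg 3 = ε.num
  reg_four : σ.reg 4 = ε.den
  reg_eleven : σ.reg 11 = U
  reg_thirteen : σ.reg 13 = 2 ^ i
  reg_fourteen : σ.reg 14 = U * ε.den - 2 ^ i * ε.num
  nonneg : 0 ≤ σ.reg 12
  add_le : σ.reg 12 + U ≤ U * 2 ^ i
  le_norm : (σ.reg 12 : ℝ) ≤ (genMatrixNorm 2 2 (toReal B) (toReal A)).toReal * 2 ^ i
  norm_le : (genMatrixNorm 2 2 (toReal B) (toReal A)).toReal * 2 ^ i ≤ σ.reg 12 + U

/-- A bound for the number of steps of `bisectionStep`. -/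
def bisectionStepSteps (ν : ℕ) : ℕ := testSteps ν + 60

theorem bisectionStep_spec {A : Matrix (Fin m) (Fin n) ℚ} {B : Matrix (Fin l) (Fin n) ℚ} {ε : ℚ}
    (hker : KerLE (toReal B) (toReal A)) {G M ν i : ℕ} {U : ℤ} (hG : 2 ≤ G)
    (hM : G ^ (64 * ν) ≤ M) (hν : ν + 1 ≤ G) (hn : n + 1 ≤ ν) (hnn : n * n ≤ ν) (hU0 : 0 ≤ U)
    (hU : U ≤ G) (hnum : ε.num.natAbs ≤ G) (hden : ε.den ≤ G) (hi : 2 ^ (i + 1) ≤ G ^ 3)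
    {σ : RAMState} (hσ : Bisecting A B ε G M U i σ) :
    ∃ τ, Runs (M ^ (testDeg ν + 20)) bisectionStep σ τ (bisectionStepSteps ν) ∧
      Bisecting A B ε G M U (i + 1) τ := by
  have hGM : ∀ k ≤ 64 * ν, G ^ k ≤ M := fun k hk =>
    (Nat.pow_le_pow_right (by omega) hk).trans hM
  have hG1 : G ≤ M := by simpa using hGM 1 (by omega)
  have hM2 : 2 ≤ M := hG.trans hG1
  have hνM : ν + 1 ≤ M := hν.trans hG1
  have hMd : ∀ {a}, a ≤ testDeg ν + 20 → M ^ a ≤ M ^ (testDeg ν + 20) := fun h =>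
    Nat.pow_le_pow_right (by omega) h
  obtain ⟨hL, hb, hm4, hm5, r3, r4, r11, r13, r14, hx0, hxU, hle, hge⟩ := hσ
  set x := σ.reg 12 with hx
  set s := (genMatrixNorm 2 2 (toReal B) (toReal A)).toReal
  have hq : ((2 : ℤ) ^ (i + 1)) ≤ (G : ℤ) ^ 3 := by exact_mod_cast hi
  have hUq : U * 2 ^ (i + 1) ≤ (G : ℤ) ^ 4 := by
    calc U * 2 ^ (i + 1) ≤ G * (G : ℤ) ^ 3 := mul_le_mul hU hq (by positivity) (by positivity)
      _ = (G : ℤ) ^ 4 := by ring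
  have hxU' : 2 * x + U + U ≤ U * 2 ^ (i + 1) := by rw [pow_succ]; linarith
  have hG4 : G ^ 4 ≤ M := hGM 4 (by omega)
  have hG5 : G ^ 5 ≤ M := hGM 5 (by omega)
  have hG34 : G ^ 3 ≤ G ^ 4 := Nat.pow_le_pow_right (by omega) (by omega)
  zify at hG4 hG34
  have hcast : ((G ^ 4 : ℕ) : ℤ) = (G : ℤ) ^ 4 := Nat.cast_pow G 4
  -- the new denominator and the midpoint
  obtain ⟨σ₁, k1, v1, m1, f1, -⟩ := assign_spec (r := 13) (e := .const 2 * .var 13) hM2 hνM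
    (by omega) (by simp) (by simp) hb
  have w1 : σ₁.reg 13 = 2 ^ (i + 1) := by
    rw [v1]; simp [r13]; ring
  have b1 := hb.of_assign m1 f1 (by
    have : (0 : ℤ) < 2 ^ (i + 1) := by positivity
    rw [w1]; omega)
  obtain ⟨σ₂, k2, v2, m2, f2, -⟩ := assign_spec (r := 5) (e := .const 2 * .var 12 + .var 11) hM2 hνM
    (by omega) (by simp) (by simp) b1
  have w2 : σ₂.reg 5 = 2 * x + U := by
    rw [v2]; simp [f1 12 (by omega) (by omega), f1 11 (by omega) (by omega), r11, hx]
  have b2 := b1.of_assign m2 f2 (by rw [w2]; omega)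
  obtain ⟨σ₃, k3, v3, m3, f3, -⟩ := assign_spec (r := 6) (e := .var 13) hM2 hνM
    (by omega) (by simp) (by simp) b2
  have w3 : σ₃.reg 6 = 2 ^ (i + 1) := by
    rw [v3, RAMExpr.eval_var, f2 13 (by omega) (by omega), w1]
  have w3' : σ₃.reg 5 = 2 * x + U := by rw [f3 5 (by omega) (by omega), w2]
  have b3 := b2.of_assign m3 f3 (by
    have : (0 : ℤ) < 2 ^ (i + 1) := by positivity
    rw [w3]; omega)
  have g3 : ∀ y < 20, y ≠ 13 → y ≠ 5 → y ≠ 6 → σ₃.reg y = σ.reg y := fun y hy h h' h'' => by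
    rw [f3 y hy h'', f2 y hy h', f1 y hy h]
  have mem3 : σ₃.mem = σ.mem := by rw [m3, m2, m1]
  have hL3 : Loaded A B σ₃ := hL.of_eq (g3 2 (by omega) (by omega) (by omega) (by omega))
    (g3 8 (by omega) (by omega) (by omega) (by omega))
    (g3 9 (by omega) (by omega) (by omega) (by omega))
    (g3 10 (by omega) (by omega) (by omega) (by omega)) (by rw [mem3]) (by rw [mem3])
  have hGle4 : G ≤ G ^ 4 := Nat.le_self_pow (by omega) G
  obtain ⟨σ₄, k4, b4, f4, m4, m5, v4⟩ := testProgram_spec (R := G ^ 4) (M := M) (ν := ν)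
    (hG.trans hGle4) (by rw [← pow_mul]; exact hGM _ (by omega)) (hν.trans hGle4) hn hnn hL3
    (by rw [w3']; omega)
    (by
      have : (0 : ℤ) < 2 ^ (i + 1) := by positivity
      rw [w3]; omega)
    (by rw [mem3]; exact fun _ _ => (hm4 _ _).trans hGle4)
    (by rw [mem3]; exact fun _ _ => (hm5 _ _).trans hGle4) b3
  have g4 : ∀ y < 20, y ≠ 13 → y ≠ 5 → y ≠ 6 → y ≠ 15 → y ≠ 16 → σ₄.reg y = σ.reg y :=
    fun y hy h h' h'' h15 h16 => by rw [f4 y hy h15 h16, g3 y hy h h' h'']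
  rw [w3, w3', ← genMatrixNorm_le_div_iff hker (by omega) (by positivity)] at v4
  -- the new left end point
  obtain ⟨σ₅, k5, v5, m6, f5, -⟩ := assign_spec (r := 12)
    (e := .const 2 * .var 12 + (.const 1 - .var 15) * .var 11) hM2 hνM
    (by omega) (by simp) (by simp) b4
  have q11 : σ₄.reg 11 = U := by
    rw [g4 11 (by omega) (by omega) (by omega) (by omega) (by omega) (by omega), r11]
  have q12 : σ₄.reg 12 = x :=
    g4 12 (by omega) (by omega) (by omega) (by omega) (by omega) (by omega)
  have w5 : s ≤ ((2 * x + U : ℤ) : ℝ) / ((2 ^ (i + 1) : ℤ) : ℝ) ∧ σ₅.reg 12 = 2 * x ∨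
      ¬ s ≤ ((2 * x + U : ℤ) : ℝ) / ((2 ^ (i + 1) : ℤ) : ℝ) ∧ σ₅.reg 12 = 2 * x + U := by
    rw [v5]
    simp only [RAMExpr.eval_add, RAMExpr.eval_mul, RAMExpr.eval_sub, RAMExpr.eval_const,
      RAMExpr.eval_var, q11, q12]
    rcases v4 with ⟨h, h'⟩ | ⟨h, h'⟩
    · exact .inl ⟨h, by rw [h']; ring⟩
    · exact .inr ⟨h, by rw [h']; ring⟩
  have w5' : 0 ≤ σ₅.reg 12 ∧ σ₅.reg 12 + U ≤ U * 2 ^ (i + 1) := by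
    rcases w5 with ⟨-, h⟩ | ⟨-, h⟩ <;> rw [h] <;> constructor <;> linarith
  have b5 := b4.of_assign m6 f5 (by omega)
  -- the new guard
  obtain ⟨σ₆, k6, v6, m7, f6, -⟩ := assign_spec (r := 14)
    (e := .var 11 * .var 4 - .var 13 * .var 3) hM2 hνM (by omega) (by simp) (by simp) b5
  have g6 : ∀ y < 20, y ≠ 13 → y ≠ 5 → y ≠ 6 → y ≠ 15 → y ≠ 16 → y ≠ 12 → y ≠ 14 →
      σ₆.reg y = σ.reg y := fun y hy h h' h'' h15 h16 h12 h14 => by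
    rw [f6 y hy h14, f5 y hy h12, g4 y hy h h' h'' h15 h16]
  have q13 : σ₅.reg 13 = 2 ^ (i + 1) := by
    rw [f5 13 (by omega) (by omega), f4 13 (by omega) (by omega) (by omega),
      f3 13 (by omega) (by omega), f2 13 (by omega) (by omega), w1]
  have w6 : σ₆.reg 14 = U * ε.den - 2 ^ (i + 1) * ε.num := by
    have q3 : σ₅.reg 3 = ε.num := by
      rw [f5 3 (by omega) (by omega),
        g4 3 (by omega) (by omega) (by omega) (by omega) (by omega) (by omega), r3]
    have q4 : σ₅.reg 4 = ε.den := by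
      rw [f5 4 (by omega) (by omega),
        g4 4 (by omega) (by omega) (by omega) (by omega) (by omega) (by omega), r4]
    rw [v6]
    simp [f5 11 (by omega) (by omega), q11, q13, q3, q4]
  have b6 := b5.of_assign m7 f6 (by
    rw [w6]
    refine (Int.natAbs_sub_le _ _).trans (le_trans ?_ hG5)
    rw [Int.natAbs_mul, Int.natAbs_mul]
    calc _ ≤ G ^ 4 + G ^ 4 := Nat.add_le_add
          ((Nat.mul_le_mul (by omega) (by simpa using hden)).trans
            (show G * G ≤ G ^ 4 by
              rw [← sq]; exact Nat.pow_le_pow_right (by omega) (by omega)))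
          ((Nat.mul_le_mul (by simpa [Int.natAbs_pow] using hi) hnum).trans (pow_succ G 3).symm.le)
      _ = 2 * G ^ 4 := by ring
      _ ≤ G * G ^ 4 := Nat.mul_le_mul_right _ hG
      _ = G ^ 5 := by ring)
  have mm4 : σ₆.mem 4 = σ.mem 4 := by rw [m7, m6, m4, mem3]
  have mm5 : σ₆.mem 5 = σ.mem 5 := by rw [m7, m6, m5, mem3]
  have w12 : σ₆.reg 12 = σ₅.reg 12 := f6 12 (by omega) (by omega)
  have hpos : (0 : ℝ) < 2 ^ (i + 1) := by positivity
  have hs2 : s * 2 ^ (i + 1) = 2 * (s * 2 ^ i) := by ring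
  refine ⟨σ₆, ?_, ?_⟩
  · have d : ∀ {a : ℕ}, a ≤ 20 → M ^ a ≤ M ^ (testDeg ν + 20) := fun h => hMd (by omega)
    exact (Runs.seq (k1.mono (d (show 3 ≤ 20 by omega)) le_rfl)
      (Runs.seq (k2.mono (d (show 5 ≤ 20 by omega)) le_rfl)
      (Runs.seq (k3.mono (d (show 1 ≤ 20 by omega)) le_rfl)
      (Runs.seq (k4.mono (hMd (by omega)) le_rfl)
      (Runs.seq (k5.mono (d (show 9 ≤ 20 by omega)) le_rfl)
      (k6.mono (d (show 7 ≤ 20 by omega)) le_rfl)))))).mono le_rfl (by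
        simp only [bisectionStepSteps]
        change (1 + 2 + 1 + 2) + ((1 + 2 + 1 + 2 + 1 + 2) + ((2 + 2) + (testSteps ν +
          ((1 + 2 + 1 + (1 + 2 + 1 + 2 + 1) + 1 + 2) + (2 + 2 + 1 + (2 + 2 + 1) + 1 + 2))))) ≤ _
        omega)
  · refine ⟨hL.of_eq (g6 2 ?_ ?_ ?_ ?_ ?_ ?_ ?_ ?_) (g6 8 ?_ ?_ ?_ ?_ ?_ ?_ ?_ ?_)
      (g6 9 ?_ ?_ ?_ ?_ ?_ ?_ ?_ ?_) (g6 10 ?_ ?_ ?_ ?_ ?_ ?_ ?_ ?_) mm4 mm5, b6,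
      by rwa [mm4], by rwa [mm5], (g6 3 ?_ ?_ ?_ ?_ ?_ ?_ ?_ ?_).trans r3,
      (g6 4 ?_ ?_ ?_ ?_ ?_ ?_ ?_ ?_).trans r4, (g6 11 ?_ ?_ ?_ ?_ ?_ ?_ ?_ ?_).trans r11,
      (f6 13 ?_ ?_).trans q13, w6, by rw [w12]; exact w5'.1, by rw [w12]; exact w5'.2, ?_, ?_⟩
    case refine_59 =>
      rw [w12, hs2]
      rcases w5 with ⟨h, h'⟩ | ⟨h, h'⟩ <;> rw [h']
      · push_cast; linarith
      · rw [not_le, div_lt_iff₀ (by push_cast; positivity)] at h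
        push_cast at h ⊢
        linarith
    case refine_60 =>
      rw [w12]
      rcases w5 with ⟨h, h'⟩ | ⟨h, h'⟩ <;> rw [h']
      · rw [le_div_iff₀ (by push_cast; positivity)] at h
        push_cast at h ⊢
        linarith
      · push_cast; linarith
    all_goals omega

end

section

variable {l m n : ℕ}

/-- A bound for the number of steps of `bisectionProgram`, for inputs bounded by `2 ^ e`. -/
def bisectionSteps (ν e : ℕ) : ℕ :=
  initSteps ν + RAMExpr.boundExpr.steps ν +
    3 * e * (initDeg ν ^ 5 * RAMExpr.boundExpr.deg ν) * (bisectionStepSteps ν + 1) + 40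

/-- A bound for the factor by which the lengths of the numbers handled by `bisectionProgram` exceed
that of the input. -/
def bisectionDeg (ν : ℕ) : ℕ :=
  initDeg ν ^ 6 * RAMExpr.boundExpr.deg ν * (64 * ν) * (testDeg ν + 20)

/-- The value of `boundExpr`. -/
theorem eval_boundExpr {A : Matrix (Fin m) (Fin n) ℚ} {B : Matrix (Fin l) (Fin n) ℚ}
    {σ : RAMState} (h : Loaded A B σ) : RAMExpr.boundExpr.eval σ =
      normBound (scaled (commonDen A B) A) (scaled (commonDen A B) B) := by
  have h4 := h.mem_four
  have h5 := h.mem_five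
  simp [RAMExpr.boundExpr, h.reg_two, RAMState.set_reg, Finset.sum_range, normBound, Matrix.trace,
    h4, h5]

theorem bisectionProgram_spec {A : Matrix (Fin m) (Fin n) ℚ} {B : Matrix (Fin l) (Fin n) ℚ} {ε : ℚ}
    (hker : KerLE (toReal B) (toReal A)) (hε : 0 < ε) {e ν : ℕ} (he : 1 ≤ e) (hν : ν + 1 ≤ 2 ^ e)
    (hl : l ≤ ν) (hm : m ≤ ν) (hn : n + 1 ≤ ν) (hnn : n * n ≤ ν)
    (hin : BoundedBy (2 ^ e) (inputState A B ε)) :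
    ∃ τ, Runs ((2 ^ e) ^ bisectionDeg ν) bisectionProgram (inputState A B ε) τ
        (bisectionSteps ν e) ∧ 0 < τ.reg 1 ∧
      |(τ.reg 0 : ℝ) / (τ.reg 1 : ℝ) - (genMatrixNorm 2 2 (toReal B) (toReal A)).toReal| ≤ ε := by
  have hM : 2 ≤ 2 ^ e := Nat.le_self_pow (by omega) 2
  obtain ⟨σ₁, k1, b1, h1, f1⟩ := initProgram_spec A B ε hM hν hl hm (by omega) hin
  have hD : 1 ≤ initDeg ν := by simp [initDeg]
  have hdU := RAMExpr.one_le_deg ν .boundExpr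
  obtain ⟨R, hR⟩ : ∃ R, R = (2 ^ e) ^ initDeg ν ^ 5 := ⟨_, rfl⟩
  obtain ⟨G, hG⟩ : ∃ G, G = R ^ RAMExpr.boundExpr.deg ν := ⟨_, rfl⟩
  obtain ⟨K, hK⟩ : ∃ K, K = G ^ (64 * ν) := ⟨_, rfl⟩
  rw [← hR] at b1
  have hMR : 2 ^ e ≤ R := by rw [hR]; exact Nat.le_self_pow (by positivity) _
  have hRG : R ≤ G := by rw [hG]; exact Nat.le_self_pow (by omega) _
  have hGK : G ≤ K := by rw [hK]; exact Nat.le_self_pow (by omega) _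
  have hG2 : 2 ≤ G := by omega
  -- the a priori bound
  obtain ⟨σ₂, k2, v2, m2, f2, b2⟩ := assign_spec (r := 11) (e := .boundExpr) (M := R) (ν := ν)
    (by omega) (by omega) (by omega) (by simp [RAMExpr.boundExpr]) (by
      have hn' : n ≤ ν := by omega
      simp [RAMExpr.boundExpr, RAMState.set_reg, h1.reg_two, hn']) b1
  rw [eval_boundExpr h1] at v2
  have hU1 := one_le_normBound (scaled (commonDen A B) A) (scaled (commonDen A B) B)
  have hUs := genMatrixNorm_le_normBound hker
  set U := normBound (scaled (commonDen A B) A) (scaled (commonDen A B) B)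
  rw [← hG] at b2 k2
  have hUG : U ≤ G := by have := b2.reg 11 (by omega); omega
  obtain ⟨σ₃, k3, v3, m3, f3, -⟩ := assign_spec (r := 13) (e := .const 1) (M := G) (ν := ν)
    (by omega) (by omega) (by omega) (by simp) (by simp) b2
  rw [RAMExpr.eval_const] at v3
  have b3 := b2.of_assign m3 f3 (by omega)
  obtain ⟨σ₄, k4, v4, m4, f4, b4⟩ := assign_spec (r := 14) (M := G) (ν := ν)
    (e := .var 11 * .var 4 - .var 13 * .var 3) (by omega) (by omega) (by omega) (by simp)
    (by simp) b3
  have d4 : (RAMExpr.var 11 * .var 4 - .var 13 * .var 3).deg ν = 7 := rfl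
  have hpow : ∀ {k}, k ≤ 64 * ν → G ^ k ≤ K := fun h => by
    rw [hK]; exact Nat.pow_le_pow_right (by omega) h
  replace b4 := b4.mono (show _ ≤ K by rw [d4]; exact hpow (by omega))
  have g4 : ∀ y < 20, y ≠ 7 → y ≠ 8 → y ≠ 10 → y ≠ 11 → y ≠ 13 → y ≠ 14 →
      σ₄.reg y = (inputState A B ε).reg y := fun y hy h7 h8 h10 h11 h13 h14 => by
    rw [f4 y hy h14, f3 y hy h13, f2 y hy h11, f1 y hy h7 h8 h10]
  have q3 : σ₄.reg 3 = ε.num :=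
    g4 3 (by omega) (by omega) (by omega) (by omega) (by omega) (by omega) (by omega)
  have q4 : σ₄.reg 4 = ε.den :=
    g4 4 (by omega) (by omega) (by omega) (by omega) (by omega) (by omega) (by omega)
  have q12 : σ₄.reg 12 = 0 :=
    g4 12 (by omega) (by omega) (by omega) (by omega) (by omega) (by omega) (by omega)
  have q11 : σ₄.reg 11 = U := by rw [f4 11 (by omega) (by omega), f3 11 (by omega) (by omega), v2]
  have q13 : σ₄.reg 13 = 1 := by rw [f4 13 (by omega) (by omega), v3]
  have q14 : σ₄.reg 14 = U * ε.den - 2 ^ 0 * ε.num := by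
    rw [f4 3 (by omega) (by omega)] at q3
    rw [f4 4 (by omega) (by omega)] at q4
    rw [f4 11 (by omega) (by omega)] at q11
    rw [v4]
    simp [q3, q4, q11, v3]
  have mem4 : σ₄.mem = σ₂.mem := by rw [m4, m3]
  have hg : ∀ y < 11, σ₄.reg y = σ₁.reg y := fun y hy => by
    rw [f4 y (by omega) (by omega), f3 y (by omega) (by omega), f2 y (by omega) (by omega)]
  have hnumG : ε.num.natAbs ≤ G := by
    have := (hin.reg 3 (by omega)).trans (hMR.trans hRG)
    exact this
  have hdenG : ε.den ≤ G := by
    have := (hin.reg 4 (by omega)).trans (hMR.trans hRG)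
    exact this
  have hnum : 0 < ε.num := Rat.num_pos.mpr hε
  have hinv : Bisecting A B ε G K U 0 σ₄ :=
    { loaded := h1.of_eq (hg 2 (by omega)) (hg 8 (by omega)) (hg 9 (by omega)) (hg 10 (by omega))
        (by rw [mem4, m2]) (by rw [mem4, m2])
      bounded := b4
      mem_four := by rw [mem4]; exact b2.mem 4
      mem_five := by rw [mem4]; exact b2.mem 5
      reg_three := q3
      reg_four := q4
      reg_eleven := q11
      reg_thirteen := by rw [q13]; rfl
      reg_fourteen := q14
      nonneg := q12.ge
      add_le := by rw [q12]; simp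
      le_norm := by rw [q12]; simp
      norm_le := by rw [q12]; simpa using hUs }
  -- the number of halvings
  have hex : ∃ k : ℕ, U * ε.den ≤ 2 ^ k * ε.num := by
    refine ⟨(U * ε.den).toNat, ?_⟩
    have h2 : (U * ε.den).toNat < 2 ^ (U * ε.den).toNat := Nat.lt_two_pow_self
    have h3 : U * ε.den ≤ (2 : ℤ) ^ (U * ε.den).toNat :=
      (Int.self_le_toNat _).trans (by exact_mod_cast h2.le)
    nlinarith
  let N := Nat.find hex
  have hN : U * ε.den ≤ 2 ^ N * ε.num := Nat.find_spec hex
  have hlt : ∀ i < N, 2 ^ i * ε.num < U * ε.den := fun i hi => not_le.mp (Nat.find_min hex hi)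
  -- hence `2 ^ N ≤ G ^ 3`, since `N` is minimal
  have hle : ∀ i < N, 2 ^ (i + 1) ≤ G ^ 3 := fun i hi => by
    have h2 := hlt i hi
    have h3 : U * ε.den ≤ (G : ℤ) * G :=
      mul_le_mul hUG (by exact_mod_cast hdenG) (by positivity) (by positivity)
    have h4 : (2 : ℤ) ^ i ≤ 2 ^ i * ε.num := le_mul_of_one_le_right (by positivity) (by omega)
    have h5 : 2 ^ i ≤ G * G := by
      have : (2 : ℤ) ^ i ≤ (G : ℤ) * G := by linarith
      exact_mod_cast this
    calc 2 ^ (i + 1) = 2 * 2 ^ i := by ring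
      _ ≤ G * (G * G) := Nat.mul_le_mul hG2 h5
      _ = G ^ 3 := by ring
  have hNle : N ≤ 3 * e * (initDeg ν ^ 5 * RAMExpr.boundExpr.deg ν) := by
    rcases Nat.eq_zero_or_pos N with h | h
    · omega
    · have := hle (N - 1) (by omega)
      rw [show N - 1 + 1 = N by omega, hG, hR, ← pow_mul, ← pow_mul, ← pow_mul,
        Nat.pow_le_pow_iff_right (by omega)] at this
      linarith
  have hKK : K ≤ K ^ (testDeg ν + 20) := Nat.le_self_pow (by omega) K
  obtain ⟨σ₅, k5, h5⟩ := Runs.whilePos (M := K ^ (testDeg ν + 20)) (r := 14)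
    (a := bisectionStepSteps ν) (n := N) (P := bisectionStep) (Bisecting A B ε G K U)
    (fun i σ h => (h.bounded.reg 14 (by omega)).trans hKK)
    (fun i hi σ h => ⟨by rw [h.reg_fourteen]; have := hlt i hi; omega,
      bisectionStep_spec hker hG2 hK.ge (by omega) hn hnn (by omega) hUG hnumG hdenG (hle i hi) h⟩)
    (fun σ h => by rw [h.reg_fourteen]; omega) hinv
  obtain ⟨σ₆, k6, v6, m6, f6, b6⟩ := assign_spec (r := 0) (e := .var 12) (M := K) (ν := ν)
    (by omega) (by omega) (by omega) (by simp) (by simp) h5.bounded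
  have d1 : ∀ r, (RAMExpr.var r).deg ν = 1 := fun _ => rfl
  have e1 : ∀ r, (RAMExpr.var r).steps ν = 2 := fun _ => rfl
  have d3 : (RAMExpr.const 1).deg ν = 1 := rfl
  have e3 : (RAMExpr.const 1).steps ν = 1 := rfl
  have e4 : (RAMExpr.var 11 * .var 4 - .var 13 * .var 3).steps ν = 11 := rfl
  rw [d1, pow_one] at b6 k6
  obtain ⟨σ₇, k7, v7, m7, f7, -⟩ := assign_spec (r := 1) (e := .var 13) (M := K) (ν := ν)
    (by omega) (by omega) (by omega) (by simp) (by simp) b6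
  rw [d1, pow_one] at k7
  rw [d3, pow_one] at k3
  rw [d4] at k4
  rw [e1] at k6 k7
  rw [e3] at k3
  rw [e4] at k4
  have w0 : σ₇.reg 0 = σ₅.reg 12 := by rw [f7 0 (by omega) (by omega), v6]; rfl
  have w1 : σ₇.reg 1 = 2 ^ N := by
    rw [v7, RAMExpr.eval_var, f6 13 (by omega) (by omega), h5.reg_thirteen]
  have hfin : K ^ (testDeg ν + 20) ≤ (2 ^ e) ^ bisectionDeg ν := by
    have h : ∀ x a b c d : ℕ, (((x ^ a) ^ b) ^ c) ^ d = x ^ (a * b * c * d) := fun x a b c d => by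
      rw [pow_mul, pow_mul, pow_mul]
    rw [hK, hG, hR, h, bisectionDeg]
    exact Nat.pow_le_pow_right (by omega) (Nat.mul_le_mul_right _ (Nat.mul_le_mul_right _
      (Nat.mul_le_mul_right _ (Nat.pow_le_pow_right hD (by omega)))))
  have hini : (2 ^ e) ^ initDeg ν ^ 6 ≤ (2 ^ e) ^ bisectionDeg ν := by
    refine Nat.pow_le_pow_right (by omega) ?_
    rw [bisectionDeg, mul_assoc, mul_assoc]
    refine Nat.le_mul_of_pos_right _ (Nat.mul_pos (by omega) (Nat.mul_pos (by omega) (by omega)))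
  generalize (2 ^ e) ^ bisectionDeg ν = F at hfin hini
  replace k1 := k1.mono hini le_rfl
  replace k2 := k2.mono ((hGK.trans hKK).trans hfin) le_rfl
  replace k3 := k3.mono ((hGK.trans hKK).trans hfin) le_rfl
  replace k4 := k4.mono (((hpow (by omega)).trans hKK).trans hfin) le_rfl
  replace k5 := k5.mono hfin le_rfl
  replace k6 := k6.mono (hKK.trans hfin) le_rfl
  replace k7 := k7.mono (hKK.trans hfin) le_rfl
  refine ⟨σ₇, (k1.seq (k2.seq (k3.seq (k4.seq (k5.seq (k6.seq k7)))))).mono le_rfl ?_, ?_, ?_⟩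
  · have := Nat.mul_le_mul_right (bisectionStepSteps ν + 1) hNle
    simp only [bisectionSteps]
    omega
  · rw [w1]; positivity
  · have hx1 := h5.le_norm
    have hx2 := h5.norm_le
    rw [w0, w1]
    set s := (genMatrixNorm 2 2 (toReal B) (toReal A)).toReal
    set x := σ₅.reg 12
    have hq : (0 : ℝ) < 2 ^ N := by positivity
    have hUε : (U : ℝ) ≤ ε * 2 ^ N := by
      have hden : (0 : ℝ) < ε.den := by exact_mod_cast ε.den_pos
      have : (U : ℝ) * ε.den ≤ 2 ^ N * ε.num := by exact_mod_cast hN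
      rw [Rat.cast_def ε, div_mul_eq_mul_div, le_div_iff₀ hden]
      linarith
    push_cast
    rw [abs_le]
    constructor
    · have : s ≤ x / 2 ^ N + ε := by
        rw [← sub_le_iff_le_add, le_div_iff₀ hq]
        linarith
      linarith
    · have : (x : ℝ) / 2 ^ N ≤ s := by rw [div_le_iff₀ hq]; exact hx1
      have : (0 : ℝ) < ε := by exact_mod_cast hε
      linarith

end

/-! ### Polynomial bounds -/

/-- The function `f` is a polynomial function with coefficients in `ℕ`. -/
def IsPolyNat (f : ℕ → ℕ) : Prop := ∃ p : Polynomial ℕ, ∀ x, f x = p.eval x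

namespace IsPolyNat

variable {f g : ℕ → ℕ}

theorem const (c : ℕ) : IsPolyNat fun _ => c := ⟨.C c, fun x => by simp⟩

theorem id : IsPolyNat fun x => x := ⟨.X, fun x => by simp⟩

theorem add : IsPolyNat f → IsPolyNat g → IsPolyNat fun x => f x + g x :=
  fun ⟨p, hp⟩ ⟨q, hq⟩ => ⟨p + q, fun x => by simp [hp, hq]⟩

theorem mul : IsPolyNat f → IsPolyNat g → IsPolyNat fun x => f x * g x :=
  fun ⟨p, hp⟩ ⟨q, hq⟩ => ⟨p * q, fun x => by simp [hp, hq]⟩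

theorem pow (k : ℕ) : IsPolyNat f → IsPolyNat fun x => f x ^ k :=
  fun ⟨p, hp⟩ => ⟨p ^ k, fun x => by simp [hp]⟩

theorem comp : IsPolyNat f → IsPolyNat g → IsPolyNat fun x => f (g x) :=
  fun ⟨p, hp⟩ ⟨q, hq⟩ => ⟨p.comp q, fun x => by simp [hp, hq]⟩

theorem monotone : IsPolyNat f → Monotone f := fun ⟨p, hp⟩ x y hxy => by
  rw [hp, hp, Polynomial.eval_eq_sum, Polynomial.eval_eq_sum]
  exact Finset.sum_le_sum fun i _ => Nat.mul_le_mul_left _ (Nat.pow_le_pow_left hxy i)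

theorem steps (e : RAMExpr) : IsPolyNat fun ν => e.steps ν := e.exists_steps_eq

theorem deg (e : RAMExpr) : IsPolyNat fun ν => e.deg ν := e.exists_deg_eq

theorem tabulateSteps (e : RAMExpr) : IsPolyNat fun ν => tabulateSteps ν e :=
  (id.mul ((id.mul ((steps e).add (const 12))).add (const 7))).add (const 3)

theorem initDeg : IsPolyNat initDeg := ((deg _).add (deg _)).add (const 6)

theorem initSteps : IsPolyNat initSteps :=
  ((steps _).add ((const 2).mul (tabulateSteps _))).add (const 12)

theorem testDeg : IsPolyNat testDeg :=
  ((((deg _).add (deg _)).add (deg _)).add (deg _)).add (const 10)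

theorem testSteps : IsPolyNat testSteps :=
  (((((tabulateSteps _).add (tabulateSteps _)).add (tabulateSteps _)).add
    (tabulateSteps _)).add (steps _)).add (const 20)

theorem decisionSteps : IsPolyNat decisionSteps := (initSteps.add testSteps).add (const 26)

theorem decisionDeg : IsPolyNat decisionDeg :=
  ((initDeg.pow 6).mul ((const 16).mul id)).mul (testDeg.add (const 20))

theorem bisectionDeg : IsPolyNat bisectionDeg :=
  (((initDeg.pow 6).mul (deg _)).mul ((const 64).mul id)).mul (testDeg.add (const 20))

theorem bisectionSteps (hf : IsPolyNat f) (hg : IsPolyNat g) :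
    IsPolyNat fun x => bisectionSteps (f x) (g x) :=
  (((initSteps.comp hf).add ((steps _).comp hf)).add ((((const 3).mul hg).mul
    (((initDeg.comp hf).pow 5).mul ((deg _).comp hf))).mul
      (((testSteps.comp hf).add (const 60)).add (const 1)))).add (const 40)

end IsPolyNat

/-- The bit cost of a run whose integers have length at most `e * E + 1`. -/
theorem Runs.cost_le {e E a : ℕ} {P : RAMProgram} {σ τ : RAMState}
    (h : Runs ((2 ^ e) ^ E) P σ τ a) :
    ∃ a' c, RAMRun P σ τ a' c ∧ a' ≤ a ∧ c ≤ a * (3 * (e * E + 1) + 1) := by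
  obtain ⟨a', c, hr, ha, hc⟩ := h
  rw [← pow_mul, Nat.size_pow] at hc
  exact ⟨a', c, hr, ha, hc.trans (Nat.mul_le_mul_right _ ha)⟩

section

variable {l m n : ℕ}

theorem natAbs_le_two_pow {x : ℤ} {k : ℕ} (h : bitLen x ≤ k) : x.natAbs ≤ 2 ^ k :=
  (Nat.lt_size_self _).le.trans (Nat.pow_le_pow_right (by omega) h)

theorem bitLen_toArray_le {M : Fin m → Fin n → ℤ} {k : ℕ} (h : ∀ i j, bitLen (M i j) ≤ k)
    (x y : ℤ) : bitLen (toArray M x y) ≤ k := by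
  rw [toArray]
  split_ifs
  · exact h _ _
  · simp [bitLen]

theorem ratLen_le_sum (A : Matrix (Fin m) (Fin n) ℚ) (i : Fin m) (j : Fin n) :
    ratLen (A i j) ≤ ∑ i, ∑ j, ratLen (A i j) :=
  (Finset.single_le_sum (f := fun j => ratLen (A i j)) (fun _ _ => Nat.zero_le _)
    (Finset.mem_univ j)).trans
    (Finset.single_le_sum (f := fun i => ∑ j, ratLen (A i j)) (fun _ _ => Nat.zero_le _)
      (Finset.mem_univ i))

theorem boundedBy_inputState (A : Matrix (Fin m) (Fin n) ℚ) (B : Matrix (Fin l) (Fin n) ℚ) (t : ℚ)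
    {k : ℕ} (hk : inputSize A B t ≤ k) : BoundedBy (2 ^ k) (inputState A B t) := by
  unfold inputSize at hk
  have hdim : ∀ d : ℕ, d ≤ k → (d : ℤ).natAbs ≤ 2 ^ k := fun d hd => by
    simpa using hd.trans Nat.lt_two_pow_self.le
  have hA := ratLen_le_sum A
  have hB := ratLen_le_sum B
  have ht : ratLen t = bitLen t.num + bitLen t.den := rfl
  constructor
  · intro r _
    match r with
    | 0 => exact hdim l (by omega)
    | 1 => exact hdim m (by omega)
    | 2 => exact hdim n (by omega)
    | 3 => exact natAbs_le_two_pow (x := t.num) (by omega)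
    | 4 => exact natAbs_le_two_pow (x := t.den) (by omega)
    | r + 5 => exact Nat.zero_le _
  · intro b x y
    have h1 : ∀ i j, bitLen (A i j).num ≤ k ∧ bitLen (A i j).den ≤ k := fun i j => by
      have := hA i j
      simp only [ratLen] at this hk
      omega
    have h2 : ∀ i j, bitLen (B i j).num ≤ k ∧ bitLen (B i j).den ≤ k := fun i j => by
      have := hB i j
      simp only [ratLen] at this hk
      omega
    match b with
    | 0 => exact natAbs_le_two_pow (bitLen_toArray_le (M := fun i j => (A i j).num)
        (fun i j => (h1 i j).1) x y)
    | 1 => exact natAbs_le_two_pow (bitLen_toArray_le (M := fun i j => ((A i j).den : ℤ))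
        (fun i j => (h1 i j).2) x y)
    | 2 => exact natAbs_le_two_pow (bitLen_toArray_le (M := fun i j => (B i j).num)
        (fun i j => (h2 i j).1) x y)
    | 3 => exact natAbs_le_two_pow (bitLen_toArray_le (M := fun i j => ((B i j).den : ℤ))
        (fun i j => (h2 i j).2) x y)
    | b + 4 => exact Nat.zero_le _

theorem sq_add_one_le_two_pow (s : ℕ) : (s + 1) ^ 2 + 1 ≤ 2 ^ (2 * (s + 1)) := by
  have h : s + 1 < 2 ^ (s + 1) := Nat.lt_two_pow_self
  rw [mul_comm, pow_mul]
  nlinarith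

/-! ### Polynomial time -/

theorem exists_bisection_polynomial : ∃ f : Polynomial ℕ,
    ∀ (l m n : ℕ) (A : Matrix (Fin m) (Fin n) ℚ) (B : Matrix (Fin l) (Fin n) ℚ) (ε : ℚ),
      KerLE (toReal B) (toReal A) → 0 < ε →
      ∃ (τ : RAMState) (a c : ℕ), RAMRun bisectionProgram (inputState A B ε) τ a c ∧
        c ≤ f.eval (inputSize A B ε) ∧ 0 < τ.reg 1 ∧
        |(τ.reg 0 : ℝ) / (τ.reg 1 : ℝ) - (genMatrixNorm 2 2 (toReal B) (toReal A)).toReal|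
          ≤ (ε : ℝ) := by
  have hν : IsPolyNat fun s => (s + 1) ^ 2 := (IsPolyNat.id.add (.const 1)).pow 2
  have he : IsPolyNat fun s => 2 * (s + 1) := (IsPolyNat.const 2).mul (IsPolyNat.id.add (.const 1))
  obtain ⟨f, hf⟩ := (IsPolyNat.bisectionSteps hν he).mul (((IsPolyNat.const 3).mul
    ((he.mul (IsPolyNat.bisectionDeg.comp hν)).add (.const 1))).add (.const 1))
  refine ⟨f, fun l m n A B ε hker hε => ?_⟩
  rw [← hf]
  set s := inputSize A B ε with hs
  have hdim : l + m + n ≤ s := by rw [hs, inputSize]; omega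
  obtain ⟨τ, hrun, hpos, hτ⟩ := bisectionProgram_spec (e := 2 * (s + 1)) (ν := (s + 1) ^ 2) hker hε
    (by omega) (sq_add_one_le_two_pow s) (by nlinarith) (by nlinarith) (by nlinarith) (by nlinarith)
    (boundedBy_inputState A B ε (by omega))
  obtain ⟨a, c, hr, -, hc⟩ := hrun.cost_le
  exact ⟨τ, a, c, hr, hc, hpos, hτ⟩

theorem exists_decision_polynomials : ∃ f g : Polynomial ℕ,
    ∀ (l m n : ℕ) (A : Matrix (Fin m) (Fin n) ℚ) (B : Matrix (Fin l) (Fin n) ℚ) (t : ℚ),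
      KerLE (toReal B) (toReal A) →
      ∃ (τ : RAMState) (a c : ℕ), RAMRun decisionProgram (inputState A B t) τ a c ∧
        a ≤ g.eval (l + m + n) ∧ c ≤ f.eval (inputSize A B t) ∧
        (τ.reg 0 = 0 ∨ τ.reg 0 = 1) ∧
        (τ.reg 0 = 1 ↔ (genMatrixNorm 2 2 (toReal B) (toReal A)).toReal ≤ (t : ℝ)) := by
  have hν : IsPolyNat fun s => (s + 1) ^ 2 := (IsPolyNat.id.add (.const 1)).pow 2
  have he : IsPolyNat fun s => 2 * (s + 1) := (IsPolyNat.const 2).mul (IsPolyNat.id.add (.const 1))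
  have hsteps := IsPolyNat.decisionSteps.comp hν
  have hdeg := IsPolyNat.decisionDeg.comp hν
  have ⟨g, hg⟩ := hsteps
  obtain ⟨f, hf⟩ := hsteps.mul (((IsPolyNat.const 3).mul ((he.mul hdeg).add (.const 1))).add
    (.const 1))
  refine ⟨f, g, fun l m n A B t hker => ?_⟩
  rw [← hf, ← hg]
  set s := inputSize A B t with hs
  -- the number of steps must not depend on the lengths of the entries, so `ν` is chosen in terms of
  -- the dimensions only
  set d := l + m + n with hd
  have hdim : d ≤ s := by rw [hs, inputSize]; omega
  have hle : (d + 1) ^ 2 ≤ (s + 1) ^ 2 := Nat.pow_le_pow_left (by omega) 2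
  obtain ⟨τ, hrun, hbool, hτ⟩ := decisionProgram_spec (M := 2 ^ (2 * (s + 1))) (ν := (d + 1) ^ 2)
    hker (by have := sq_add_one_le_two_pow s; nlinarith)
    ((Nat.add_le_add_right hle 1).trans (sq_add_one_le_two_pow s)) (by nlinarith) (by nlinarith)
    (by nlinarith) (by nlinarith) (boundedBy_inputState A B t (by omega))
  obtain ⟨a, c, hr, ha, hc⟩ := hrun.cost_le
  refine ⟨τ, a, c, hr, ha, hc.trans ?_, hbool, hτ⟩
  have h1 := IsPolyNat.decisionSteps.monotone hle
  have h2 := Nat.mul_le_mul_left (2 * (s + 1)) (IsPolyNat.decisionDeg.monotone hle)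
  exact Nat.mul_le_mul h1 (by omega)

end

theorem mainTheorem9 :
    -- the case `Ker B ⊆ Ker A`: finiteness, attainment, and the formula
    (∀ (l m n : ℕ) (A : Matrix (Fin m) (Fin n) ℝ) (B : Matrix (Fin l) (Fin n) ℝ), KerLE B A →
      genMatrixNorm 2 2 B A = matrixNorm 2 2 (A * pinv B) ∧
      genMatrixNorm 2 2 B A ≠ ⊤ ∧
      (∃ v : Fin n → ℝ, vecNorm 2 (B.mulVec v) ≤ 1 ∧
        ENNReal.ofReal (vecNorm 2 (A.mulVec v)) = genMatrixNorm 2 2 B A) ∧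
      (∃ w : Fin l → ℝ, vecNorm 2 w ≤ 1 ∧
        ENNReal.ofReal (vecNorm 2 ((A * pinv B).mulVec w)) = matrixNorm 2 2 (A * pinv B))) ∧
    -- evaluation up to any prescribed error in polynomial bit time
    (∃ (P : RAMProgram) (f : Polynomial ℕ),
      ∀ (l m n : ℕ) (A : Matrix (Fin m) (Fin n) ℚ) (B : Matrix (Fin l) (Fin n) ℚ) (ε : ℚ),
        KerLE (toReal B) (toReal A) → 0 < ε →
        ∃ (τ : RAMState) (a c : ℕ), RAMRun P (inputState A B ε) τ a c ∧
          c ≤ f.eval (inputSize A B ε) ∧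
          0 < τ.reg 1 ∧
          |(τ.reg 0 : ℝ) / (τ.reg 1 : ℝ) - (genMatrixNorm 2 2 (toReal B) (toReal A)).toReal|
            ≤ (ε : ℝ)) ∧
    -- exact comparison with any rational number: polynomially many steps in `l`, `m`, `n`,
    -- and polynomial bit time
    (∃ (P : RAMProgram) (f g : Polynomial ℕ),
      ∀ (l m n : ℕ) (A : Matrix (Fin m) (Fin n) ℚ) (B : Matrix (Fin l) (Fin n) ℚ) (t : ℚ),
        KerLE (toReal B) (toReal A) →
        ∃ (τ : RAMState) (a c : ℕ), RAMRun P (inputState A B t) τ a c ∧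
          a ≤ g.eval (l + m + n) ∧
          c ≤ f.eval (inputSize A B t) ∧
          (τ.reg 0 = 0 ∨ τ.reg 0 = 1) ∧
          (τ.reg 0 = 1 ↔ (genMatrixNorm 2 2 (toReal B) (toReal A)).toReal ≤ (t : ℝ))) ∧
    -- the case `Ker B ⊄ Ker A`
    (∀ (l m n : ℕ) (A : Matrix (Fin m) (Fin n) ℝ) (B : Matrix (Fin l) (Fin n) ℝ), ¬ KerLE B A →
      genMatrixNorm 2 2 B A = ⊤) := by
  refine ⟨fun l m n A B h => ⟨genMatrixNorm_eq_matrixNorm h, genMatrixNorm_ne_top h,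
    exists_eq_genMatrixNorm h, exists_eq_matrixNorm _⟩, ?_, ?_,
    fun l m n A B h => genMatrixNorm_eq_top h⟩
  · exact ⟨bisectionProgram, exists_bisection_polynomial⟩
  · exact ⟨decisionProgram, exists_decision_polynomials⟩
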